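/- **Setting.** An \emph{abstract open book} $(P,\psi)$ consists of a compact oriented smooth surface $P$ with boundary, none of whose connected components is closed, and a diffeomorphism $\psi:P\to P$ that is the identity near $\partial P$. Its \emph{mapping torus} is $P_\psi=(\mathbb R\times P)/\big((t+1,p)\sim(t,\psi(p))\big)$, fibred over $S^1=\mathbb R/\mathbb Z$ by $\phi=[t]$ and oriented as a product; the tangent planes of the fibres form the \emph{vertical distribution} on $P_\psi$. Choose disjoint collars $[1,2)\times S^1\ni(\rho,\theta)$ of the components of $\partial P=\{\rho=1\}$ such that $d\theta\wedge d\rho$ is positive on $P$. Let $M$ be the closed oriented $3$-manifold obtained from $P_\psi$ by gluing to each boundary component a solid torus $S^1\times\{|z|\le 1\}$ with coordinates $(\theta,\; z=\rho e^{2\pi i\phi})$ along its boundary $\rho=1$, such that the coordinates $(\theta,\rho,\phi)$ match smoothly with those on the collar of that boundary component of $P_\psi$. The coordinate $\phi$ defines a fibration $\pi:M\setminus B\to S^1$, where the binding $B$ is the union of the circles $\{z=0\}$; its fibres, the pages, are oriented by $P$, and $B$ is oriented as the boundary of the pages. All plane fields below are smooth and coorientable. With respect to the orientation of $M$, $\ker\lambda$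 is a \emph{confoliation} if $\lambda\wedge d\lambda\ge 0$ and a \emph{(positive) contact structure} if $\lambda\wedge d\lambda>0$. A contact structure $\xi$ is \emph{supported} by the open book if $\xi=\ker\lambda$ for a contact form $\lambda$ that is positive on $B$ and has $d\lambda$ positive on the pages. A \emph{stable Hamiltonian structure} on $M$ is a triple $(\xi,X,\omega)$ of a plane field $\xi$, a smooth vector field $X$ transverse to $\xi$ whose flow preserves $\xi$, and a smooth closed $2$-form $\omega$ with $\omega|_\xi>0$ (where $\xi$ is oriented by $X$ and the orientation of $M$) and $\iota_X\omega=0$. **Proposition.** For every such $(P,\psi)$ and $M$ there are $\epsilon_0>0$, a stable Hamiltonian structure $\mathcal H_0=(\xi_0,X_0,\omega_0)$ on $M$ and stable Hamiltonian structures $\mathcal H_\epsilon=(\xi_\epsilon,X_\epsilon,\omega_\epsilon)$ on $M$ for $0<\epsilon<\epsilon_0$ such that 1. $\xi_0$ is a confoliation that restricts to the vertical distribution on $P_\psi$, and $X_0$ is positively transverse to the fibres of $P_\psi\to S^1$; 2. for every $\epsilon\in(0,\epsilon_0)$, $\xi_\epsilon$ is a contact structure supported by the open book; 3. $\mathcal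 H_\epsilon\to\mathcal H_0$ in the $C^\infty$ topology as $\epsilon\to0$, that is $\xi_\epsilon\to\xi_0$, $X_\epsilon\to X_0$ and $\omega_\epsilon\to\omega_0$. -/

import Mathlib

open Set Filter Topology Function
open scoped Manifold ContDiff

noncomputable section

namespace OpenBook

/-! ### Differential forms and vector fields on manifolds -/

section Forms

variable {E : Type*} [NormedAddCommGroup E] [NormedSpace ℝ E]
  {H : Type*} [TopologicalSpace H] {I : ModelWithCorners ℝ E H}
  {M : Type*} [TopologicalSpace M] [ChartedSpace H M] {k : ℕ}

/-- A (not necessarily smooth) differential `k`-form on `M`. -/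
abbrev DiffForm (I : ModelWithCorners ℝ E H) (M : Type*) [TopologicalSpace M] [ChartedSpace H M]
    (k : ℕ) : Type _ :=
  ∀ x : M, (TangentSpace I x) [⋀^Fin k]→L[ℝ] ℝ

/-- The expression of `Ω` in the preferred chart at `x₀`: its pullback to the target of that chart
under the inverse of the chart. -/
def DiffForm.inChart (Ω : DiffForm I M k) (x₀ : M) (y : E) : E [⋀^Fin k]→L[ℝ] ℝ :=
  (Ω ((extChartAt I x₀).symm y)).compContinuousLinearMap
    (mfderivWithin 𝓘(ℝ, E) I (extChartAt I x₀).symm (range I) y)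

/-- A form is smooth if it is smooth in every chart. -/
def DiffForm.Smooth (Ω : DiffForm I M k) : Prop :=
  ∀ x₀ : M, ContDiffOn ℝ ∞ (Ω.inChart x₀) (extChartAt I x₀).target

/-- The exterior derivative, computed at each point `x` in the preferred chart at `x`. -/
def DiffForm.d (Ω : DiffForm I M k) : DiffForm I M (k + 1) := fun x =>
  (extDerivWithin (Ω.inChart x) (range I) (extChartAt I x x)).compContinuousLinearMap
    (mfderiv I 𝓘(ℝ, E) (extChartAt I x) x)

/-- `(α ∧ β)_x (u, v, w)` for a 1-form `α` and a 2-form `β`. -/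
def wedge (α : DiffForm I M 1) (β : DiffForm I M 2) (x : M) (u v w : TangentSpace I x) : ℝ :=
  α x ![u] * β x ![v, w] - α x ![v] * β x ![u, w] + α x ![w] * β x ![u, v]

/-- The expression of a vector field in the preferred chart at `x₀`. -/
def vfInChart (X : ∀ x : M, TangentSpace I x) (x₀ : M) (y : E) : E :=
  mfderiv I 𝓘(ℝ, E) (extChartAt I x₀) ((extChartAt I x₀).symm y) (X ((extChartAt I x₀).symm y))

/-- A vector field is smooth if it is a smooth section of the tangent bundle. -/
def SmoothVF [IsManifold I 1 M] (X : ∀ x : M, TangentSpace I x) : Prop :=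
  ContMDiff I I.tangent ∞ (fun x => (⟨x, X x⟩ : TangentBundle I M))

/-- `f ε → f₀` as `ε ↓ 0`, uniformly with all derivatives on compact subsets of the open
set `U`. -/
def TendstoCInftyOn {F : Type*} [NormedAddCommGroup F] [NormedSpace ℝ F]
    (f : ℝ → E → F) (f₀ : E → F) (U : Set E) : Prop :=
  ∀ (n : ℕ) (K : Set E), K ⊆ U → IsCompact K →
    TendstoUniformlyOn (fun ε => iteratedFDeriv ℝ n (f ε)) (iteratedFDeriv ℝ n f₀) (𝓝[>] 0) K

end Forms

/-! ### Plane fields and stable Hamiltonian structures on 3-manifolds -/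

section ThreeManifold

variable {M : Type*} [TopologicalSpace M] [ChartedSpace (EuclideanSpace ℝ (Fin 3)) M]

/-- Convergence `Ω ε → Ω₀` of forms in the `C^∞` topology as `ε ↓ 0`. -/
def FormTendsto {k : ℕ} (Ω : ℝ → DiffForm (𝓡 3) M k) (Ω₀ : DiffForm (𝓡 3) M k) : Prop :=
  ∀ x₀ : M, TendstoCInftyOn (fun ε => (Ω ε).inChart x₀) (Ω₀.inChart x₀) (extChartAt (𝓡 3) x₀).target

/-- Convergence `X ε → X₀` of vector fields in the `C^∞` topology as `ε ↓ 0`. -/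
def VFTendsto (X : ℝ → ∀ x : M, TangentSpace (𝓡 3) x) (X₀ : ∀ x : M, TangentSpace (𝓡 3) x) :
    Prop :=
  ∀ x₀ : M, TendstoCInftyOn (fun ε => vfInChart (X ε) x₀) (vfInChart X₀ x₀)
    (extChartAt (𝓡 3) x₀).target

/-- A field of linear subspaces of the tangent spaces. -/
abbrev Distribution (M : Type*) [TopologicalSpace M] [ChartedSpace (EuclideanSpace ℝ (Fin 3)) M] :
    Type _ :=
  ∀ x : M, Submodule ℝ (TangentSpace (𝓡 3) x)

/-- `α` is a smooth nowhere vanishing 1-form with kernel `ξ`. A coorientable smooth 2-plane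
distribution is a `ξ` that has such a form. -/
def IsDefiningForm (α : DiffForm (𝓡 3) M 1) (ξ : Distribution M) : Prop :=
  α.Smooth ∧ (∀ x, α x ≠ 0) ∧ ∀ x v, v ∈ ξ x ↔ α x ![v] = 0

/-- Convergence `ξ ε → ξ₀` of coorientable plane fields in the `C^∞` topology as `ε ↓ 0`. -/
def DistributionTendsto (ξ : ℝ → Distribution M) (ξ₀ : Distribution M) : Prop :=
  ∃ (α : ℝ → DiffForm (𝓡 3) M 1) (α₀ : DiffForm (𝓡 3) M 1),
    (∀ᶠ ε in 𝓝[>] (0 : ℝ), IsDefiningForm (α ε) (ξ ε)) ∧ IsDefiningForm α₀ ξ₀ ∧ FormTendsto α α₀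

/-- `α ∧ dα ≥ 0` with respect to the orientation of `M` given by the volume form `vol`. -/
def IsConfoliationForm (vol : DiffForm (𝓡 3) M 3) (α : DiffForm (𝓡 3) M 1) : Prop :=
  ∀ x u v w, 0 < vol x ![u, v, w] → 0 ≤ wedge α α.d x u v w

/-- `α ∧ dα > 0` with respect to the orientation of `M` given by the volume form `vol`. -/
def IsContactForm (vol : DiffForm (𝓡 3) M 3) (α : DiffForm (𝓡 3) M 1) : Prop :=
  ∀ x u v w, 0 < vol x ![u, v, w] → 0 < wedge α α.d x u v w

/-- A (positive, coorientable) confoliation. -/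
def IsConfoliation (vol : DiffForm (𝓡 3) M 3) (ξ : Distribution M) : Prop :=
  ∃ α, IsDefiningForm α ξ ∧ IsConfoliationForm vol α

/-- A (positive, coorientable) contact structure. -/
def IsContactStructure (vol : DiffForm (𝓡 3) M 3) (ξ : Distribution M) : Prop :=
  ∃ α, IsDefiningForm α ξ ∧ IsContactForm vol α

/-- `Fl` is the smooth (global) flow of the vector field `X`. On a closed manifold a smooth vector
field has exactly one such flow. -/
def IsFlow (Fl : ℝ → M → M) (X : ∀ x : M, TangentSpace (𝓡 3) x) : Prop :=
  ContMDiff (𝓘(ℝ, ℝ).prod (𝓡 3)) (𝓡 3) ∞ (uncurry Fl) ∧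
    ∀ x, Fl 0 x = x ∧ IsMIntegralCurve (fun t => Fl t x) X

variable [IsManifold (𝓡 3) ∞ M]

variable (M) in
/-- A stable Hamiltonian structure `(ξ, X, Ω)` on a closed 3-manifold `M` oriented by `vol`.
The plane field `ξ` is cooriented by `X` and then oriented so that a basis `(v, w)` of `ξ` is
positive if and only if `(X, v, w)` is a positive basis of the tangent space of `M`. -/
structure StableHamiltonianStructure (vol : DiffForm (𝓡 3) M 3) where
  /-- the plane field -/
  ξ : Distribution M
  /-- the Reeb vector field -/
  X : ∀ x : M, TangentSpace (𝓡 3) x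
  /-- the taming form -/
  Ω : DiffForm (𝓡 3) M 2
  coorientable : ∃ α, IsDefiningForm α ξ
  smooth_X : SmoothVF X
  transverse : ∀ x, X x ∉ ξ x
  flow_preserves : ∀ Fl, IsFlow Fl X → ∀ t x,
    (ξ x).map (mfderiv (𝓡 3) (𝓡 3) (Fl t) x).toLinearMap = ξ (Fl t x)
  smooth_Ω : Ω.Smooth
  closed : ∀ x, Ω.d x = 0
  taming : ∀ x, ∀ v ∈ ξ x, ∀ w ∈ ξ x, 0 < vol x ![X x, v, w] → 0 < Ω x ![v, w]
  contraction : ∀ x v, Ω x ![X x, v] = 0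

/-- `H ε → H₀` in the `C^∞` topology as `ε ↓ 0`. -/
def SHSTendsto {vol : DiffForm (𝓡 3) M 3} (H : ℝ → StableHamiltonianStructure M vol)
    (H₀ : StableHamiltonianStructure M vol) : Prop :=
  DistributionTendsto (fun ε => (H ε).ξ) H₀.ξ ∧ VFTendsto (fun ε => (H ε).X) H₀.X ∧
    FormTendsto (fun ε => (H ε).Ω) H₀.Ω

end ThreeManifold

/-! ### Abstract open books and their closed 3-manifolds -/

section Books

/-- An abstract open book with page the compact surface with boundary `P`: an orientation of `P`
(the one for which the nowhere vanishing 2-form `area` is positive; only the sign of `area`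
matters) and a diffeomorphism `ψ` of `P` that is the identity near the boundary. No component
of `P` is closed. -/
structure AbstractOpenBook (P : Type*) [TopologicalSpace P]
    [ChartedSpace (EuclideanHalfSpace 2) P] where
  area : DiffForm (𝓡∂ 2) P 2
  area_smooth : area.Smooth
  area_ne_zero : ∀ p, area p ≠ 0
  ψ : P ≃ₘ^∞⟮𝓡∂ 2, 𝓡∂ 2⟯ P
  ψ_eq_id : ∀ᶠ p in 𝓝ˢ ((𝓡∂ 2).boundary P), ψ p = p
  meets_boundary : ∀ p : P, ((𝓡∂ 2).boundary P ∩ connectedComponent p).Nonempty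

variable {P : Type*} [TopologicalSpace P] [ChartedSpace (EuclideanHalfSpace 2) P]

/-- A presentation of the 3-manifold `M` as the result of gluing solid tori to the mapping torus
of the abstract open book `A`.

* `vol` represents the orientation of `M`.
* `Φ : ℝ × P → M` induces an embedding of the mapping torus
  `P_ψ = (ℝ × P) / ((t + 1, p) ∼ (t, ψ p))`, which preserves the product orientation.
* `κ i (ρ, θ)`, for `1 ≤ ρ < 2` and `θ` in `ℝ / ℤ`, are disjoint collars of the boundary components
  of `P`, which are the circles `ρ = 1`, such that `dθ ∧ dρ` is positive on `P`.
* `σ i (θ, z)`, for `θ` in `ℝ / ℤ` and `|z| < 2`, are disjoint orientation preserving embeddings of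
  solid tori. The solid torus `|z| ≤ 1` is glued to the mapping torus along the boundary
  component `i`, and the part `1 ≤ |z| < 2` is the collar `S¹ × [1, 2) × S¹` of that boundary
  component: with polar coordinates `z = ρ e^{2πiφ}`, the gluing is the identity in the coordinates
  `(φ, ρ, θ)`. -/
structure Gluing (A : AbstractOpenBook P) (M : Type*) [TopologicalSpace M]
    [ChartedSpace (EuclideanSpace ℝ (Fin 3)) M] where
  vol : DiffForm (𝓡 3) M 3
  vol_smooth : vol.Smooth
  vol_ne_zero : ∀ x, vol x ≠ 0
  Φ : ℝ → P → M
  Φ_smooth : ContMDiff (𝓘(ℝ, ℝ).prod (𝓡∂ 2)) (𝓡 3) ∞ (uncurry Φ)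
  Φ_eq_iff : ∀ s p t q, Φ s p = Φ t q ↔
    ∃ n : ℤ, s = t + n ∧ q = ((A.ψ.toEquiv : Equiv.Perm P) ^ n) p
  Φ_oriented : ∀ t p v w, 0 < A.area p ![v, w] →
    0 < vol (Φ t p) ![mfderiv 𝓘(ℝ, ℝ) (𝓡 3) (fun s => Φ s p) t (1 : ℝ),
      mfderiv (𝓡∂ 2) (𝓡 3) (Φ t) p v, mfderiv (𝓡∂ 2) (𝓡 3) (Φ t) p w]
  /-- the number of boundary components of the page -/
  b : ℕ
  κ : Fin b → ℝ → ℝ → P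
  κ_smooth : ∀ i, ContMDiffOn 𝓘(ℝ, ℝ × ℝ) (𝓡∂ 2) ∞ (uncurry (κ i)) (Ico 1 2 ×ˢ univ)
  κ_oriented : ∀ i, ∀ ρ ∈ Ico (1 : ℝ) 2, ∀ θ,
    0 < A.area (κ i ρ θ) ![mfderiv 𝓘(ℝ, ℝ) (𝓡∂ 2) (fun θ' => κ i ρ θ') θ (1 : ℝ),
      mfderivWithin 𝓘(ℝ, ℝ) (𝓡∂ 2) (fun ρ' => κ i ρ' θ) (Ico 1 2) ρ (1 : ℝ)]
  κ_eq_iff : ∀ i j, ∀ ρ ∈ Ico (1 : ℝ) 2, ∀ ρ' ∈ Ico (1 : ℝ) 2, ∀ θ θ',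
    κ i ρ θ = κ j ρ' θ' ↔ i = j ∧ ρ = ρ' ∧ ∃ n : ℤ, θ' = θ + n
  κ_open : ∀ i, IsOpen {p | ∃ ρ ∈ Ico (1 : ℝ) 2, ∃ θ, κ i ρ θ = p}
  κ_boundary : ∀ p, p ∈ (𝓡∂ 2).boundary P ↔ ∃ i θ, κ i 1 θ = p
  σ : Fin b → ℝ → ℂ → M
  σ_smooth : ∀ i, ContMDiffOn 𝓘(ℝ, ℝ × ℂ) (𝓡 3) ∞ (uncurry (σ i)) (univ ×ˢ Metric.ball 0 2)
  σ_oriented : ∀ i θ, ∀ z ∈ Metric.ball (0 : ℂ) 2,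
    0 < vol (σ i θ z) ![mfderiv 𝓘(ℝ, ℝ) (𝓡 3) (fun θ' => σ i θ' z) θ (1 : ℝ),
      mfderiv 𝓘(ℝ, ℂ) (𝓡 3) (σ i θ) z (1 : ℂ), mfderiv 𝓘(ℝ, ℂ) (𝓡 3) (σ i θ) z Complex.I]
  σ_eq_iff : ∀ i j, ∀ z ∈ Metric.ball (0 : ℂ) 2, ∀ z' ∈ Metric.ball (0 : ℂ) 2, ∀ θ θ',
    σ i θ z = σ j θ' z' ↔ i = j ∧ z = z' ∧ ∃ n : ℤ, θ' = θ + n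
  glue : ∀ i, ∀ ρ ∈ Ico (1 : ℝ) 2, ∀ θ φ : ℝ,
    σ i θ (ρ * Complex.exp (2 * Real.pi * φ * Complex.I)) = Φ φ (κ i ρ θ)
  disjoint : ∀ i θ, ∀ z ∈ Metric.ball (0 : ℂ) 1, ∀ t p, σ i θ z ≠ Φ t p
  cover : ∀ x, (∃ t p, Φ t p = x) ∨ ∃ i θ, ∃ z ∈ Metric.ball (0 : ℂ) 1, σ i θ z = x

namespace Gluing

variable {A : AbstractOpenBook P} {M : Type*} [TopologicalSpace M]
  [ChartedSpace (EuclideanSpace ℝ (Fin 3)) M] (G : Gluing A M)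

/-- On the mapping torus, `ξ` is the vertical distribution: its value at `Φ t p` is the tangent space
of the fibre `Φ ({t} × P)`. -/
def ExtendsVertical (ξ : Distribution M) : Prop :=
  ∀ t p, ξ (G.Φ t p) = LinearMap.range (mfderiv (𝓡∂ 2) (𝓡 3) (G.Φ t) p).toLinearMap

/-- On the mapping torus, `X` is positively transverse to the fibres over the circle. -/
def PositivelyTransverse (X : ∀ x : M, TangentSpace (𝓡 3) x) : Prop :=
  ∀ t p v w, 0 < A.area p ![v, w] →
    0 < G.vol (G.Φ t p) ![X (G.Φ t p), mfderiv (𝓡∂ 2) (𝓡 3) (G.Φ t) p v,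
      mfderiv (𝓡∂ 2) (𝓡 3) (G.Φ t) p w]

/-- The 2-form `β` is positive on the pages of the open book of `G`. The binding is the union of the
circles `z = 0`, and the fibration of its complement over `ℝ / ℤ` is the coordinate `φ`, that is
`Φ t p ↦ t` and `σ i (θ, ρ e^{2πiφ}) ↦ φ`. So the page over `φ` is the union of `Φ ({φ} × P)`,
oriented as `P`, and of the annuli of all `σ i (θ, ρ e^{2πiφ})` with `ρ > 0`, oriented by
`dθ ∧ dρ`; the second vector below is the image of `ρ ∂_ρ` at `z`. -/
def PositiveOnPages (β : DiffForm (𝓡 3) M 2) : Prop :=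
  (∀ t p v w, 0 < A.area p ![v, w] →
    0 < β (G.Φ t p) ![mfderiv (𝓡∂ 2) (𝓡 3) (G.Φ t) p v, mfderiv (𝓡∂ 2) (𝓡 3) (G.Φ t) p w]) ∧
  ∀ i θ, ∀ z ∈ Metric.ball (0 : ℂ) 2, z ≠ 0 →
    0 < β (G.σ i θ z) ![mfderiv 𝓘(ℝ, ℝ) (𝓡 3) (fun θ' => G.σ i θ' z) θ (1 : ℝ),
      mfderiv 𝓘(ℝ, ℂ) (𝓡 3) (G.σ i θ) z z]

/-- The 1-form `α` is positive on the binding, oriented as the boundary of the pages. As `dθ ∧ dρ` is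
positive on the pages and `-∂_ρ` points out of them at `ρ = 0`, this is the orientation by `∂_θ`. -/
def PositiveOnBinding (α : DiffForm (𝓡 3) M 1) : Prop :=
  ∀ i θ, 0 < α (G.σ i θ 0) ![mfderiv 𝓘(ℝ, ℝ) (𝓡 3) (fun θ' => G.σ i θ' 0) θ (1 : ℝ)]

/-- The open book of `G` supports `ξ`: there is a contact form with kernel `ξ` (a Giroux form) that
is positive on the binding and whose exterior derivative is positive on the pages. -/
def Supports (ξ : Distribution M) : Prop :=
  ∃ α, IsDefiningForm α ξ ∧ IsContactForm G.vol α ∧ G.PositiveOnPages α.d ∧ G.PositiveOnBinding α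

end Gluing

end Books

end OpenBook

end

/-!
# Stable Hamiltonian structures that interpolate from an open book to its contact structures

The contact structures of the family are the kernels of `α₀ + ε μ`, where `ker α₀` is the
confoliation. All members of the family share the taming form `ω = dα₀ + dμ` and, up to a positive
factor, the Reeb field. What makes this possible is that `dα₀` and `dμ` are pointwise proportional.
Suppose that `dα₀ = c ω` and `dμ = (1 - c) ω` with `0 ≤ c ≤ 1`, and that `α₀ ∧ ω > 0`. Let `X` be
the field with `α₀ X = 1` and `ι_X ω = 0`. For small `ε ≥ 0` put `X_ε = X / (1 + ε μ X)`. Then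
`α₀ + ε μ` equals `1` on `X_ε`, its exterior derivative `(c + ε (1 - c)) ω` is annihilated by `X_ε`,
and so the flow of `X_ε` preserves the form and its kernel, which is tamed by `ω`. As
`(α₀ + ε μ) ∧ d(α₀ + ε μ)` is `c + ε (1 - c)` times `(α₀ + ε μ) ∧ ω = (1 + ε μ X) α₀ ∧ ω`, the
kernel is a contact structure for `ε > 0` and a confoliation for `ε = 0`. This is
`exists_family_of_proportional`.

Only finite sums of forms `h db` with global smooth functions `h`, `b` are used (`Generated`). For
these the exterior derivative is explicit, and the invariance of a form under a flow follows from
`∂_s ∂_t`-symmetry along maps of two real variables (`Generated.two_parameter`,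
`Generated.flow_pullback`), so that no Lie derivatives are needed.

The form `α₀` (`baseForm`) is the sum of two angular forms `x dy - y dx`. The first belongs to the
complex function `angle` that is `e^{2πit}` on the mapping torus and `k(|z|²) z` on the solid tori;
it is `2π dt` on the mapping torus. The second is `2π w² dθ`, supported in the solid tori `|z| ≤ 1`,
where `w` decreases with `|z|`; it makes `α₀` a contact form for `|z| < 1`. On the mapping torus
`dα₀ = 0`, so there `dμ` may be any exact form that is positive on the fibres. On the solid tori
`|z| < 1`, `μ` is a multiple of `v² dθ` for a nonincreasing function `v` of `|z|²` that is constant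
for `|z|² < 1/2`; where it is not constant, both exterior derivatives are nonnegative multiples of
`dθ ∧ d|z|²` (`Admissible.exists_proportional`, `Admissible.density_pos`).

It remains to find a 1-form `μ` on `M` with this behaviour on the solid tori that has `dt ∧ dμ > 0`
on the whole mapping torus. A primitive of an area form on each page exists because no component of
the page is closed, but it has to be chosen smoothly in `t` and compatibly with the monodromy. This
is done without cohomology. Consider the forms `μ` with the given behaviour on the solid tori and
with `dt ∧ dμ ≥ 0`; as sums of such forms have the same properties, it suffices by compactness to
find for each point of the mapping torus one that is positive there (`exists_admissible`). On the
collars `v² dθ` is positive. In a flow box with page coordinates `(a, b)` the form `g db` satisfies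
`dt ∧ d(g db) = (∂g/∂a) dt ∧ da ∧ db`, and `g` can be chosen with compact support, with `∂g/∂a`
positive at a given point and negative only near a second given point of the same page. Adding a
large multiple of a form that is positive near the second point repairs the sign
(`mem_positiveSet_of_near`). Hence the set of points of a page at which positivity can be achieved
is open and closed, and it contains the boundary, which every component of the page meets
(`Φ_mem_positiveSet`).
-/

open Set Filter Topology Function
open scoped Manifold ContDiff

noncomputable section

set_option linter.unusedSectionVars false

namespace OpenBook

/-! ### Forms `h db` and their exterior derivatives -/

section LinearForms

variable {V : Type*} [NormedAddCommGroup V] [NormedSpace ℝ V]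

/-- A covector, as an alternating form of degree one. -/
def covectorForm (a : V →L[ℝ] ℝ) : V [⋀^Fin 1]→L[ℝ] ℝ :=
  ContinuousAlternatingMap.ofSubsingletonLIE (𝕜 := ℝ) (E := V) (F := ℝ) (0 : Fin 1) a

/-- The exterior product of two covectors. -/
def wedgeCovectors (a b : V →L[ℝ] ℝ) : V [⋀^Fin 2]→L[ℝ] ℝ :=
  ContinuousAlternatingMap.alternatizeUncurryFin (a.smulRight (covectorForm b))

@[simp] theorem covectorForm_apply (a : V →L[ℝ] ℝ) (v : Fin 1 → V) :
    covectorForm a v = a (v 0) := rfl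

@[simp] theorem wedgeCovectors_apply (a b : V →L[ℝ] ℝ) (v : Fin 2 → V) :
    wedgeCovectors a b v = a (v 0) * b (v 1) - a (v 1) * b (v 0) := by
  simp [wedgeCovectors, ContinuousAlternatingMap.alternatizeUncurryFin_apply, Fin.sum_univ_two,
    Fin.removeNth]
  ring

theorem two_le_infty : (2 : WithTop ℕ∞) ≤ ∞ :=
  (WithTop.coe_le_coe.2 le_top : ((2 : ℕ∞) : WithTop ℕ∞) ≤ ((⊤ : ℕ∞) : WithTop ℕ∞))

theorem extDeriv_smul_covectorForm_fderiv {h b : V → ℝ} {y : V} (hh : DifferentiableAt ℝ h y)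
    (hb : ContDiffAt ℝ ∞ b y) :
    extDeriv (fun z => h z • covectorForm (fderiv ℝ b z)) y =
      wedgeCovectors (fderiv ℝ h y) (fderiv ℝ b y) := by
  have hd : DifferentiableAt ℝ (fderiv ℝ b) y :=
    (hb.fderiv_right (m := ∞) (by simp)).differentiableAt (by simp)
  have hd' : DifferentiableAt ℝ (fun z => covectorForm (fderiv ℝ b z)) y :=
    (ContinuousAlternatingMap.ofSubsingletonLIE (𝕜 := ℝ) (E := V) (F := ℝ) (0 : Fin 1)).toContinuousLinearEquiv.differentiableAt.comp y hd
  have hsymm : IsSymmSndFDerivAt ℝ b y :=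
    (hb.of_le two_le_infty : ContDiffAt ℝ 2 b y).isSymmSndFDerivAt (by simp)
  have hf : ∀ u v, fderiv ℝ (fun z => h z • covectorForm (fderiv ℝ b z)) y u ![v] =
      fderiv ℝ h y u * fderiv ℝ b y v + h y * fderiv ℝ (fderiv ℝ b) y u v := by
    intro u v
    have h2 : HasFDerivAt (fun z => covectorForm (fderiv ℝ b z))
        ((ContinuousAlternatingMap.ofSubsingletonLIE (𝕜 := ℝ) (E := V) (F := ℝ) (0 : Fin 1)).toContinuousLinearEquiv.toContinuousLinearMap ∘L
            fderiv ℝ (fderiv ℝ b) y) y :=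
      (ContinuousAlternatingMap.ofSubsingletonLIE (𝕜 := ℝ) (E := V) (F := ℝ) (0 : Fin 1)).toContinuousLinearEquiv.hasFDerivAt.comp y hd.hasFDerivAt
    rw [(hh.hasFDerivAt.fun_smul h2).fderiv]
    simp
    change _ * _ + _ = _ * _ + h y * fderiv ℝ (fderiv ℝ b) y u v
    rw [add_comm]
  ext v
  have e : v = ![v 0, v 1] := by ext i; fin_cases i <;> rfl
  rw [e, extDeriv, ContinuousAlternatingMap.alternatizeUncurryFin_apply]
  have e0 : Fin.removeNth 0 ![v 0, v 1] = ![v 1] := by ext i; fin_cases i; rfl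
  have e1 : Fin.removeNth 1 ![v 0, v 1] = ![v 0] := by ext i; fin_cases i; rfl
  rw [Fin.sum_univ_two, e0, e1, wedgeCovectors_apply]
  simp [hf, hsymm.eq (v 0) (v 1)]
  ring

end LinearForms

/-- The model space of a 3-manifold. -/
abbrev E3 : Type := EuclideanSpace ℝ (Fin 3)

section Generated

variable {M : Type*} [TopologicalSpace M] [ChartedSpace E3 M]

/-- The differential of a real function, as a covector at each point. -/
def differential (b : M → ℝ) (x : M) : E3 →L[ℝ] ℝ := mfderiv (𝓡 3) 𝓘(ℝ, ℝ) b x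

/-- The 1-form `h db`. -/
def oneForm (h b : M → ℝ) : DiffForm (𝓡 3) M 1 := fun x =>
  (h x • covectorForm (differential b x) : E3 [⋀^Fin 1]→L[ℝ] ℝ)

/-- The 2-form `dh ∧ db`. -/
def twoForm (h b : M → ℝ) : DiffForm (𝓡 3) M 2 := fun x =>
  (wedgeCovectors (differential h x) (differential b x) : E3 [⋀^Fin 2]→L[ℝ] ℝ)

theorem oneForm_apply (h b : M → ℝ) (x : M) (v : Fin 1 → TangentSpace (𝓡 3) x) :
    oneForm h b x v = h x * differential b x (v 0) := rfl

theorem twoForm_apply (h b : M → ℝ) (x : M) (v : Fin 2 → TangentSpace (𝓡 3) x) :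
    twoForm h b x v = differential h x (v 0) * differential b x (v 1) -
      differential h x (v 1) * differential b x (v 0) :=
  wedgeCovectors_apply (V := E3) _ _ v

/-- The expression of a function in the preferred chart at `x₀`. -/
def funInChart {F : Type*} (f : M → F) (x₀ : M) (y : E3) : F := f ((extChartAt (𝓡 3) x₀).symm y)

theorem mem_nhds_extChartAt_target (x₀ : M) {y : E3} (hy : y ∈ (extChartAt (𝓡 3) x₀).target) :
    (extChartAt (𝓡 3) x₀).target ∈ 𝓝 y :=
  (isOpen_extChartAt_target x₀).mem_nhds hy

theorem isOpen_extChartAt_target' (x₀ : M) : IsOpen (extChartAt (𝓡 3) x₀).target :=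
  isOpen_extChartAt_target x₀

variable [IsManifold (𝓡 3) ∞ M]

theorem contMDiffAt_extChartAt_symm' (x₀ : M) {y : E3}
    (hy : y ∈ (extChartAt (𝓡 3) x₀).target) :
    ContMDiffAt 𝓘(ℝ, E3) (𝓡 3) ∞ (extChartAt (𝓡 3) x₀).symm y :=
  (contMDiffOn_extChartAt_symm x₀).contMDiffAt (mem_nhds_extChartAt_target x₀ hy)

theorem contDiffOn_funInChart {F : Type*} [NormedAddCommGroup F] [NormedSpace ℝ F] {f : M → F}
    (hf : ContMDiff (𝓡 3) 𝓘(ℝ, F) ∞ f) (x₀ : M) :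
    ContDiffOn ℝ ∞ (funInChart f x₀) (extChartAt (𝓡 3) x₀).target := by
  intro y hy
  apply ContDiffAt.contDiffWithinAt
  rw [← contMDiffAt_iff_contDiffAt]
  exact hf.contMDiffAt.comp y (contMDiffAt_extChartAt_symm' x₀ hy)

theorem mfderiv_comp_chart_symm {f : M → ℝ}
    (hf : ContMDiff (𝓡 3) 𝓘(ℝ, ℝ) ∞ f) (x₀ : M) {y : E3}
    (hy : y ∈ (extChartAt (𝓡 3) x₀).target) (v : E3) :
    differential f ((extChartAt (𝓡 3) x₀).symm y)
      (mfderivWithin 𝓘(ℝ, E3) (𝓡 3) (extChartAt (𝓡 3) x₀).symm (range (𝓡 3)) y v) =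
      fderiv ℝ (funInChart f x₀) y v := by
  have h1 : range (𝓡 3) = univ := by simp
  rw [h1, mfderivWithin_univ, ← mfderiv_eq_fderiv]
  have := mfderiv_comp (x := y) (hf.mdifferentiableAt (by simp))
    ((contMDiffAt_extChartAt_symm' x₀ hy).mdifferentiableAt (by simp))
  change _ = mfderiv 𝓘(ℝ, E3) 𝓘(ℝ, ℝ) (f ∘ (extChartAt (𝓡 3) x₀).symm) y v
  rw [this]; rfl

theorem oneForm_inChart {h b : M → ℝ}
    (hb : ContMDiff (𝓡 3) 𝓘(ℝ, ℝ) ∞ b) (x₀ : M) {y : E3}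
    (hy : y ∈ (extChartAt (𝓡 3) x₀).target) :
    (oneForm h b).inChart x₀ y =
      funInChart h x₀ y • covectorForm (fderiv ℝ (funInChart b x₀) y) := by
  ext v
  exact congrArg (fun r : ℝ => funInChart h x₀ y * r) (mfderiv_comp_chart_symm hb x₀ hy (v 0))

theorem twoForm_inChart {h b : M → ℝ} (hh : ContMDiff (𝓡 3) 𝓘(ℝ, ℝ) ∞ h)
    (hb : ContMDiff (𝓡 3) 𝓘(ℝ, ℝ) ∞ b) (x₀ : M) {y : E3}
    (hy : y ∈ (extChartAt (𝓡 3) x₀).target) :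
    (twoForm h b).inChart x₀ y =
      wedgeCovectors (fderiv ℝ (funInChart h x₀) y) (fderiv ℝ (funInChart b x₀) y) := by
  ext v
  rw [wedgeCovectors_apply, ← mfderiv_comp_chart_symm hb x₀ hy, ← mfderiv_comp_chart_symm hb x₀ hy,
    ← mfderiv_comp_chart_symm hh x₀ hy, ← mfderiv_comp_chart_symm hh x₀ hy]
  exact twoForm_apply _ _ _ _

theorem twoForm_inChart_eq_extDeriv {h b : M → ℝ} (hh : ContMDiff (𝓡 3) 𝓘(ℝ, ℝ) ∞ h)
    (hb : ContMDiff (𝓡 3) 𝓘(ℝ, ℝ) ∞ b) (x₀ : M) {y : E3}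
    (hy : y ∈ (extChartAt (𝓡 3) x₀).target) :
    (twoForm h b).inChart x₀ y = extDeriv ((oneForm h b).inChart x₀) y := by
  have h1 : (oneForm h b).inChart x₀ =ᶠ[𝓝 y] fun z =>
      funInChart h x₀ z • covectorForm (fderiv ℝ (funInChart b x₀) z) := by
    filter_upwards [mem_nhds_extChartAt_target x₀ hy] with z hz
    exact oneForm_inChart hb x₀ hz
  rw [h1.extDeriv_eq, twoForm_inChart hh hb x₀ hy]
  have := mem_nhds_extChartAt_target x₀ hy
  exact (extDeriv_smul_covectorForm_fderiv
    (((contDiffOn_funInChart hh x₀).contDiffAt this).differentiableAt (by simp))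
    ((contDiffOn_funInChart hb x₀).contDiffAt this)).symm

theorem oneForm_smooth {h b : M → ℝ} (hh : ContMDiff (𝓡 3) 𝓘(ℝ, ℝ) ∞ h)
    (hb : ContMDiff (𝓡 3) 𝓘(ℝ, ℝ) ∞ b) : (oneForm h b).Smooth := by
  intro x₀
  refine ContDiffOn.congr ?_ fun y hy => oneForm_inChart hb x₀ hy
  refine (contDiffOn_funInChart hh x₀).smul ?_
  exact (ContinuousAlternatingMap.ofSubsingletonLIE (𝕜 := ℝ) (E := E3) (F := ℝ) (0 : Fin 1)).toContinuousLinearEquiv.contDiff.comp_contDiffOn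
    ((contDiffOn_funInChart hb x₀).fderiv_of_isOpen (isOpen_extChartAt_target' x₀) (by simp))

theorem contDiffOn_extDeriv {V : Type*} [NormedAddCommGroup V] [NormedSpace ℝ V] {n : ℕ}
    {f : V → V [⋀^Fin n]→L[ℝ] ℝ} {U : Set V} (hU : IsOpen U) (hf : ContDiffOn ℝ ∞ f U) :
    ContDiffOn ℝ ∞ (extDeriv f) U :=
  (ContinuousAlternatingMap.alternatizeUncurryFinCLM ℝ V ℝ).contDiff.comp_contDiffOn
    (hf.fderiv_of_isOpen hU (by simp))

/-- `Generated α β` says that `α` is a finite sum of 1-forms `h db` with smooth `h` and `b`,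
and that `β` is the corresponding sum of the 2-forms `dh ∧ db`. The predicate keeps a primitive
and its exterior derivative together. -/
inductive Generated : DiffForm (𝓡 3) M 1 → DiffForm (𝓡 3) M 2 → Prop
  | zero : Generated 0 0
  | basic {h b : M → ℝ} (hh : ContMDiff (𝓡 3) 𝓘(ℝ, ℝ) ∞ h)
      (hb : ContMDiff (𝓡 3) 𝓘(ℝ, ℝ) ∞ b) : Generated (oneForm h b) (twoForm h b)
  | add {α α' : DiffForm (𝓡 3) M 1} {β β' : DiffForm (𝓡 3) M 2} (h : Generated α β)
      (h' : Generated α' β') : Generated (α + α') (β + β')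

theorem inChart_add {k : ℕ} (Ω Ω' : DiffForm (𝓡 3) M k) (x₀ : M) :
    (Ω + Ω').inChart x₀ = Ω.inChart x₀ + Ω'.inChart x₀ := rfl

theorem Generated.smooth {α : DiffForm (𝓡 3) M 1} {β : DiffForm (𝓡 3) M 2}
    (h : Generated α β) : α.Smooth := by
  induction h with
  | zero => exact fun x₀ => (contDiffOn_const : ContDiffOn ℝ ∞ (fun _ => (0 : E3 [⋀^Fin 1]→L[ℝ] ℝ)) _)
  | basic hh hb => exact oneForm_smooth hh hb
  | add _ _ ih ih' => exact fun x₀ => (ih x₀).add (ih' x₀)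

theorem Generated.inChart_eq {α : DiffForm (𝓡 3) M 1} {β : DiffForm (𝓡 3) M 2}
    (h : Generated α β) (x₀ : M) {y : E3} (hy : y ∈ (extChartAt (𝓡 3) x₀).target) :
    β.inChart x₀ y = extDeriv (α.inChart x₀) y := by
  induction h with
  | zero =>
    change 0 = extDeriv (0 : E3 → E3 [⋀^Fin 1]→L[ℝ] ℝ) y
    simp [extDeriv]
    exact (map_zero (ContinuousAlternatingMap.alternatizeUncurryFinCLM ℝ E3 ℝ)).symm
  | basic hh hb => exact twoForm_inChart_eq_extDeriv hh hb x₀ hy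
  | add h h' ih ih' =>
    have := mem_nhds_extChartAt_target x₀ hy
    rw [inChart_add, inChart_add, extDeriv_add
      (((h.smooth x₀).contDiffAt this).differentiableAt (by simp))
      (((h'.smooth x₀).contDiffAt this).differentiableAt (by simp)), ← ih, ← ih']
    rfl

theorem Generated.smooth_snd {α : DiffForm (𝓡 3) M 1} {β : DiffForm (𝓡 3) M 2}
    (h : Generated α β) : β.Smooth := fun x₀ =>
  (contDiffOn_extDeriv (isOpen_extChartAt_target' x₀) (h.smooth x₀)).congr
    fun _ hy => h.inChart_eq x₀ hy

theorem mfderivWithin_symm_comp_mfderiv (x₀ : M) {x : M} (hx : x ∈ (extChartAt (𝓡 3) x₀).source)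
    (w : E3) : mfderivWithin 𝓘(ℝ, E3) (𝓡 3) (extChartAt (𝓡 3) x₀).symm (range (𝓡 3))
      (extChartAt (𝓡 3) x₀ x) (mfderiv (𝓡 3) 𝓘(ℝ, E3) (extChartAt (𝓡 3) x₀) x w) = w := by
  have : IsManifold (𝓡 3) 1 M := .of_le (n := ∞) (by simp)
  exact congrArg (fun L : E3 →L[ℝ] E3 => L w)
    (mfderivWithin_extChartAt_symm_comp_mfderiv_extChartAt' (I := 𝓡 3) hx)

/-- A form is the pullback of its chart expression under the chart. -/
theorem inChart_comp_mfderiv {k : ℕ} (Ω : DiffForm (𝓡 3) M k) (x₀ : M) {x : M}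
    (hx : x ∈ (extChartAt (𝓡 3) x₀).source) (v : Fin k → TangentSpace (𝓡 3) x) :
    Ω.inChart x₀ (extChartAt (𝓡 3) x₀ x)
      (fun i => mfderiv (𝓡 3) 𝓘(ℝ, E3) (extChartAt (𝓡 3) x₀) x (v i)) = Ω x v := by
  let Ω' : M → E3 [⋀^Fin k]→L[ℝ] ℝ := Ω
  change Ω' ((extChartAt (𝓡 3) x₀).symm (extChartAt (𝓡 3) x₀ x)) (fun i =>
    mfderivWithin 𝓘(ℝ, E3) (𝓡 3) (extChartAt (𝓡 3) x₀).symm (range (𝓡 3))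
      (extChartAt (𝓡 3) x₀ x) (mfderiv (𝓡 3) 𝓘(ℝ, E3) (extChartAt (𝓡 3) x₀) x (v i))) = Ω' x v
  rw [(extChartAt (𝓡 3) x₀).left_inv hx]
  exact congrArg (Ω' x) (funext fun i => mfderivWithin_symm_comp_mfderiv x₀ hx (v i))

/-- The exterior derivative of a sum of forms `h db` is the sum of the forms `dh ∧ db`. -/
theorem Generated.d_eq {α : DiffForm (𝓡 3) M 1} {β : DiffForm (𝓡 3) M 2}
    (h : Generated α β) : α.d = β := by
  funext x
  ext v
  rw [← inChart_comp_mfderiv β x (mem_extChartAt_source x) v, h.inChart_eq x (mem_extChartAt_target x), DiffForm.d]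
  simp
  rfl

theorem Generated.closed {α : DiffForm (𝓡 3) M 1} {β : DiffForm (𝓡 3) M 2}
    (h : Generated α β) (x : M) : β.d x = 0 := by
  have hy := mem_nhds_extChartAt_target x (mem_extChartAt_target (I := 𝓡 3) x)
  have h1 : β.inChart x =ᶠ[𝓝 (extChartAt (𝓡 3) x x)] extDeriv (α.inChart x) := by
    filter_upwards [hy] with y hy
    exact h.inChart_eq x hy
  have h2 : extDeriv (β.inChart x) (extChartAt (𝓡 3) x x) = 0 := by
    rw [h1.extDeriv_eq]
    exact extDeriv_extDeriv_apply ((h.smooth x).contDiffAt hy) (by simpa using two_le_infty)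
  have h1 : range (𝓡 3) = univ := by simp
  rw [DiffForm.d, h1, extDerivWithin_univ, h2]
  rfl

theorem Generated.smul {α : DiffForm (𝓡 3) M 1} {β : DiffForm (𝓡 3) M 2}
    (h : Generated α β) (c : ℝ) : Generated (c • α) (c • β) := by
  induction h with
  | zero => simpa using Generated.zero
  | @basic h b hh hb =>
    have := Generated.basic (h := fun x => c * h x) (contMDiff_const.mul hh) hb
    convert this using 1
    · funext x; ext v
      change c * (oneForm h b x v) = _
      rw [oneForm_apply, oneForm_apply]; ring
    · funext x; ext v
      change c * (twoForm h b x v) = _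
      have h1 : differential (fun x => c * h x) x = c • differential h x :=
        const_smul_mfderiv (hh.mdifferentiableAt (by simp)) c
      rw [twoForm_apply, twoForm_apply, h1]
      exact (by intros; ring : ∀ p q r s : ℝ, c * (p * q - r * s) = c * p * q - c * r * s) _ _ _ _
  | add _ _ ih ih' =>
    rw [smul_add, smul_add]
    exact ih.add ih'

theorem Generated.sum {ι : Type*} (s : Finset ι) {α : ι → DiffForm (𝓡 3) M 1}
    {β : ι → DiffForm (𝓡 3) M 2} (h : ∀ i ∈ s, Generated (α i) (β i)) :
    Generated (∑ i ∈ s, α i) (∑ i ∈ s, β i) := by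
  classical
  induction s using Finset.induction_on with
  | empty => simpa using Generated.zero
  | insert a s ha ih =>
    rw [Finset.sum_insert ha, Finset.sum_insert ha]
    exact (h a (by simp)).add (ih fun i hi => h i (by simp [hi]))

end Generated

/-! ### Linear algebra of forms in dimension three -/

section LinearAlgebra

/-- The standard basis vectors of the model space. -/
def stdVec (i : Fin 3) : E3 := EuclideanSpace.single i (1 : ℝ)

theorem stdVec_apply (i j : Fin 3) : stdVec i j = if j = i then 1 else 0 := by
  simp [stdVec]

theorem eq_sum_stdVec (v : E3) : v = v 0 • stdVec 0 + v 1 • stdVec 1 + v 2 • stdVec 2 := by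
  ext i; fin_cases i <;> simp [stdVec]

theorem form_one_expand (a : E3 [⋀^Fin 1]→L[ℝ] ℝ) (v : E3) :
    a ![v] = v 0 * a ![stdVec 0] + v 1 * a ![stdVec 1] + v 2 * a ![stdVec 2] := by
  conv_lhs => rw [eq_sum_stdVec v]
  simp only [ContinuousAlternatingMap.vecCons_add, ContinuousAlternatingMap.vecCons_smul,
    smul_eq_mul]

theorem form_two_swap {V : Type*} [AddCommGroup V] [Module ℝ V] [TopologicalSpace V]
    (β : V [⋀^Fin 2]→L[ℝ] ℝ) (u v : V) : β ![u, v] = -β ![v, u] := by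
  have := β.toAlternatingMap.map_swap ![v, u] (i := 0) (j := 1) (by decide)
  rw [← ContinuousAlternatingMap.coe_toAlternatingMap, ← this]
  congr 1
  ext i; fin_cases i <;> simp

theorem form_two_self {V : Type*} [AddCommGroup V] [Module ℝ V] [TopologicalSpace V]
    (β : V [⋀^Fin 2]→L[ℝ] ℝ) (u : V) : β ![u, u] = 0 := by
  have := form_two_swap β u u; linarith

theorem form_two_expand (β : E3 [⋀^Fin 2]→L[ℝ] ℝ) (u v : E3) :
    β ![u, v] = (u 0 * v 1 - u 1 * v 0) * β ![stdVec 0, stdVec 1] +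
      (u 1 * v 2 - u 2 * v 1) * β ![stdVec 1, stdVec 2] +
      (u 2 * v 0 - u 0 * v 2) * β ![stdVec 2, stdVec 0] := by
  have key : ∀ w z : E3, β ![w, z] = w 0 * β ![stdVec 0, z] + w 1 * β ![stdVec 1, z] +
      w 2 * β ![stdVec 2, z] := by
    intro w z
    conv_lhs => rw [eq_sum_stdVec w]
    simp only [ContinuousAlternatingMap.vecCons_add, ContinuousAlternatingMap.vecCons_smul,
      smul_eq_mul]
  rw [key u v, form_two_swap β (stdVec 0) v, form_two_swap β (stdVec 1) v,
    form_two_swap β (stdVec 2) v, key v, key v, key v, form_two_self, form_two_self, form_two_self,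
    form_two_swap β (stdVec 1) (stdVec 0), form_two_swap β (stdVec 2) (stdVec 1),
    form_two_swap β (stdVec 0) (stdVec 2)]
  ring

/-- The exterior product of a covector and an alternating 2-form. -/
def wedgeForm {V : Type*} [NormedAddCommGroup V] [NormedSpace ℝ V] (a : V [⋀^Fin 1]→L[ℝ] ℝ)
    (β : V [⋀^Fin 2]→L[ℝ] ℝ) : V [⋀^Fin 3]→L[ℝ] ℝ :=
  ContinuousAlternatingMap.alternatizeUncurryFin
    (((ContinuousAlternatingMap.ofSubsingletonLIE (𝕜 := ℝ) (E := V) (F := ℝ) (0 : Fin 1)).symm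
      a).smulRight β)

theorem wedgeForm_apply {V : Type*} [NormedAddCommGroup V] [NormedSpace ℝ V]
    (a : V [⋀^Fin 1]→L[ℝ] ℝ) (β : V [⋀^Fin 2]→L[ℝ] ℝ) (u v w : V) :
    wedgeForm a β ![u, v, w] = a ![u] * β ![v, w] - a ![v] * β ![u, w] + a ![w] * β ![u, v] := by
  have e0 : Fin.removeNth 0 ![u, v, w] = ![v, w] := by ext i; fin_cases i <;> rfl
  have e1 : Fin.removeNth 1 ![u, v, w] = ![u, w] := by ext i; fin_cases i <;> rfl
  have e2 : Fin.removeNth 2 ![u, v, w] = ![u, v] := by ext i; fin_cases i <;> rfl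
  have hs : ∀ z, a (fun _ => z) = a ![z] := fun z => by
    congr 1; ext i; fin_cases i; rfl
  rw [wedgeForm, ContinuousAlternatingMap.alternatizeUncurryFin_apply, Fin.sum_univ_three,
    e0, e1, e2]
  simp [hs]
  ring

theorem wedgeForm_add {V : Type*} [NormedAddCommGroup V] [NormedSpace ℝ V]
    (a : V [⋀^Fin 1]→L[ℝ] ℝ) (β β' : V [⋀^Fin 2]→L[ℝ] ℝ) :
    wedgeForm a (β + β') = wedgeForm a β + wedgeForm a β' := by
  unfold wedgeForm
  rw [← ContinuousAlternatingMap.alternatizeUncurryFin_add]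
  congr 1
  ext u v
  exact smul_add _ _ _

theorem wedgeForm_smul {V : Type*} [NormedAddCommGroup V] [NormedSpace ℝ V]
    (a : V [⋀^Fin 1]→L[ℝ] ℝ) (c : ℝ) (β : V [⋀^Fin 2]→L[ℝ] ℝ) :
    wedgeForm a (c • β) = c • wedgeForm a β := by
  unfold wedgeForm
  rw [← ContinuousAlternatingMap.alternatizeUncurryFin_smul]
  congr 1
  ext u v
  exact smul_comm _ _ _

/-- Alternating 3-forms on the model space are proportional. -/
theorem form_three_proportional (A B : E3 [⋀^Fin 3]→L[ℝ] ℝ) (v w : Fin 3 → E3) :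
    A v * B w = A w * B v := by
  let e := (EuclideanSpace.basisFun (Fin 3) ℝ).toBasis
  have hA := A.toAlternatingMap.eq_smul_basis_det e
  have hB := B.toAlternatingMap.eq_smul_basis_det e
  have h1 : ∀ u, A u = A e * e.det u := fun u => congrArg (fun f => f u) hA
  have h2 : ∀ u, B u = B e * e.det u := fun u => congrArg (fun f => f u) hB
  rw [h1 v, h1 w, h2 v, h2 w]; ring

theorem form_three_swap {V : Type*} [AddCommGroup V] [Module ℝ V] [TopologicalSpace V]
    (B : V [⋀^Fin 3]→L[ℝ] ℝ) (u v w : V) : B ![u, v, w] = -B ![v, u, w] := by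
  have := B.toAlternatingMap.map_swap ![v, u, w] (i := 0) (j := 1) (by decide)
  rw [← ContinuousAlternatingMap.coe_toAlternatingMap, ← this]
  congr 1
  ext i; fin_cases i <;> simp [Equiv.swap_apply_def]

theorem form_three_ne_zero_stdVec {B : E3 [⋀^Fin 3]→L[ℝ] ℝ} (hB : B ≠ 0) :
    B ![stdVec 0, stdVec 1, stdVec 2] ≠ 0 := by
  let e := (EuclideanSpace.basisFun (Fin 3) ℝ).toBasis
  have hB' := B.toAlternatingMap.eq_smul_basis_det e
  have h2 : ∀ u, B u = B e * e.det u := fun u => congrArg (fun f => f u) hB'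
  have he : (e : Fin 3 → E3) = ![stdVec 0, stdVec 1, stdVec 2] := by
    ext i; fin_cases i <;> simp [e, stdVec]
  rw [← he]
  intro h
  apply hB
  ext u
  rw [h2, h]; simp

/-- Every nonzero alternating 3-form has a positive basis. -/
theorem exists_positive_basis {B : E3 [⋀^Fin 3]→L[ℝ] ℝ} (hB : B ≠ 0) :
    ∃ u v w, 0 < B ![u, v, w] := by
  rcases (form_three_ne_zero_stdVec hB).lt_or_gt with h | h
  · exact ⟨stdVec 1, stdVec 0, stdVec 2, by rw [form_three_swap]; linarith⟩
  · exact ⟨_, _, _, h⟩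

/-- The vector representing the 2-form `β` with respect to the standard volume form of the model
space; it spans the kernel of `β` if `β ≠ 0`. -/
def kernelVec (β : E3 [⋀^Fin 2]→L[ℝ] ℝ) : E3 :=
  β ![stdVec 1, stdVec 2] • stdVec 0 + β ![stdVec 2, stdVec 0] • stdVec 1 +
    β ![stdVec 0, stdVec 1] • stdVec 2

@[simp] theorem kernelVec_zero (β : E3 [⋀^Fin 2]→L[ℝ] ℝ) :
    kernelVec β 0 = β ![stdVec 1, stdVec 2] := by simp [kernelVec, stdVec]
@[simp] theorem kernelVec_one (β : E3 [⋀^Fin 2]→L[ℝ] ℝ) :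
    kernelVec β 1 = β ![stdVec 2, stdVec 0] := by simp [kernelVec, stdVec]
@[simp] theorem kernelVec_two (β : E3 [⋀^Fin 2]→L[ℝ] ℝ) :
    kernelVec β 2 = β ![stdVec 0, stdVec 1] := by simp [kernelVec, stdVec]

theorem contraction_kernelVec (β : E3 [⋀^Fin 2]→L[ℝ] ℝ) (v : E3) : β ![kernelVec β, v] = 0 := by
  rw [form_two_expand]; simp; ring

theorem form_one_kernelVec (a : E3 [⋀^Fin 1]→L[ℝ] ℝ) (β : E3 [⋀^Fin 2]→L[ℝ] ℝ) :
    a ![kernelVec β] = wedgeForm a β ![stdVec 0, stdVec 1, stdVec 2] := by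
  rw [form_one_expand, wedgeForm_apply, form_two_swap β (stdVec 0) (stdVec 2)]; simp; ring

theorem eq_kernelVec {a : E3 [⋀^Fin 1]→L[ℝ] ℝ} {β : E3 [⋀^Fin 2]→L[ℝ] ℝ} {X : E3}
    (h1 : a ![X] = 1) (h2 : ∀ v, β ![X, v] = 0) :
    wedgeForm a β ![stdVec 0, stdVec 1, stdVec 2] • X = kernelVec β := by
  have h0 := h2 (stdVec 0)
  have h3 := h2 (stdVec 1)
  have h4 := h2 (stdVec 2)
  rw [form_two_expand] at h0 h3 h4
  rw [form_one_expand] at h1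
  simp [stdVec_apply] at h0 h3 h4
  rw [wedgeForm_apply, form_two_swap β (stdVec 0) (stdVec 2)]
  ext i
  fin_cases i
  · simp
    linear_combination β ![stdVec 1, stdVec 2] * h1 - a ![stdVec 1] * h4 + a ![stdVec 2] * h3
  · simp
    linear_combination β ![stdVec 2, stdVec 0] * h1 + a ![stdVec 0] * h4 - a ![stdVec 2] * h0
  · simp
    linear_combination β ![stdVec 0, stdVec 1] * h1 - a ![stdVec 0] * h3 + a ![stdVec 1] * h0

theorem wedgeForm_eq_smul {a c : E3 [⋀^Fin 1]→L[ℝ] ℝ} {β : E3 [⋀^Fin 2]→L[ℝ] ℝ} {X : E3}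
    (h1 : a ![X] = 1) (h2 : ∀ v, β ![X, v] = 0) (v : Fin 3 → E3) (hβ : wedgeForm a β ≠ 0) :
    wedgeForm c β v = c ![X] * wedgeForm a β v := by
  have hD := form_three_ne_zero_stdVec hβ
  have h3 := eq_kernelVec h1 h2
  have h4 := form_one_kernelVec c β
  rw [← h3, ContinuousAlternatingMap.vecCons_smul, smul_eq_mul] at h4
  have h5 := form_three_proportional (wedgeForm c β) (wedgeForm a β) v
    ![stdVec 0, stdVec 1, stdVec 2]
  rw [← h4] at h5
  apply mul_right_cancel₀ hD
  rw [h5]; ring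

end LinearAlgebra

/-! ### Top forms and Reeb fields in charts -/

section ReebField

variable {M : Type*} [TopologicalSpace M] [ChartedSpace E3 M]

/-- The 3-form `α ∧ β`. -/
def topForm (α : DiffForm (𝓡 3) M 1) (β : DiffForm (𝓡 3) M 2) : DiffForm (𝓡 3) M 3 := fun x =>
  wedgeForm (V := E3) (α x) (β x)

theorem topForm_apply (α : DiffForm (𝓡 3) M 1) (β : DiffForm (𝓡 3) M 2) (x : M)
    (u v w : TangentSpace (𝓡 3) x) : topForm α β x ![u, v, w] = wedge α β x u v w :=
  wedgeForm_apply (V := E3) (α x) (β x) u v w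

theorem topForm_add_right (α : DiffForm (𝓡 3) M 1) (β β' : DiffForm (𝓡 3) M 2) (x : M) :
    topForm α (β + β') x = topForm α β x + topForm α β' x :=
  wedgeForm_add (V := E3) (α x) (β x) (β' x)

theorem topForm_smul_right (α : DiffForm (𝓡 3) M 1) (c : ℝ) (β : DiffForm (𝓡 3) M 2) (x : M) :
    topForm α (c • β) x = c • topForm α β x :=
  wedgeForm_smul (V := E3) (α x) c (β x)

/-- The quotient of two 3-forms, where the denominator is nowhere zero. It is computed in the
standard basis of the model space, with which each tangent space is identified. -/
def topRatio (A B : DiffForm (𝓡 3) M 3) (x : M) : ℝ :=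
  (A x : E3 [⋀^Fin 3]→L[ℝ] ℝ) ![stdVec 0, stdVec 1, stdVec 2] /
    (B x : E3 [⋀^Fin 3]→L[ℝ] ℝ) ![stdVec 0, stdVec 1, stdVec 2]

theorem topRatio_mul (A : DiffForm (𝓡 3) M 3) {B : DiffForm (𝓡 3) M 3} {x : M} (hB : B x ≠ 0)
    (v : Fin 3 → TangentSpace (𝓡 3) x) : A x v = topRatio A B x * B x v := by
  have h := form_three_ne_zero_stdVec hB
  have h2 := form_three_proportional (A x) (B x) v ![stdVec 0, stdVec 1, stdVec 2]
  exact ((eq_div_iff h).2 h2).trans (div_mul_eq_mul_div _ _ _).symm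

variable [IsManifold (𝓡 3) ∞ M]

theorem mfderiv_comp_mfderivWithin_symm (x₀ : M) {y : E3}
    (hy : y ∈ (extChartAt (𝓡 3) x₀).target) (w : E3) :
    mfderiv (𝓡 3) 𝓘(ℝ, E3) (extChartAt (𝓡 3) x₀) ((extChartAt (𝓡 3) x₀).symm y)
      (mfderivWithin 𝓘(ℝ, E3) (𝓡 3) (extChartAt (𝓡 3) x₀).symm (range (𝓡 3)) y w) = w := by
  have : IsManifold (𝓡 3) 1 M := .of_le (n := ∞) (by simp)
  exact congrArg (fun L : E3 →L[ℝ] E3 => L w)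
    (mfderiv_extChartAt_comp_mfderivWithin_extChartAt_symm (I := 𝓡 3) hy)

theorem inChart_apply_chart {k : ℕ} (Ω : DiffForm (𝓡 3) M k) (x₀ : M) {x : M}
    (hx : x ∈ (extChartAt (𝓡 3) x₀).source) (v : Fin k → E3) :
    Ω.inChart x₀ (extChartAt (𝓡 3) x₀ x) v = Ω x (fun i =>
      mfderivWithin 𝓘(ℝ, E3) (𝓡 3) (extChartAt (𝓡 3) x₀).symm (range (𝓡 3))
      (extChartAt (𝓡 3) x₀ x) (v i)) := by
  let Ω' : M → E3 [⋀^Fin k]→L[ℝ] ℝ := Ω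
  change Ω' ((extChartAt (𝓡 3) x₀).symm (extChartAt (𝓡 3) x₀ x)) (fun i =>
    mfderivWithin 𝓘(ℝ, E3) (𝓡 3) (extChartAt (𝓡 3) x₀).symm (range (𝓡 3))
      (extChartAt (𝓡 3) x₀ x) (v i)) = Ω' x _
  rw [(extChartAt (𝓡 3) x₀).left_inv hx]

theorem inChart_ne_zero {k : ℕ} {Ω : DiffForm (𝓡 3) M k} (h : ∀ x, Ω x ≠ 0) (x₀ : M) {y : E3}
    (hy : y ∈ (extChartAt (𝓡 3) x₀).target) : Ω.inChart x₀ y ≠ 0 := by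
  intro h0
  apply h ((extChartAt (𝓡 3) x₀).symm y)
  ext v
  have h1 := inChart_comp_mfderiv Ω x₀ ((extChartAt (𝓡 3) x₀).map_target hy) v
  rw [(extChartAt (𝓡 3) x₀).right_inv hy, h0] at h1
  exact h1.symm

theorem topForm_inChart (α : DiffForm (𝓡 3) M 1) (β : DiffForm (𝓡 3) M 2) (x₀ : M) (y : E3) :
    (topForm α β).inChart x₀ y = wedgeForm (α.inChart x₀ y) (β.inChart x₀ y) := by
  ext v
  have e : v = ![v 0, v 1, v 2] := by ext i; fin_cases i <;> rfl
  rw [e, wedgeForm_apply]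
  let L : E3 →L[ℝ] E3 :=
    mfderivWithin 𝓘(ℝ, E3) (𝓡 3) (extChartAt (𝓡 3) x₀).symm (range (𝓡 3)) y
  have h3 : ∀ (Ω : E3 [⋀^Fin 3]→L[ℝ] ℝ) (a b c : E3),
      Ω.compContinuousLinearMap L ![a, b, c] = Ω ![L a, L b, L c] := fun Ω a b c => by
    rw [ContinuousAlternatingMap.compContinuousLinearMap_apply]
    congr 1; ext i; fin_cases i <;> rfl
  have h2 : ∀ (Ω : E3 [⋀^Fin 2]→L[ℝ] ℝ) (a b : E3),
      Ω.compContinuousLinearMap L ![a, b] = Ω ![L a, L b] := fun Ω a b => by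
    rw [ContinuousAlternatingMap.compContinuousLinearMap_apply]
    congr 1; ext i; fin_cases i <;> rfl
  have h1 : ∀ (Ω : E3 [⋀^Fin 1]→L[ℝ] ℝ) (a : E3),
      Ω.compContinuousLinearMap L ![a] = Ω ![L a] := fun Ω a => by
    rw [ContinuousAlternatingMap.compContinuousLinearMap_apply]
    congr 1; ext i; fin_cases i; rfl
  refine (h3 _ _ _ _).trans ?_
  refine (wedgeForm_apply (V := E3) _ _ _ _ _).trans ?_
  congr 1
  · congr 1
    · exact congrArg₂ _ (h1 _ _).symm (h2 _ _ _).symm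
    · exact congrArg₂ _ (h1 _ _).symm (h2 _ _ _).symm
  · exact congrArg₂ _ (h1 _ _).symm (h2 _ _ _).symm

theorem contDiffOn_form_apply {V W : Type*} [NormedAddCommGroup V] [NormedSpace ℝ V]
    [NormedAddCommGroup W] [NormedSpace ℝ W] {k : ℕ}
    {f : W → V [⋀^Fin k]→L[ℝ] ℝ} {U : Set W} (hf : ContDiffOn ℝ ∞ f U) (v : Fin k → V) :
    ContDiffOn ℝ ∞ (fun y => f y v) U :=
  (ContinuousAlternatingMap.apply ℝ V ℝ v).contDiff.comp_contDiffOn hf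

theorem contDiffOn_wedgeForm_apply {α : DiffForm (𝓡 3) M 1} {β : DiffForm (𝓡 3) M 2}
    (hα : α.Smooth) (hβ : β.Smooth) (x₀ : M) (u v w : E3) :
    ContDiffOn ℝ ∞ (fun y => wedgeForm (α.inChart x₀ y) (β.inChart x₀ y) ![u, v, w])
      (extChartAt (𝓡 3) x₀).target := by
  simp only [wedgeForm_apply]
  exact (((contDiffOn_form_apply (hα x₀) _).mul (contDiffOn_form_apply (hβ x₀) _)).sub
    ((contDiffOn_form_apply (hα x₀) _).mul (contDiffOn_form_apply (hβ x₀) _))).add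
    ((contDiffOn_form_apply (hα x₀) _).mul (contDiffOn_form_apply (hβ x₀) _))

theorem topRatio_continuous {α : DiffForm (𝓡 3) M 1} {β : DiffForm (𝓡 3) M 2}
    {B : DiffForm (𝓡 3) M 3} (hα : α.Smooth) (hβ : β.Smooth) (hB : B.Smooth)
    (hB0 : ∀ x, B x ≠ 0) : Continuous (topRatio (topForm α β) B) := by
  rw [continuous_iff_continuousAt]
  intro x₀
  let e : Fin 3 → E3 := ![stdVec 0, stdVec 1, stdVec 2]
  have h1 : ContinuousOn (fun y => wedgeForm (α.inChart x₀ y) (β.inChart x₀ y) e /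
      B.inChart x₀ y e) (extChartAt (𝓡 3) x₀).target :=
    (contDiffOn_wedgeForm_apply hα hβ x₀ _ _ _).continuousOn.div
      (contDiffOn_form_apply (hB x₀) _).continuousOn
      fun y hy => form_three_ne_zero_stdVec (inChart_ne_zero hB0 x₀ hy)
  have h2 : ContinuousOn ((fun y => wedgeForm (α.inChart x₀ y) (β.inChart x₀ y) e /
      B.inChart x₀ y e) ∘ extChartAt (𝓡 3) x₀) (extChartAt (𝓡 3) x₀).source :=
    h1.comp (continuousOn_extChartAt x₀) fun x hx => (extChartAt (𝓡 3) x₀).map_source hx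
  refine ContinuousAt.congr (h2.continuousAt (extChartAt_source_mem_nhds x₀)) ?_
  filter_upwards [extChartAt_source_mem_nhds (I := 𝓡 3) x₀] with x hx
  have hy := (extChartAt (𝓡 3) x₀).map_source hx
  have hne := form_three_ne_zero_stdVec (inChart_ne_zero hB0 x₀ hy)
  change wedgeForm (α.inChart x₀ _) (β.inChart x₀ _) e / B.inChart x₀ _ e = _
  rw [← topForm_inChart, div_eq_iff hne]
  rw [inChart_apply_chart _ x₀ hx, inChart_apply_chart _ x₀ hx]
  exact topRatio_mul (topForm α β) (hB0 x) _

/-- The vector field `X` with `α(X) = 1` and `ι_X β = 0`, where `α ∧ β` is nowhere zero. -/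
def reebField (α : DiffForm (𝓡 3) M 1) (β : DiffForm (𝓡 3) M 2) (x : M) : TangentSpace (𝓡 3) x :=
  (((topForm α β x : E3 [⋀^Fin 3]→L[ℝ] ℝ) ![stdVec 0, stdVec 1, stdVec 2])⁻¹ •
    kernelVec (β x) : E3)

theorem reebField_contraction (α : DiffForm (𝓡 3) M 1) (β : DiffForm (𝓡 3) M 2) (x : M)
    (v : TangentSpace (𝓡 3) x) : β x ![reebField α β x, v] = 0 := by
  refine ((β x).vecCons_smul ![v] _ (kernelVec (β x))).trans ?_
  have := contraction_kernelVec (β x) v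
  exact (congrArg (fun r : ℝ => _ • r) this).trans (smul_zero _)

theorem reebField_normalized {α : DiffForm (𝓡 3) M 1} {β : DiffForm (𝓡 3) M 2} {x : M}
    (h : topForm α β x ≠ 0) : α x ![reebField α β x] = 1 := by
  refine ((α x).vecCons_smul ![] _ (kernelVec (β x))).trans ?_
  have h1 := form_one_kernelVec (α x) (β x)
  exact (congrArg (fun r : ℝ => _ • r) h1).trans (inv_mul_cancel₀ (form_three_ne_zero_stdVec h))

theorem inChart_vfInChart_one (α : DiffForm (𝓡 3) M 1) (X : ∀ x : M, TangentSpace (𝓡 3) x)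
    (x₀ : M) {y : E3} (hy : y ∈ (extChartAt (𝓡 3) x₀).target) :
    α.inChart x₀ y ![vfInChart X x₀ y] = α ((extChartAt (𝓡 3) x₀).symm y)
      ![X ((extChartAt (𝓡 3) x₀).symm y)] := by
  rw [← inChart_comp_mfderiv α x₀ ((extChartAt (𝓡 3) x₀).map_target hy),
    (extChartAt (𝓡 3) x₀).right_inv hy]
  congr 1
  ext i; fin_cases i; rfl

theorem inChart_vfInChart_two (β : DiffForm (𝓡 3) M 2) (X : ∀ x : M, TangentSpace (𝓡 3) x)
    (hX : ∀ x v, β x ![X x, v] = 0)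
    (x₀ : M) {y : E3} (hy : y ∈ (extChartAt (𝓡 3) x₀).target) (v : E3) :
    β.inChart x₀ y ![vfInChart X x₀ y, v] = 0 := by
  rw [← hX ((extChartAt (𝓡 3) x₀).symm y)
      (mfderivWithin 𝓘(ℝ, E3) (𝓡 3) (extChartAt (𝓡 3) x₀).symm (range (𝓡 3)) y v),
    ← inChart_comp_mfderiv β x₀ ((extChartAt (𝓡 3) x₀).map_target hy),
    (extChartAt (𝓡 3) x₀).right_inv hy]
  congr 1
  ext i; fin_cases i
  · rfl
  · exact congrArg (fun z : E3 => z _) (mfderiv_comp_mfderivWithin_symm x₀ hy v).symm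

/-- In a chart the field is the kernel vector of the 2-form, divided by the density of the
3-form. -/
theorem reebField_inChart {α : DiffForm (𝓡 3) M 1} {β : DiffForm (𝓡 3) M 2}
    (h : ∀ x, topForm α β x ≠ 0) (x₀ : M) {y : E3}
    (hy : y ∈ (extChartAt (𝓡 3) x₀).target) :
    vfInChart (reebField α β) x₀ y =
      (wedgeForm (α.inChart x₀ y) (β.inChart x₀ y) ![stdVec 0, stdVec 1, stdVec 2])⁻¹ •
        kernelVec (β.inChart x₀ y) := by
  have hne := inChart_ne_zero h x₀ hy
  rw [topForm_inChart] at hne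
  have h1 := inChart_vfInChart_one α (reebField α β) x₀ hy
  rw [reebField_normalized (h _)] at h1
  have h2 := inChart_vfInChart_two β _ (reebField_contraction α β) x₀ hy
  rw [← eq_kernelVec h1 h2, smul_smul, inv_mul_cancel₀ (form_three_ne_zero_stdVec hne), one_smul]

theorem contDiffOn_reebField {α : DiffForm (𝓡 3) M 1} {β : DiffForm (𝓡 3) M 2}
    (hα : α.Smooth) (hβ : β.Smooth) (h : ∀ x, topForm α β x ≠ 0) (x₀ : M) :
    ContDiffOn ℝ ∞ (vfInChart (reebField α β) x₀) (extChartAt (𝓡 3) x₀).target := by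
  refine ContDiffOn.congr ?_ fun y hy => reebField_inChart h x₀ hy
  have h1 : ∀ (v : Fin 2 → E3) (w : E3), ContDiffOn ℝ ∞ (fun y => β.inChart x₀ y v • w)
      (extChartAt (𝓡 3) x₀).target := fun v w =>
    ContDiffOn.smul (contDiffOn_form_apply (hβ x₀) v) (contDiffOn_const (c := w))
  have h2 := (contDiffOn_wedgeForm_apply hα hβ x₀ (stdVec 0) (stdVec 1) (stdVec 2)).inv
    fun y hy => by
      have hne := inChart_ne_zero h x₀ hy
      rw [topForm_inChart] at hne
      exact form_three_ne_zero_stdVec hne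
  exact ContDiffOn.smul h2 (((h1 _ _).add (h1 _ _)).add (h1 _ _))

/-- A vector field whose chart expressions are smooth is a smooth section of the tangent bundle. -/
theorem smoothVF_of_inChart [IsManifold (𝓡 3) 1 M] {X : ∀ x : M, TangentSpace (𝓡 3) x}
    (h : ∀ x₀ : M, ContDiffOn ℝ ∞ (vfInChart X x₀) (extChartAt (𝓡 3) x₀).target) :
    SmoothVF X := by
  intro x₀
  refine (Bundle.contMDiffAt_section (F := E3) (E := fun x : M => TangentSpace (𝓡 3) x) x₀).2 ?_
  have h1 : ContMDiffAt (𝓡 3) 𝓘(ℝ, E3) ∞ (vfInChart X x₀ ∘ extChartAt (𝓡 3) x₀) x₀ := by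
    refine ContMDiffAt.comp x₀ (I' := 𝓘(ℝ, E3)) ?_ contMDiffAt_extChartAt
    exact ((h x₀).contDiffAt (extChartAt_target_mem_nhds x₀)).contMDiffAt
  refine h1.congr_of_eventuallyEq ?_
  filter_upwards [extChartAt_source_mem_nhds (I := 𝓡 3) x₀] with x hx
  have hx' : x ∈ (chartAt E3 x₀).source := by simpa using hx
  have h2 := TangentBundle.continuousLinearMapAt_trivializationAt (I := 𝓡 3) hx'
  have h3 : x ∈ (trivializationAt E3 (TangentSpace (𝓡 3)) x₀).baseSet := by
    simpa using hx
  have h4 := Bundle.Trivialization.continuousLinearMapAt_apply_of_mem (R := ℝ)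
    (trivializationAt E3 (TangentSpace (𝓡 3)) x₀) h3 (X x)
  refine h4.symm.trans ?_
  rw [h2]
  change _ = mfderiv (𝓡 3) 𝓘(ℝ, E3) (extChartAt (𝓡 3) x₀) ((extChartAt (𝓡 3) x₀).symm
    (extChartAt (𝓡 3) x₀ x)) (X ((extChartAt (𝓡 3) x₀).symm (extChartAt (𝓡 3) x₀ x)))
  rw [(extChartAt (𝓡 3) x₀).left_inv hx]
  rfl

end ReebField

/-! ### Convergence of smooth families -/

section Convergence

universe u

variable {E : Type u} [NormedAddCommGroup E] [NormedSpace ℝ E]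

/-- For a jointly smooth family, the derivatives in the second variable are jointly continuous. -/
theorem continuousOn_iteratedFDeriv_of_joint {F : Type u} [NormedAddCommGroup F]
    [NormedSpace ℝ F] {f : ℝ → E → F} {W : Set (ℝ × E)} (hW : IsOpen W)
    (hf : ContDiffOn ℝ ∞ (uncurry f) W) (n : ℕ) :
    ContinuousOn (fun p : ℝ × E => iteratedFDeriv ℝ n (f p.1) p.2) W := by
  induction n generalizing F with
  | zero =>
    have h1 : (fun p : ℝ × E => iteratedFDeriv ℝ 0 (f p.1) p.2) =
        (continuousMultilinearCurryFin0 ℝ E F).symm ∘ uncurry f := rfl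
    rw [h1]
    exact (continuousMultilinearCurryFin0 ℝ E F).symm.continuous.comp_continuousOn hf.continuousOn
  | succ n ih =>
    have h1 : ∀ p ∈ W, fderiv ℝ (f p.1) p.2 =
        (fderiv ℝ (uncurry f) p).comp (ContinuousLinearMap.inr ℝ ℝ E) := fun p hp => by
      have hd := ((hf.contDiffAt (hW.mem_nhds hp)).differentiableAt (by simp)).hasFDerivAt
      exact (HasFDerivAt.comp (g := uncurry f) (f := fun y => (p.1, y)) p.2 hd
        (hasFDerivAt_prodMk_right p.1 p.2)).fderiv
    have h2 : ContDiffOn ℝ ∞ (uncurry fun ε y => fderiv ℝ (f ε) y) W := by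
      refine ContDiffOn.congr ?_ h1
      exact (hf.fderiv_of_isOpen hW (by simp)).clm_comp contDiffOn_const
    have h3 := ih h2
    have h4 : (fun p : ℝ × E => iteratedFDeriv ℝ (n + 1) (f p.1) p.2) =
        (continuousMultilinearCurryRightEquiv' ℝ n E F).symm ∘
          fun p : ℝ × E => iteratedFDeriv ℝ n (fderiv ℝ (f p.1)) p.2 := by
      funext p
      exact iteratedFDeriv_succ_eq_comp_right
    rw [h4]
    exact (continuousMultilinearCurryRightEquiv' ℝ n E F).symm.continuous.comp_continuousOn h3

/-- A jointly smooth family converges together with all derivatives, uniformly on compact sets. -/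
theorem tendstoCInftyOn_of_joint {F : Type u} [NormedAddCommGroup F] [NormedSpace ℝ F]
    {f g : ℝ → E → F} {f₀ : E → F} {W : Set (ℝ × E)} (hW : IsOpen W) {U : Set E} (hU : IsOpen U)
    (hUW : ∀ y ∈ U, ((0 : ℝ), y) ∈ W) (hf : ContDiffOn ℝ ∞ (uncurry f) W)
    (hg : ∀ᶠ ε in 𝓝[>] (0 : ℝ), EqOn (g ε) (f ε) U) (hf₀ : EqOn f₀ (f 0) U) :
    TendstoCInftyOn g f₀ U := by
  intro n K hKU hK
  have h0 : EqOn (iteratedFDeriv ℝ n f₀) (iteratedFDeriv ℝ n (f 0)) K := fun y hy =>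
    (((hf₀.eventuallyEq_of_mem (hU.mem_nhds (hKU hy))).iteratedFDeriv ℝ n)).eq_of_nhds
  have h1 : ∀ᶠ ε in 𝓝[>] (0 : ℝ),
      EqOn (iteratedFDeriv ℝ n (f ε)) (iteratedFDeriv ℝ n (g ε)) K := by
    filter_upwards [hg] with ε hε y hy
    exact (((hε.eventuallyEq_of_mem (hU.mem_nhds (hKU hy))).iteratedFDeriv ℝ n)).eq_of_nhds.symm
  refine TendstoUniformlyOn.congr (F := fun ε => iteratedFDeriv ℝ n (f ε)) ?_ h1
  refine TendstoUniformlyOn.congr_right (f := iteratedFDeriv ℝ n (f 0)) ?_ h0.symm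
  obtain ⟨s, t, hs, -, h0s, hKt, hst⟩ := generalized_tube_lemma (isCompact_singleton (x := (0 : ℝ)))
    hK hW (by rintro ⟨a, y⟩ ⟨ha, hy⟩; obtain rfl : a = 0 := ha; exact hUW y (hKU hy))
  have h2 : ContinuousOn (uncurry fun ε y => iteratedFDeriv ℝ n (f ε) y) (s ×ˢ K) :=
    (continuousOn_iteratedFDeriv_of_joint hW hf n).mono
      ((prod_mono_right hKt).trans hst)
  intro u hu
  have h0s' : (0 : ℝ) ∈ s := h0s rfl
  obtain ⟨v, hv, hvu⟩ := hK.mem_uniformity_of_prod h2 h0s' (symm_le_uniformity hu)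
  rw [hs.nhdsWithin_eq h0s'] at hv
  filter_upwards [nhdsWithin_le_nhds hv] with ε hε y hy
  exact hvu ε hε y hy

end Convergence

/-! ### Flows of Reeb fields -/

section Flow

variable {M : Type*} [TopologicalSpace M] [ChartedSpace E3 M] [IsManifold (𝓡 3) ∞ M]

/-- Chain rule for a real function and a parametrized piece of `M`. -/
theorem differential_comp {V : Type*} [NormedAddCommGroup V] [NormedSpace ℝ V] {b : M → ℝ}
    (hb : ContMDiff (𝓡 3) 𝓘(ℝ, ℝ) ∞ b) {c : V → M} {q : V}
    (hc : MDifferentiableAt 𝓘(ℝ, V) (𝓡 3) c q) (v : V) :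
    differential b (c q) (mfderiv 𝓘(ℝ, V) (𝓡 3) c q v) = fderiv ℝ (b ∘ c) q v := by
  have h1 := mfderiv_comp q (hb.mdifferentiableAt (by simp)) hc
  rw [mfderiv_eq_fderiv] at h1
  rw [h1]; rfl

theorem eventually_mdifferentiableAt {V : Type*} [NormedAddCommGroup V] [NormedSpace ℝ V]
    {c : V → M} {q : V} (hc : ContMDiffAt 𝓘(ℝ, V) (𝓡 3) ∞ c q) :
    ∀ᶠ p in 𝓝 q, MDifferentiableAt 𝓘(ℝ, V) (𝓡 3) c p := by
  have : IsManifold (𝓡 3) 1 M := .of_le (n := ∞) (by simp)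
  have h1 := (contMDiffAt_iff_contMDiffAt_nhds (by simp)).1
    (hc.of_le (m := 1) (by simp))
  filter_upwards [h1] with p hp
  exact hp.mdifferentiableAt (by simp)

/-- The intrinsic formula for the exterior derivative on a two-parameter family of points:
`∂_u (α(∂_v c)) - ∂_v (α(∂_u c)) = dα(∂_u c, ∂_v c)`. -/
theorem Generated.two_parameter {α : DiffForm (𝓡 3) M 1} {β : DiffForm (𝓡 3) M 2}
    (h : Generated α β) {c : ℝ × ℝ → M} {p : ℝ × ℝ}
    (hc : ContMDiffAt 𝓘(ℝ, ℝ × ℝ) (𝓡 3) ∞ c p) :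
    (∀ v, DifferentiableAt ℝ
      (fun q => α (c q) ![mfderiv 𝓘(ℝ, ℝ × ℝ) (𝓡 3) c q v]) p) ∧
    ∀ u v, fderiv ℝ (fun q => α (c q) ![mfderiv 𝓘(ℝ, ℝ × ℝ) (𝓡 3) c q v]) p u -
      fderiv ℝ (fun q => α (c q) ![mfderiv 𝓘(ℝ, ℝ × ℝ) (𝓡 3) c q u]) p v =
      β (c p) ![mfderiv 𝓘(ℝ, ℝ × ℝ) (𝓡 3) c p u, mfderiv 𝓘(ℝ, ℝ × ℝ) (𝓡 3) c p v] := by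
  induction h with
  | zero =>
    have h0 : ∀ v : ℝ × ℝ, (fun q => (0 : DiffForm (𝓡 3) M 1) (c q)
      ![mfderiv 𝓘(ℝ, ℝ × ℝ) (𝓡 3) c q v]) = fun _ => 0 := fun v => rfl
    refine ⟨fun v => ?_, fun u v => ?_⟩
    · rw [h0]; exact differentiableAt_const _
    · rw [h0, h0]
      simp
  | @basic h b hh hb =>
    have hev := eventually_mdifferentiableAt hc
    have hhc : ContDiffAt ℝ ∞ (h ∘ c) p :=
      (hh.contMDiffAt.comp p hc).contDiffAt
    have hbc : ContDiffAt ℝ ∞ (b ∘ c) p :=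
      (hb.contMDiffAt.comp p hc).contDiffAt
    have h0 : ∀ v : ℝ × ℝ, (fun q => oneForm h b (c q)
      ![mfderiv 𝓘(ℝ, ℝ × ℝ) (𝓡 3) c q v]) =ᶠ[𝓝 p] fun q => h (c q) * fderiv ℝ (b ∘ c) q v := by
      intro v
      filter_upwards [hev] with q hq
      rw [oneForm_apply]
      exact congrArg (h (c q) * ·) (differential_comp hb hq v)
    have hd1 : HasFDerivAt (fun q => h (c q)) (fderiv ℝ (h ∘ c) p) p :=
      (hhc.differentiableAt (by simp)).hasFDerivAt
    have hd2 : DifferentiableAt ℝ (fderiv ℝ (b ∘ c)) p :=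
      (hbc.fderiv_right (m := ∞) (by simp)).differentiableAt (by simp)
    have hd3 : ∀ v : ℝ × ℝ, HasFDerivAt (fun q => fderiv ℝ (b ∘ c) q v)
        ((ContinuousLinearMap.apply ℝ ℝ v).comp (fderiv ℝ (fderiv ℝ (b ∘ c)) p)) p := fun v =>
      (ContinuousLinearMap.apply ℝ ℝ v).hasFDerivAt.comp p hd2.hasFDerivAt
    have hd : ∀ v : ℝ × ℝ, HasFDerivAt (fun q => oneForm h b (c q)
      ![mfderiv 𝓘(ℝ, ℝ × ℝ) (𝓡 3) c q v]) _ p := fun v =>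
      (hd1.mul (hd3 v)).congr_of_eventuallyEq (h0 v)
    have hsymm : IsSymmSndFDerivAt ℝ (b ∘ c) p :=
      (hbc.of_le two_le_infty).isSymmSndFDerivAt (by simp)
    refine ⟨fun v => (hd v).differentiableAt, fun u v => ?_⟩
    rw [(hd u).fderiv, (hd v).fderiv, twoForm_apply]
    have e := hev.self_of_nhds
    have e1 := differential_comp hh e u
    have e2 := differential_comp hh e v
    have e3 := differential_comp hb e u
    have e4 := differential_comp hb e v
    refine Eq.trans ?_ (congrArg₂ (fun r s : ℝ => r - s) (congrArg₂ (fun r s : ℝ => r * s) e1 e4)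
      (congrArg₂ (fun r s : ℝ => r * s) e2 e3)).symm
    have := hsymm.eq u v
    simp
    rw [this]; ring
  | add h h' ih ih' =>
    rename_i α α' β β'
    have hadd : ∀ v, HasFDerivAt (fun q => (α + α') (c q)
        ![mfderiv 𝓘(ℝ, ℝ × ℝ) (𝓡 3) c q v]) _ p := fun v =>
      (ih.1 v).hasFDerivAt.add (ih'.1 v).hasFDerivAt
    refine ⟨fun v => (hadd v).differentiableAt, fun u v => ?_⟩
    rw [(hadd u).fderiv, (hadd v).fderiv]
    have h1 := ih.2 u v
    have h2 := ih'.2 u v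
    refine Eq.trans ?_ (congrArg₂ (fun r s : ℝ => r + s) h1 h2)
    simp
    ring

/-- Every tangent vector is the velocity of a smooth curve. -/
theorem exists_curve (x : M) (v : TangentSpace (𝓡 3) x) : ∃ γ : ℝ → M,
    γ 0 = x ∧ ContMDiffAt 𝓘(ℝ, ℝ) (𝓡 3) ∞ γ 0 ∧
      HasMFDerivAt 𝓘(ℝ, ℝ) (𝓡 3) γ 0 (ContinuousLinearMap.toSpanSingleton ℝ (v : E3)) := by
  let e := extChartAt (𝓡 3) x
  let w : E3 := mfderiv (𝓡 3) 𝓘(ℝ, E3) e x v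
  have h0 : e x + (0 : ℝ) • w = e x := by simp
  have hs : ContMDiffAt 𝓘(ℝ, E3) (𝓡 3) ∞ e.symm (e x + (0 : ℝ) • w) := by
    rw [h0]; exact contMDiffAt_extChartAt_symm' x (mem_extChartAt_target x)
  have hl : HasFDerivAt (fun s : ℝ => e x + s • w) (ContinuousLinearMap.toSpanSingleton ℝ w) 0 := by
    have := ((hasFDerivAt_id (𝕜 := ℝ) (0 : ℝ)).smul_const w).const_add (e x)
    exact this.congr_fderiv (by ext; simp)
  refine ⟨fun s => e.symm (e x + s • w), ?_, ?_, ?_⟩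
  · change e.symm (e x + (0 : ℝ) • w) = x
    rw [h0]; exact extChartAt_to_inv x
  · refine ContMDiffAt.comp (0 : ℝ) (g := e.symm) (f := fun s : ℝ => e x + s • w) hs ?_
    exact (contDiffAt_const.add (contDiffAt_id.smul contDiffAt_const)).contMDiffAt
  · have h1 := HasMFDerivAt.comp (0 : ℝ) (g := e.symm) (f := fun s : ℝ => e x + s • w)
      (hs.mdifferentiableAt (by simp)).hasMFDerivAt hl.hasMFDerivAt
    have h2 := mfderivWithin_symm_comp_mfderiv x (mem_extChartAt_source (I := 𝓡 3) x) v
    have h3 : range (𝓡 3) = univ := by simp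
    rw [h3, mfderivWithin_univ] at h2
    refine h1.congr_mfderiv ?_
    let D : E3 → E3 →L[ℝ] E3 := fun z => mfderiv 𝓘(ℝ, E3) (𝓡 3) e.symm z
    refine ContinuousLinearMap.ext fun r : ℝ => ?_
    change D (e x + (0 : ℝ) • w) (r • w) = r • (v : E3)
    rw [h0, map_smul]
    exact congrArg (fun z : E3 => r • z) h2

/-- A vector field with `α(X) = 1` and `ι_X dα = 0` has a flow that preserves `α`. -/
theorem Generated.flow_pullback {α : DiffForm (𝓡 3) M 1} {β : DiffForm (𝓡 3) M 2}
    (h : Generated α β) {X : ∀ x : M, TangentSpace (𝓡 3) x} (h1 : ∀ x, α x ![X x] = 1)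
    (h2 : ∀ x v, β x ![X x, v] = 0) {Fl : ℝ → M → M} (hFl : IsFlow Fl X) (t : ℝ) (x : M)
    (v : TangentSpace (𝓡 3) x) :
    α (Fl t x) ![mfderiv (𝓡 3) (𝓡 3) (Fl t) x v] = α x ![v] := by
  obtain ⟨γ, hγ0, hγs, hγd⟩ := exists_curve x v
  let c : ℝ × ℝ → M := fun q => Fl q.1 (γ q.2)
  have hc : ∀ t, ContMDiffAt 𝓘(ℝ, ℝ × ℝ) (𝓡 3) ∞ c (t, 0) := fun t => by
    have e1 : ContMDiffAt 𝓘(ℝ, ℝ × ℝ) (𝓘(ℝ, ℝ).prod (𝓡 3)) ∞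
        (fun q : ℝ × ℝ => (q.1, γ q.2)) (t, 0) := by
      refine ContMDiffAt.prodMk contDiffAt_fst.contMDiffAt ?_
      exact ContMDiffAt.comp (t, (0 : ℝ)) (g := γ) (I' := 𝓘(ℝ, ℝ)) hγs contDiffAt_snd.contMDiffAt
    exact ContMDiffAt.comp (t, (0 : ℝ)) hFl.1.contMDiffAt e1
  have hcX : ∀ q, MDifferentiableAt 𝓘(ℝ, ℝ × ℝ) (𝓡 3) c q →
      mfderiv 𝓘(ℝ, ℝ × ℝ) (𝓡 3) c q (1, 0) = X (c q) := fun q hq => by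
    have e1 : HasMFDerivAt 𝓘(ℝ, ℝ) 𝓘(ℝ, ℝ × ℝ) (fun r : ℝ => (r, q.2)) q.1
        (ContinuousLinearMap.inl ℝ ℝ ℝ) := (hasFDerivAt_prodMk_left q.1 q.2).hasMFDerivAt
    have e2 := HasMFDerivAt.comp q.1 (g := c) (f := fun r : ℝ => (r, q.2)) hq.hasMFDerivAt e1
    have e3 := (hFl.2 (γ q.2)).2 q.1
    have e4 := hasMFDerivAt_unique e2 e3
    have e5 := congrArg (fun L : ℝ →L[ℝ] E3 => L 1) e4
    refine Eq.trans ?_ (e5.trans ?_)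
    · rfl
    · exact one_smul ℝ (X (c q) : E3)
  have hcv : ∀ t, mfderiv 𝓘(ℝ, ℝ × ℝ) (𝓡 3) c (t, 0) (0, 1) =
      (mfderiv (𝓡 3) (𝓡 3) (Fl t) (γ 0) (v : E3) : E3) := fun t => by
    have e1 : HasMFDerivAt 𝓘(ℝ, ℝ) 𝓘(ℝ, ℝ × ℝ) (fun r : ℝ => (t, r)) 0
        (ContinuousLinearMap.inr ℝ ℝ ℝ) := (hasFDerivAt_prodMk_right t 0).hasMFDerivAt
    have e2 := HasMFDerivAt.comp (0 : ℝ) (g := c) (f := fun r : ℝ => (t, r))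
      ((hc t).mdifferentiableAt (by simp)).hasMFDerivAt e1
    have e6 : MDifferentiableAt (𝓡 3) (𝓡 3) (Fl t) (γ 0) := by
      have : ContMDiff (𝓡 3) (𝓡 3) ∞ (Fl t) := hFl.1.comp (contMDiff_const.prodMk contMDiff_id)
      exact this.mdifferentiableAt (by simp)
    have e3 := HasMFDerivAt.comp (0 : ℝ) (g := Fl t) (f := γ) e6.hasMFDerivAt hγd
    have e4 := hasMFDerivAt_unique e2 e3
    have e5 := congrArg (fun L : ℝ →L[ℝ] E3 => L 1) e4
    refine Eq.trans ?_ (e5.trans ?_)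
    · rfl
    · exact congrArg (fun z : E3 => (mfderiv (𝓡 3) (𝓡 3) (Fl t) (γ 0) z : E3)) (one_smul ℝ (v : E3))
  have hev : ∀ t, ∀ᶠ q in 𝓝 (t, (0 : ℝ)), MDifferentiableAt 𝓘(ℝ, ℝ × ℝ) (𝓡 3) c q := fun t =>
    eventually_mdifferentiableAt (hc t)
  let L : ℝ × ℝ → ℝ × ℝ → ℝ := fun w q => α (c q) ![mfderiv 𝓘(ℝ, ℝ × ℝ) (𝓡 3) c q w]
  have hL1 : ∀ t, fderiv ℝ (L (1, 0)) (t, 0) = 0 := fun t => by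
    have : L (1, 0) =ᶠ[𝓝 (t, (0 : ℝ))] fun _ => 1 := by
      filter_upwards [hev t] with q hq
      change α (c q) ![mfderiv 𝓘(ℝ, ℝ × ℝ) (𝓡 3) c q (1, 0)] = 1
      rw [hcX q hq]
      exact h1 (c q)
    rw [this.fderiv_eq]; simp
  have hL2 : ∀ t, HasDerivAt (fun r => L (0, 1) (r, 0)) 0 t := fun t => by
    obtain ⟨hd, hf⟩ := h.two_parameter (hc t)
    have e1 := hf (1, 0) (0, 1)
    rw [hcX _ (hev t).self_of_nhds, h2] at e1
    have e2 : fderiv ℝ (L (0, 1)) (t, 0) (1, 0) - fderiv ℝ (L (1, 0)) (t, 0) (0, 1) = 0 := e1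
    rw [hL1] at e2
    have e3 : fderiv ℝ (L (0, 1)) (t, 0) (1, 0) = 0 := by simpa using e2
    have e4 := (HasFDerivAt.comp t (g := L (0, 1)) (f := fun r : ℝ => (r, (0 : ℝ)))
      (hd (0, 1)).hasFDerivAt (hasFDerivAt_prodMk_left t 0)).hasDerivAt
    exact e4.congr_deriv e3
  have hconst : L (0, 1) (t, 0) = L (0, 1) (0, 0) :=
    is_const_of_deriv_eq_zero (fun r => (hL2 r).differentiableAt) (fun r => (hL2 r).deriv) t 0
  have e1 : ∀ t, L (0, 1) (t, 0) = α (Fl t x) ![mfderiv (𝓡 3) (𝓡 3) (Fl t) x v] := fun t => by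
    change α (c (t, 0)) ![mfderiv 𝓘(ℝ, ℝ × ℝ) (𝓡 3) c (t, 0) (0, 1)] = _
    rw [hcv]
    subst hγ0
    rfl
  rw [e1, e1] at hconst
  rw [hconst]
  have e2 : Fl 0 = id := funext fun y => (hFl.2 y).1
  rw [e2, mfderiv_id]
  rfl

end Flow

/-! ### Stable Hamiltonian structures from proportional exterior derivatives -/

section Family

variable {M : Type*} [TopologicalSpace M] [ChartedSpace E3 M]

/-- The kernel of a 1-form. -/
def kernelField (α : DiffForm (𝓡 3) M 1) : Distribution M := fun x =>
  LinearMap.ker ((ContinuousAlternatingMap.ofSubsingleton ℝ (TangentSpace (𝓡 3) x) ℝ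
    (0 : Fin 1)).symm (α x)).toLinearMap

theorem mem_kernelField {α : DiffForm (𝓡 3) M 1} {x : M} {v : TangentSpace (𝓡 3) x} :
    v ∈ kernelField α x ↔ α x ![v] = 0 := by
  have : (fun _ : Fin 1 => v) = ![v] := by funext i; fin_cases i; rfl
  rw [← this]
  rfl

theorem form_one_smul (α : DiffForm (𝓡 3) M 1) (x : M) (r : ℝ) (v : TangentSpace (𝓡 3) x) :
    α x ![r • v] = r * α x ![v] :=
  (α x).vecCons_smul ![] r v

theorem form_two_smul (β : DiffForm (𝓡 3) M 2) (x : M) (r : ℝ) (v w : TangentSpace (𝓡 3) x) :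
    β x ![r • v, w] = r * β x ![v, w] :=
  (β x).vecCons_smul ![w] r v

variable [IsManifold (𝓡 3) ∞ M]

/-- The field `X` rescaled so that `α(X) = 1`. -/
def normalizedField (α : DiffForm (𝓡 3) M 1) (X : ∀ x : M, TangentSpace (𝓡 3) x) (x : M) :
    TangentSpace (𝓡 3) x := (α x ![X x])⁻¹ • X x

theorem normalizedField_apply {α : DiffForm (𝓡 3) M 1} {X : ∀ x : M, TangentSpace (𝓡 3) x}
    {x : M} (h : α x ![X x] ≠ 0) : α x ![normalizedField α X x] = 1 := by
  rw [normalizedField, form_one_smul, inv_mul_cancel₀ h]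

theorem normalizedField_inChart (α : DiffForm (𝓡 3) M 1) (X : ∀ x : M, TangentSpace (𝓡 3) x)
    (x₀ : M) {y : E3} (hy : y ∈ (extChartAt (𝓡 3) x₀).target) :
    vfInChart (normalizedField α X) x₀ y =
      (α.inChart x₀ y ![vfInChart X x₀ y])⁻¹ • vfInChart X x₀ y := by
  rw [inChart_vfInChart_one α X x₀ hy]
  exact ContinuousLinearMap.map_smul (mfderiv (𝓡 3) 𝓘(ℝ, E3) (extChartAt (𝓡 3) x₀) _) _ _

theorem contDiffOn_inChart_vfInChart {α : DiffForm (𝓡 3) M 1} {X : ∀ x : M, TangentSpace (𝓡 3) x}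
    (hα : α.Smooth) (x₀ : M)
    (hX : ContDiffOn ℝ ∞ (vfInChart X x₀) (extChartAt (𝓡 3) x₀).target) :
    ContDiffOn ℝ ∞ (fun y => α.inChart x₀ y ![vfInChart X x₀ y])
      (extChartAt (𝓡 3) x₀).target := by
  simp only [form_one_expand _ (vfInChart X x₀ _)]
  have h1 : ∀ i : Fin 3, ContDiffOn ℝ ∞ (fun y => vfInChart X x₀ y i)
      (extChartAt (𝓡 3) x₀).target := fun i =>
    (EuclideanSpace.proj (𝕜 := ℝ) i).contDiff.comp_contDiffOn hX
  exact (((h1 0).mul (contDiffOn_form_apply (hα x₀) _)).add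
    ((h1 1).mul (contDiffOn_form_apply (hα x₀) _))).add
    ((h1 2).mul (contDiffOn_form_apply (hα x₀) _))

theorem continuous_form_apply_field {α : DiffForm (𝓡 3) M 1} {X : ∀ x : M, TangentSpace (𝓡 3) x}
    (hα : α.Smooth)
    (hX : ∀ x₀, ContDiffOn ℝ ∞ (vfInChart X x₀) (extChartAt (𝓡 3) x₀).target) :
    Continuous fun x => α x ![X x] := by
  rw [continuous_iff_continuousAt]
  intro x₀
  have h1 := (contDiffOn_inChart_vfInChart hα x₀ (hX x₀)).continuousOn.comp
    (continuousOn_extChartAt x₀) fun x hx => (extChartAt (𝓡 3) x₀).map_source hx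
  refine (h1.continuousAt (extChartAt_source_mem_nhds x₀)).congr ?_
  filter_upwards [extChartAt_source_mem_nhds (I := 𝓡 3) x₀] with x hx
  change α.inChart x₀ _ ![vfInChart X x₀ _] = _
  rw [inChart_vfInChart_one α X x₀ ((extChartAt (𝓡 3) x₀).map_source hx),
    (extChartAt (𝓡 3) x₀).left_inv hx]

theorem contDiffOn_normalizedField {α : DiffForm (𝓡 3) M 1}
    {X : ∀ x : M, TangentSpace (𝓡 3) x} (hα : α.Smooth)
    (hX : ∀ x₀, ContDiffOn ℝ ∞ (vfInChart X x₀) (extChartAt (𝓡 3) x₀).target)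
    (h : ∀ x, α x ![X x] ≠ 0) (x₀ : M) :
    ContDiffOn ℝ ∞ (vfInChart (normalizedField α X) x₀) (extChartAt (𝓡 3) x₀).target := by
  refine ContDiffOn.congr ?_ fun y hy => normalizedField_inChart α X x₀ hy
  refine ContDiffOn.smul ((contDiffOn_inChart_vfInChart hα x₀ (hX x₀)).inv fun y hy => ?_) (hX x₀)
  rw [inChart_vfInChart_one α X x₀ hy]
  exact h _

theorem Generated.isDefiningForm {α : DiffForm (𝓡 3) M 1} {β : DiffForm (𝓡 3) M 2}
    (h : Generated α β) {X : ∀ x : M, TangentSpace (𝓡 3) x} (h1 : ∀ x, α x ![X x] ≠ 0) :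
    IsDefiningForm α (kernelField α) :=
  ⟨h.smooth, fun x hx => h1 x (by rw [hx]; rfl), fun _ _ => mem_kernelField⟩

/-- The kernel of `α` is preserved by the flow of a field `X` with `α(X) = 1` and `ι_X dα = 0`.
Mapping onto the kernel follows from the group law of the flow. -/
theorem Generated.flow_kernelField [T2Space M] {α : DiffForm (𝓡 3) M 1} {β : DiffForm (𝓡 3) M 2}
    (h : Generated α β) {X : ∀ x : M, TangentSpace (𝓡 3) x} (h1 : ∀ x, α x ![X x] = 1)
    (h2 : ∀ x v, β x ![X x, v] = 0) [IsManifold (𝓡 3) 1 M] (hX : SmoothVF X) {Fl : ℝ → M → M}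
    (hFl : IsFlow Fl X) (t : ℝ) (x : M) :
    (kernelField α x).map (mfderiv (𝓡 3) (𝓡 3) (Fl t) x).toLinearMap =
      kernelField α (Fl t x) := by
  have hsm : ∀ t, ContMDiff (𝓡 3) (𝓡 3) ∞ (Fl t) := fun t =>
    hFl.1.comp (contMDiff_const.prodMk contMDiff_id)
  have hgroup : ∀ y, Fl t (Fl (-t) y) = y := fun y => by
    have e1 : IsMIntegralCurve (fun s => Fl s (Fl (-t) y)) X := (hFl.2 _).2
    have e2 : IsMIntegralCurve ((fun s => Fl s y) ∘ (· + -t)) X := ((hFl.2 y).2).comp_add (-t)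
    have e3 := isMIntegralCurve_Ioo_eq_of_contMDiff_boundaryless (t₀ := 0)
      (ContMDiff.of_le hX (by simp)) e1 e2 (by simp [(hFl.2 _).1])
    have e4 := congrFun e3 t
    simpa [(hFl.2 y).1] using e4
  apply le_antisymm
  · rintro _ ⟨v, hv, rfl⟩
    rw [SetLike.mem_coe, mem_kernelField] at hv
    rw [mem_kernelField, ← hv]
    exact h.flow_pullback h1 h2 hFl t x v
  · intro w hw
    have hgroup' : Fl (-t) (Fl t x) = x := by
      have e1 : IsMIntegralCurve (fun s => Fl s (Fl t x)) X := (hFl.2 _).2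
      have e2 : IsMIntegralCurve ((fun s => Fl s x) ∘ (· + t)) X := ((hFl.2 x).2).comp_add t
      have e3 := isMIntegralCurve_Ioo_eq_of_contMDiff_boundaryless (t₀ := 0)
        (ContMDiff.of_le hX (by simp)) e1 e2 (by simp [(hFl.2 _).1])
      have e4 := congrFun e3 (-t)
      simpa [(hFl.2 x).1] using e4
    have h3 := mfderiv_comp (Fl t x) (g := Fl t) (f := Fl (-t))
      ((hsm t).mdifferentiableAt (by simp)) ((hsm (-t)).mdifferentiableAt (by simp))
    have h4 : Fl t ∘ Fl (-t) = id := funext hgroup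
    rw [h4, mfderiv_id] at h3
    let D : M → E3 →L[ℝ] E3 := fun z => mfderiv (𝓡 3) (𝓡 3) (Fl t) z
    let v : E3 := mfderiv (𝓡 3) (𝓡 3) (Fl (-t)) (Fl t x) w
    have h5 : D (Fl (-t) (Fl t x)) v = w := (congrArg (fun L : E3 →L[ℝ] E3 => L w) h3).symm
    rw [hgroup'] at h5
    refine ⟨v, ?_, h5⟩
    refine (mem_kernelField (α := α) (x := x) (v := v)).2 ?_
    refine (h.flow_pullback h1 h2 hFl t x v).symm.trans ?_
    rw [mem_kernelField] at hw
    exact (congrArg (fun z : E3 => α (Fl t x) ![z]) h5).trans hw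

/-- If `dα` is everywhere a multiple of the exact form `β` and `α ∧ β > 0`, then `ker α`, the
kernel direction of `β`, normalized by `α`, and `β` form a stable Hamiltonian structure. -/
def stableHamiltonianOf [T2Space M] {vol : DiffForm (𝓡 3) M 3}
    (X : ∀ x : M, TangentSpace (𝓡 3) x) {α γ : DiffForm (𝓡 3) M 1} {δ β : DiffForm (𝓡 3) M 2}
    (hα : Generated α δ) (hβ : Generated γ β) (hXβ : ∀ x v, β x ![X x, v] = 0)
    (hX : ∀ x₀, ContDiffOn ℝ ∞ (vfInChart X x₀) (extChartAt (𝓡 3) x₀).target)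
    (hαX : ∀ x, α x ![X x] ≠ 0) (hδ : ∀ x, ∃ r : ℝ, δ x = r • β x)
    (hpos : ∀ x u v w, 0 < vol x ![u, v, w] → 0 < topForm α β x ![u, v, w]) :
    StableHamiltonianStructure M vol where
  ξ := kernelField α
  X := normalizedField α X
  Ω := β
  coorientable := ⟨α, hα.isDefiningForm hαX⟩
  smooth_X := smoothVF_of_inChart (contDiffOn_normalizedField hα.smooth hX hαX)
  transverse x hx := by
    rw [mem_kernelField, normalizedField_apply (hαX x)] at hx
    exact one_ne_zero hx
  flow_preserves Fl hFl t x := by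
    have : IsManifold (𝓡 3) 1 M := .of_le (n := ∞) (by simp)
    refine hα.flow_kernelField (fun x => normalizedField_apply (hαX x)) (fun x v => ?_)
      (smoothVF_of_inChart (contDiffOn_normalizedField hα.smooth hX hαX)) hFl t x
    obtain ⟨r, hr⟩ := hδ x
    rw [hr, normalizedField]
    refine (congrArg (r * ·) (form_two_smul β x _ _ _)).trans ?_
    rw [hXβ, mul_zero, mul_zero]
  smooth_Ω := hβ.smooth_snd
  closed := hβ.closed
  taming x v hv w hw h := by
    have h1 := hpos x _ _ _ h
    rw [mem_kernelField] at hv hw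
    rw [topForm_apply, wedge, normalizedField_apply (hαX x), hv, hw] at h1
    simpa using h1
  contraction x v := by
    rw [normalizedField, form_two_smul, hXβ, mul_zero]

/-- Let `dα₀ = c β` and `dμ = (1 - c) β` with `0 ≤ c ≤ 1` and `α₀ ∧ β > 0`. Then the forms
`α₀ + ε μ` define contact structures for small `ε > 0`, and with `β` as taming form they give
stable Hamiltonian structures that converge to the one of `α₀`. -/
theorem exists_family_of_proportional [T2Space M] [CompactSpace M] {vol : DiffForm (𝓡 3) M 3}
    (hvol : ∀ x, vol x ≠ 0) {α₀ μ : DiffForm (𝓡 3) M 1} {β₀ ν : DiffForm (𝓡 3) M 2}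
    (hα : Generated α₀ β₀) (hμ : Generated μ ν) (c : M → ℝ) (hc : ∀ x, c x ∈ Icc (0 : ℝ) 1)
    (hβc : ∀ x, β₀ x = c x • (β₀ + ν) x) (hνc : ∀ x, ν x = (1 - c x) • (β₀ + ν) x)
    (hpos : ∀ x u v w, 0 < vol x ![u, v, w] → 0 < topForm α₀ (β₀ + ν) x ![u, v, w]) :
    ∃ (H₀ : StableHamiltonianStructure M vol) (H : ℝ → StableHamiltonianStructure M vol)
      (ε₀ : ℝ), 0 < ε₀ ∧ H₀.ξ = kernelField α₀ ∧ (∀ x, α₀ x ![H₀.X x] = 1) ∧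
      IsConfoliation vol H₀.ξ ∧
      (∀ ε ∈ Ioo 0 ε₀, IsDefiningForm (α₀ + ε • μ) (H ε).ξ ∧ IsContactForm vol (α₀ + ε • μ) ∧
        (α₀ + ε • μ).d = β₀ + ε • ν ∧ ∀ x, ∃ r : ℝ, 0 < r ∧ (β₀ + ε • ν) x = r • (β₀ + ν) x) ∧
      SHSTendsto H H₀ := by
  have hβ : Generated (α₀ + μ) (β₀ + ν) := hα.add hμ
  generalize hβdef : β₀ + ν = β at *
  have hne : ∀ x, topForm α₀ β x ≠ 0 := fun x h0 => by
    obtain ⟨u, v, w, h⟩ := exists_positive_basis (hvol x)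
    have := hpos x u v w h
    rw [h0] at this
    exact lt_irrefl _ this
  let X := reebField α₀ β
  have hX1 : ∀ x, α₀ x ![X x] = 1 := fun x => reebField_normalized (hne x)
  have hXβ : ∀ x v, β x ![X x, v] = 0 := reebField_contraction α₀ β
  have hX : ∀ x₀, ContDiffOn ℝ ∞ (vfInChart X x₀) (extChartAt (𝓡 3) x₀).target :=
    contDiffOn_reebField hα.smooth hβ.smooth_snd hne
  obtain ⟨K, hK⟩ : ∃ K, ∀ x, |μ x ![X x]| ≤ K := by
    obtain ⟨K, hK⟩ := isCompact_univ.exists_bound_of_continuousOn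
      (continuous_form_apply_field hμ.smooth hX).continuousOn
    exact ⟨K, fun x => hK x (mem_univ x)⟩
  -- The bound keeps `(α₀ + ε μ) X = 1 + ε μ X` positive, so that `X` can be normalized.
  let ε₀ : ℝ := (|K| + 1)⁻¹
  have hε₀ : 0 < ε₀ := by positivity
  have hε₀1 : ε₀ ≤ 1 := inv_le_one_of_one_le₀ (by linarith [abs_nonneg K])
  have hgen : ∀ ε : ℝ, Generated (α₀ + ε • μ) (β₀ + ε • ν) := fun ε => hα.add (hμ.smul ε)
  have happ : ∀ (ε : ℝ) x, (α₀ + ε • μ) x ![X x] = 1 + ε * μ x ![X x] := fun ε x => by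
    rw [← hX1 x]; rfl
  have hXpos : ∀ ε ∈ Ioo 0 ε₀, ∀ x, 0 < (α₀ + ε • μ) x ![X x] := fun ε hε x => by
    rw [happ]
    have h1 : |ε * μ x ![X x]| ≤ ε * |K| := by
      rw [abs_mul, abs_of_pos hε.1]
      exact mul_le_mul_of_nonneg_left ((hK x).trans (le_abs_self K)) hε.1.le
    have h2 : ε * (|K| + 1) < 1 := by
      have := mul_lt_mul_of_pos_right hε.2 (show 0 < |K| + 1 by positivity)
      rwa [inv_mul_cancel₀ (by positivity)] at this
    have h3 := neg_abs_le (ε * μ x ![X x])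
    nlinarith [hε.1]
  have hprop : ∀ (ε : ℝ) x, (β₀ + ε • ν) x = (c x + ε * (1 - c x)) • β x := fun ε x => by
    change β₀ x + ε • ν x = _
    rw [hνc x, add_smul, mul_smul, ← hβc x]
  have hrpos : ∀ ε ∈ Ioo 0 ε₀, ∀ x, 0 < c x + ε * (1 - c x) := fun ε hε x => by
    have h1 := (hc x).1
    have h2 := hε.1
    have h3 : ε < 1 := hε.2.trans_le hε₀1
    nlinarith
  have htop : ∀ (ε : ℝ) x (v : Fin 3 → TangentSpace (𝓡 3) x),
      topForm (α₀ + ε • μ) β x v = (α₀ + ε • μ) x ![X x] * topForm α₀ β x v := fun ε x v =>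
    wedgeForm_eq_smul (a := α₀ x) (c := (α₀ + ε • μ) x) (hX1 x) (hXβ x) v (hne x)
  have hposε : ∀ ε ∈ Ioo 0 ε₀, ∀ x u v w, 0 < vol x ![u, v, w] →
      0 < topForm (α₀ + ε • μ) β x ![u, v, w] := fun ε hε x u v w h => by
    rw [htop]
    exact mul_pos (hXpos ε hε x) (hpos x u v w h)
  have hwedge : ∀ (a : DiffForm (𝓡 3) M 1) (δ : DiffForm (𝓡 3) M 2) (x : M) (r : ℝ),
      δ x = r • β x → ∀ u v w, wedge a δ x u v w = r * topForm a β x ![u, v, w] := by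
    intro a δ x r h u v w
    rw [← topForm_apply]
    have h1 : topForm a δ x = r • topForm a β x :=
      (congrArg (fun b => wedgeForm (V := E3) (a x) b) h).trans (wedgeForm_smul (V := E3) _ _ _)
    rw [h1]; rfl
  let H₀ : StableHamiltonianStructure M vol := stableHamiltonianOf X hα hβ hXβ hX
    (fun x => by rw [hX1]; exact one_ne_zero) (fun x => ⟨c x, hβc x⟩) hpos
  let Hpos : ∀ ε ∈ Ioo 0 ε₀, StableHamiltonianStructure M vol := fun ε hε =>
    stableHamiltonianOf X (hgen ε) hβ hXβ hX (fun x => (hXpos ε hε x).ne')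
      (fun x => ⟨_, hprop ε x⟩) (hposε ε hε)
  let H : ℝ → StableHamiltonianStructure M vol := fun ε =>
    open Classical in if hε : ε ∈ Ioo 0 ε₀ then Hpos ε hε else H₀
  have hH : ∀ ε (hε : ε ∈ Ioo 0 ε₀), H ε = Hpos ε hε := fun ε hε => dif_pos hε
  have hdef : ∀ ε ∈ Ioo 0 ε₀, IsDefiningForm (α₀ + ε • μ) (H ε).ξ := fun ε hε => by
    rw [hH ε hε]
    exact (hgen ε).isDefiningForm fun x => (hXpos ε hε x).ne'
  have hdef₀ : IsDefiningForm α₀ H₀.ξ := hα.isDefiningForm (X := X) fun x => by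
    rw [hX1]; exact one_ne_zero
  have hev : ∀ᶠ ε in 𝓝[>] (0 : ℝ), ε ∈ Ioo 0 ε₀ := Ioo_mem_nhdsGT hε₀
  refine ⟨H₀, H, ε₀, hε₀, rfl, fun x => ?_, ⟨α₀, hdef₀, ?_⟩, fun ε hε => ⟨hdef ε hε, ?_,
    (hgen ε).d_eq, fun x => ⟨_, hrpos ε hε x, hprop ε x⟩⟩, ⟨fun ε => α₀ + ε • μ, α₀, ?_, hdef₀, ?_⟩,
    ?_, ?_⟩
  · exact normalizedField_apply (by rw [hX1]; exact one_ne_zero)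
  · intro x u v w h
    rw [hα.d_eq, hwedge α₀ β₀ x (c x) (hβc x)]
    exact mul_nonneg (hc x).1 (hpos x u v w h).le
  · intro x u v w h
    rw [(hgen ε).d_eq, hwedge _ _ x _ (hprop ε x)]
    exact mul_pos (hrpos ε hε x) (hposε ε hε x u v w h)
  · filter_upwards [hev] with ε hε using hdef ε hε
  · intro x₀
    refine tendstoCInftyOn_of_joint (f := fun ε y => α₀.inChart x₀ y + ε • μ.inChart x₀ y)
      (W := univ ×ˢ (extChartAt (𝓡 3) x₀).target) (isOpen_univ.prod (isOpen_extChartAt_target' x₀))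
      (isOpen_extChartAt_target' x₀) (fun y hy => ⟨trivial, hy⟩) ?_ ?_ ?_
    · have h1 : ContDiffOn ℝ ∞ (fun p : ℝ × E3 => α₀.inChart x₀ p.2)
          (univ ×ˢ (extChartAt (𝓡 3) x₀).target) :=
        (hα.smooth x₀).comp contDiffOn_snd fun p hp => hp.2
      have h2 : ContDiffOn ℝ ∞ (fun p : ℝ × E3 => μ.inChart x₀ p.2)
          (univ ×ˢ (extChartAt (𝓡 3) x₀).target) :=
        (hμ.smooth x₀).comp contDiffOn_snd fun p hp => hp.2
      exact h1.add (contDiffOn_fst.smul h2)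
    · exact Eventually.of_forall fun ε y _ => rfl
    · intro y _
      simp
  · intro x₀
    let V := vfInChart X x₀
    let D : ℝ × E3 → ℝ := fun p =>
      α₀.inChart x₀ p.2 ![V p.2] + p.1 * μ.inChart x₀ p.2 ![V p.2]
    have hD : ContDiffOn ℝ ∞ D (univ ×ˢ (extChartAt (𝓡 3) x₀).target) := by
      have h1 : ContDiffOn ℝ ∞ (fun p : ℝ × E3 => α₀.inChart x₀ p.2 ![V p.2])
          (univ ×ˢ (extChartAt (𝓡 3) x₀).target) :=
        (contDiffOn_inChart_vfInChart hα.smooth x₀ (hX x₀)).comp contDiffOn_snd fun p hp => hp.2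
      have h2 : ContDiffOn ℝ ∞ (fun p : ℝ × E3 => μ.inChart x₀ p.2 ![V p.2])
          (univ ×ˢ (extChartAt (𝓡 3) x₀).target) :=
        (contDiffOn_inChart_vfInChart hμ.smooth x₀ (hX x₀)).comp contDiffOn_snd fun p hp => hp.2
      exact h1.add (contDiffOn_fst.mul h2)
    have hV : ContDiffOn ℝ ∞ (fun p : ℝ × E3 => V p.2)
        (univ ×ˢ (extChartAt (𝓡 3) x₀).target) :=
      (hX x₀).comp contDiffOn_snd fun p hp => hp.2
    refine tendstoCInftyOn_of_joint (f := fun ε y => (D (ε, y))⁻¹ • V y)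
      (W := (univ ×ˢ (extChartAt (𝓡 3) x₀).target) ∩ D ⁻¹' {0}ᶜ)
      (hD.continuousOn.isOpen_inter_preimage
        (isOpen_univ.prod (isOpen_extChartAt_target' x₀)) isOpen_compl_singleton)
      (isOpen_extChartAt_target' x₀) (fun y hy => ⟨⟨trivial, hy⟩, ?_⟩) ?_ ?_ ?_
    · change α₀.inChart x₀ y ![V y] + 0 * _ ≠ 0
      rw [inChart_vfInChart_one α₀ X x₀ hy, hX1]
      simp
    · exact ((hD.mono inter_subset_left).inv fun p hp => hp.2).smul (hV.mono inter_subset_left)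
    · filter_upwards [hev] with ε hε y hy
      have h1 : (H ε).X = normalizedField (α₀ + ε • μ) X := by rw [hH ε hε]; rfl
      rw [h1]
      exact normalizedField_inChart _ X x₀ hy
    · intro y hy
      refine (normalizedField_inChart α₀ X x₀ hy).trans ?_
      simp [D, V]
  · intro x₀
    refine tendstoCInftyOn_of_joint (f := fun _ y => β.inChart x₀ y)
      (W := univ ×ˢ (extChartAt (𝓡 3) x₀).target) (isOpen_univ.prod (isOpen_extChartAt_target' x₀))
      (isOpen_extChartAt_target' x₀) (fun y hy => ⟨trivial, hy⟩) ?_ ?_ ?_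
    · exact (hβ.smooth_snd x₀).comp contDiffOn_snd fun p hp => hp.2
    · filter_upwards [hev] with ε hε y hy
      rw [hH ε hε]; rfl
    · intro y _
      rfl

end Family

/-! ### Local parametrizations -/

section LocalParam

variable {M : Type*} [TopologicalSpace M] [ChartedSpace E3 M] [IsManifold (𝓡 3) ∞ M] [T2Space M]
  {V : Type*} [NormedAddCommGroup V] [NormedSpace ℝ V]

/-- The germ of a smooth function at a point extends to a global smooth function. -/
theorem exists_smooth_extension {f : M → V} {x : M}
    (hf : ∀ᶠ y in 𝓝 x, ContMDiffAt (𝓡 3) 𝓘(ℝ, V) ∞ f y) :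
    ∃ g : M → V, ContMDiff (𝓡 3) 𝓘(ℝ, V) ∞ g ∧ g =ᶠ[𝓝 x] f := by
  obtain ⟨χ, -, hχ⟩ := (SmoothBumpFunction.nhds_basis_tsupport (I := 𝓡 3) x).mem_iff.1 hf
  refine ⟨fun y => χ y • f y, ?_, ?_⟩
  · refine contMDiff_of_tsupport fun y hy => ?_
    exact (χ.contMDiff.contMDiffAt).smul (hχ (tsupport_smul_subset_left _ _ hy))
  · filter_upwards [χ.eventuallyEq_one] with y hy
    rw [hy]; simp

/-- The inverse function theorem for a parametrization `F` of a piece of `M`: near `F u` it has a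
smooth inverse, which extends to a smooth map on all of `M`. -/
theorem exists_smooth_inverse [FiniteDimensional ℝ V] (hV : Module.finrank ℝ V = 3)
    {F : V → M} {u : V} (hF : ∀ᶠ v in 𝓝 u, ContMDiffAt 𝓘(ℝ, V) (𝓡 3) ∞ F v)
    (hs : Surjective (mfderiv 𝓘(ℝ, V) (𝓡 3) F u)) :
    ∃ G : M → V, ContMDiff (𝓡 3) 𝓘(ℝ, V) ∞ G ∧ (∀ᶠ y in 𝓝 (F u), F (G y) = y) ∧
      ∀ᶠ v in 𝓝 u, G (F v) = v := by
  have : CompleteSpace V := FiniteDimensional.complete ℝ V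
  have hM1 : IsManifold (𝓡 3) 1 M := .of_le (n := ∞) (by simp)
  let x := F u
  let e := extChartAt (𝓡 3) x
  let f : V → E3 := e ∘ F
  have hFu := hF.self_of_nhds
  have hsrc : ∀ᶠ v in 𝓝 u, F v ∈ e.source :=
    hFu.continuousAt.eventually (extChartAt_source_mem_nhds (I := 𝓡 3) x)
  have hf : ∀ᶠ v in 𝓝 u, ContDiffAt ℝ ∞ f v := by
    filter_upwards [hF, hsrc] with v hv hv'
    rw [← contMDiffAt_iff_contDiffAt]
    exact (contMDiffAt_extChartAt' (by simpa [e] using hv')).comp v hv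
  have hfu := hf.self_of_nhds
  have hfs : Surjective (fderiv ℝ f u) := by
    have h1 := mfderiv_comp u (g := e) (f := F)
      (mdifferentiableAt_extChartAt (I := 𝓡 3) (mem_chart_source E3 x))
      (hFu.mdifferentiableAt (by simp))
    rw [mfderiv_eq_fderiv] at h1
    have h2 : Surjective (mfderiv (𝓡 3) 𝓘(ℝ, E3) e (F u)) := fun w =>
      ⟨_, by
        have := mfderiv_comp_mfderivWithin_symm x (mem_extChartAt_target (I := 𝓡 3) x) w
        rw [extChartAt_to_inv] at this
        exact this⟩
    intro w
    obtain ⟨z, hz⟩ := h2 w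
    obtain ⟨v, hv⟩ := hs z
    refine ⟨v, ?_⟩
    have h3 := congrArg (fun L : V →L[ℝ] E3 => L v) h1
    refine Eq.trans h3 ?_
    refine Eq.trans ?_ hz
    exact congrArg (fun z => mfderiv (𝓡 3) 𝓘(ℝ, E3) e (F u) z) hv
  have hfin : Module.finrank ℝ V = Module.finrank ℝ E3 := by rw [hV]; simp
  have hinj : Injective (fderiv ℝ f u) :=
    ((fderiv ℝ f u).toLinearMap.injective_iff_surjective_of_finrank_eq_finrank hfin).2 hfs
  let A : V ≃L[ℝ] E3 :=
    (LinearEquiv.ofBijective (fderiv ℝ f u).toLinearMap ⟨hinj, hfs⟩).toContinuousLinearEquiv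
  have hA : HasFDerivAt f (A : V →L[ℝ] E3) u := by
    have h1 := (hfu.differentiableAt (by simp)).hasFDerivAt
    have h2 : (A : V →L[ℝ] E3) = fderiv ℝ f u := by ext v; rfl
    rw [h2]; exact h1
  have hinf : (∞ : WithTop ℕ∞) ≠ 0 := by simp
  let ψ := hfu.toOpenPartialHomeomorph f hA hinf
  have hu : u ∈ ψ.source := hfu.mem_toOpenPartialHomeomorph_source hA hinf
  have hinv : ∀ᶠ v in 𝓝 u, ∃ B : V ≃L[ℝ] E3, (B : V →L[ℝ] E3) = fderiv ℝ f v := by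
    have h1 : ContinuousAt (fderiv ℝ f) u :=
      (hfu.fderiv_right (m := ∞) (by simp)).continuousAt
    have h2 := A.nhds
    rw [← hA.fderiv] at h2
    exact h1.eventually h2
  have hgood : ∀ᶠ z in 𝓝 (f u), ContDiffAt ℝ ∞ ψ.symm z := by
    have ht : f u ∈ ψ.target := ψ.map_source hu
    have hc : Tendsto ψ.symm (𝓝 (f u)) (𝓝 u) := by
      have h1 := ψ.continuousAt_symm ht
      have h2 : ψ.symm (f u) = u := ψ.left_inv hu
      rwa [ContinuousAt, h2] at h1
    filter_upwards [ψ.open_target.mem_nhds ht, hc.eventually hinv, hc.eventually hf]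
      with z hz ⟨B, hB⟩ hz3
    refine ψ.contDiffAt_symm hz (f₀' := B) ?_ hz3
    rw [hB]
    exact (hz3.differentiableAt (by simp)).hasFDerivAt
  have hφ : Tendsto e (𝓝 x) (𝓝 (f u)) := continuousAt_extChartAt x
  obtain ⟨G, hG, hGe⟩ := exists_smooth_extension (f := ψ.symm ∘ e) (x := x) (by
    filter_upwards [hφ.eventually hgood, extChartAt_source_mem_nhds (I := 𝓡 3) x] with y hy hys
    exact hy.contMDiffAt.comp y (contMDiffAt_extChartAt' (by simpa [e] using hys)))
  refine ⟨G, hG, ?_, ?_⟩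
  · have ht : f u ∈ ψ.target := ψ.map_source hu
    have hc : Tendsto ψ.symm (𝓝 (f u)) (𝓝 u) := by
      have h1 := ψ.continuousAt_symm ht
      have h2 : ψ.symm (f u) = u := ψ.left_inv hu
      rwa [ContinuousAt, h2] at h1
    filter_upwards [hGe, hφ.eventually (ψ.open_target.mem_nhds ht),
      extChartAt_source_mem_nhds (I := 𝓡 3) x, hφ.eventually (hc.eventually hsrc)]
      with y h1 h2 h3 h4
    rw [h1]
    refine e.injOn h4 h3 ?_
    exact ψ.right_inv h2
  · filter_upwards [hFu.continuousAt.eventually hGe, ψ.open_source.mem_nhds hu] with v h1 h2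
    rw [h1]
    exact ψ.left_inv h2

/-- A function is smooth at `F u` if it is smooth in the parametrization `F`. -/
theorem contMDiffAt_of_param [FiniteDimensional ℝ V] (hV : Module.finrank ℝ V = 3)
    {F : V → M} {u : V} (hF : ∀ᶠ v in 𝓝 u, ContMDiffAt 𝓘(ℝ, V) (𝓡 3) ∞ F v)
    (hs : Surjective (mfderiv 𝓘(ℝ, V) (𝓡 3) F u)) {N : Type*} [NormedAddCommGroup N]
    [NormedSpace ℝ N] {f : M → N} (hf : ContDiffAt ℝ ∞ (f ∘ F) u) :
    ContMDiffAt (𝓡 3) 𝓘(ℝ, N) ∞ f (F u) := by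
  obtain ⟨G, hG, h1, h2⟩ := exists_smooth_inverse hV hF hs
  have h3 : ContMDiffAt (𝓡 3) 𝓘(ℝ, N) ∞ ((f ∘ F) ∘ G) (F u) := by
    refine ContMDiffAt.comp (I' := 𝓘(ℝ, V)) (F u) ?_ hG.contMDiffAt
    rw [h2.self_of_nhds]
    exact hf.contMDiffAt
  refine h3.congr_of_eventuallyEq ?_
  filter_upwards [h1] with y hy
  simp [hy]

/-- A parametrization with surjective differential is open at the given point. -/
theorem map_nhds_param [FiniteDimensional ℝ V] (hV : Module.finrank ℝ V = 3)
    {F : V → M} {u : V} (hF : ∀ᶠ v in 𝓝 u, ContMDiffAt 𝓘(ℝ, V) (𝓡 3) ∞ F v)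
    (hs : Surjective (mfderiv 𝓘(ℝ, V) (𝓡 3) F u)) {s : Set V} (hu : s ∈ 𝓝 u) :
    F '' s ∈ 𝓝 (F u) := by
  obtain ⟨G, hG, h1, h2⟩ := exists_smooth_inverse hV hF hs
  have h3 : Tendsto G (𝓝 (F u)) (𝓝 u) := by
    have := hG.continuous.continuousAt (x := F u)
    rwa [ContinuousAt, h2.self_of_nhds] at this
  filter_upwards [h1, h3 hu] with y hy hy'
  exact ⟨G y, hy', hy⟩

end LocalParam

/-! ### Angular forms of complex functions -/

section AngularForm

variable {M : Type*} [TopologicalSpace M] [ChartedSpace E3 M]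

/-- The 1-form `X dY - Y dX` of a complex function `X + iY`. Where the function does not vanish, it
is the squared modulus times the differential of the argument. -/
def angularForm (Z : M → ℂ) : DiffForm (𝓡 3) M 1 :=
  oneForm (fun x => (Z x).re) (fun x => (Z x).im) + oneForm (fun x => -(Z x).im) fun x => (Z x).re

/-- The exterior derivative `2 dX ∧ dY` of the angular form of `X + iY`. -/
def angularTwoForm (Z : M → ℂ) : DiffForm (𝓡 3) M 2 :=
  twoForm (fun x => (Z x).re) (fun x => (Z x).im) + twoForm (fun x => -(Z x).im) fun x => (Z x).re

variable [IsManifold (𝓡 3) ∞ M]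

theorem contMDiff_re {Z : M → ℂ} (hZ : ContMDiff (𝓡 3) 𝓘(ℝ, ℂ) ∞ Z) :
    ContMDiff (𝓡 3) 𝓘(ℝ, ℝ) ∞ fun x => (Z x).re :=
  Complex.reCLM.contDiff.contMDiff.comp hZ

theorem contMDiff_im {Z : M → ℂ} (hZ : ContMDiff (𝓡 3) 𝓘(ℝ, ℂ) ∞ Z) :
    ContMDiff (𝓡 3) 𝓘(ℝ, ℝ) ∞ fun x => (Z x).im :=
  Complex.imCLM.contDiff.contMDiff.comp hZ

theorem generated_angularForm {Z : M → ℂ} (hZ : ContMDiff (𝓡 3) 𝓘(ℝ, ℂ) ∞ Z) :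
    Generated (angularForm Z) (angularTwoForm Z) :=
  (Generated.basic (contMDiff_re hZ) (contMDiff_im hZ)).add
    (Generated.basic (contMDiff_im hZ).neg (contMDiff_re hZ))

theorem differential_neg {b : M → ℝ} (x : M) :
    differential (fun x => -b x) x = -differential b x :=
  mfderiv_neg

theorem angularForm_apply (Z : M → ℂ) (x : M) (v : TangentSpace (𝓡 3) x) :
    angularForm Z x ![v] = (Z x).re * differential (fun x => (Z x).im) x v -
      (Z x).im * differential (fun x => (Z x).re) x v := by
  refine (congrArg₂ (fun r s : ℝ => r + s) (oneForm_apply _ _ _ ![v])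
    (oneForm_apply _ _ _ ![v])).trans ?_
  simp
  ring

theorem angularTwoForm_apply (Z : M → ℂ) (x : M) (v w : TangentSpace (𝓡 3) x) :
    angularTwoForm Z x ![v, w] =
      2 * (differential (fun x => (Z x).re) x v * differential (fun x => (Z x).im) x w -
        differential (fun x => (Z x).re) x w * differential (fun x => (Z x).im) x v) := by
  refine (congrArg₂ (fun r s : ℝ => r + s) (twoForm_apply _ _ _ ![v, w])
    (twoForm_apply _ _ _ ![v, w])).trans ?_
  rw [differential_neg]
  change _ * _ - _ * _ + ((-_) * _ - (-_) * _) = _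
  simp
  ring

/-- If the complex function is `X + iY` in a parametrization, this is its angular form. -/
theorem angularForm_param {V : Type*} [NormedAddCommGroup V] [NormedSpace ℝ V] {Z : M → ℂ}
    (hZ : ContMDiff (𝓡 3) 𝓘(ℝ, ℂ) ∞ Z) {F : V → M} {u : V}
    (hF : MDifferentiableAt 𝓘(ℝ, V) (𝓡 3) F u) {X Y : V → ℝ} {X' Y' : V →L[ℝ] ℝ}
    (hZF : ∀ᶠ v in 𝓝 u, Z (F v) = ⟨X v, Y v⟩) (hX : HasFDerivAt X X' u) (hY : HasFDerivAt Y Y' u)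
    (v : V) : angularForm Z (F u) ![mfderiv 𝓘(ℝ, V) (𝓡 3) F u v] = X u * Y' v - Y u * X' v := by
  rw [angularForm_apply]
  have h1 := differential_comp (contMDiff_re hZ) hF v
  have h2 := differential_comp (contMDiff_im hZ) hF v
  have h3 : (fun x => (Z x).re) ∘ F =ᶠ[𝓝 u] X := by
    filter_upwards [hZF] with v hv; simp [hv]
  have h4 : (fun x => (Z x).im) ∘ F =ᶠ[𝓝 u] Y := by
    filter_upwards [hZF] with v hv; simp [hv]
  rw [h3.fderiv_eq, hX.fderiv] at h1
  rw [h4.fderiv_eq, hY.fderiv] at h2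
  rw [hZF.self_of_nhds]
  exact congrArg₂ (fun r s : ℝ => X u * r - Y u * s) h2 h1

theorem angularTwoForm_param {V : Type*} [NormedAddCommGroup V] [NormedSpace ℝ V] {Z : M → ℂ}
    (hZ : ContMDiff (𝓡 3) 𝓘(ℝ, ℂ) ∞ Z) {F : V → M} {u : V}
    (hF : MDifferentiableAt 𝓘(ℝ, V) (𝓡 3) F u) {X Y : V → ℝ} {X' Y' : V →L[ℝ] ℝ}
    (hZF : ∀ᶠ v in 𝓝 u, Z (F v) = ⟨X v, Y v⟩) (hX : HasFDerivAt X X' u) (hY : HasFDerivAt Y Y' u)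
    (v w : V) : angularTwoForm Z (F u) ![mfderiv 𝓘(ℝ, V) (𝓡 3) F u v,
      mfderiv 𝓘(ℝ, V) (𝓡 3) F u w] = 2 * (X' v * Y' w - X' w * Y' v) := by
  rw [angularTwoForm_apply]
  have h3 : (fun x => (Z x).re) ∘ F =ᶠ[𝓝 u] X := by
    filter_upwards [hZF] with v hv; simp [hv]
  have h4 : (fun x => (Z x).im) ∘ F =ᶠ[𝓝 u] Y := by
    filter_upwards [hZF] with v hv; simp [hv]
  have h1 : ∀ v, differential (fun x => (Z x).re) (F u) (mfderiv 𝓘(ℝ, V) (𝓡 3) F u v) = X' v :=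
    fun v => by
      have := differential_comp (contMDiff_re hZ) hF v
      rwa [h3.fderiv_eq, hX.fderiv] at this
  have h2 : ∀ v, differential (fun x => (Z x).im) (F u) (mfderiv 𝓘(ℝ, V) (𝓡 3) F u v) = Y' v :=
    fun v => by
      have := differential_comp (contMDiff_im hZ) hF v
      rwa [h4.fderiv_eq, hY.fderiv] at this
  exact congrArg₂ (fun r s : ℝ => 2 * (r - s)) (congrArg₂ (fun r s : ℝ => r * s) (h1 v) (h2 w))
    (congrArg₂ (fun r s : ℝ => r * s) (h1 w) (h2 v))

end AngularForm

/-! ### Radial profiles -/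

section Profiles

open Real

/-- An interpolation between `1` for `s ≤ 1/8` and `s` for `s ≥ 1/4`. -/
def interp (s : ℝ) : ℝ := smoothTransition (8 * s - 1) * s + (1 - smoothTransition (8 * s - 1))

theorem interp_pos (s : ℝ) : 0 < interp s := by
  have h0 := smoothTransition.nonneg (8 * s - 1)
  have h1 := smoothTransition.le_one (8 * s - 1)
  rcases le_or_gt (8 * s - 1) 0 with h | h
  · simp [interp, smoothTransition.zero_of_nonpos h]
  · have hs : 0 < s := by linarith
    have h2 := smoothTransition.pos_of_pos h
    unfold interp
    nlinarith [mul_pos h2 hs]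

theorem contDiff_interp : ContDiff ℝ ∞ interp := by
  have h : ContDiff ℝ ∞ fun s : ℝ => smoothTransition (8 * s - 1) :=
    smoothTransition.contDiff.comp ((contDiff_const.mul contDiff_id).sub contDiff_const)
  exact (h.mul contDiff_id).add (contDiff_const.sub h)

/-- The radial profile `k` of the function `z k(|z|²)`, whose modulus is `1` for `|z| ≥ 1/2`. -/
def discProfile (s : ℝ) : ℝ := (√(interp s))⁻¹

theorem contDiff_discProfile : ContDiff ℝ ∞ discProfile :=
  (contDiff_interp.sqrt fun s => (interp_pos s).ne').inv
    fun s => (Real.sqrt_pos.2 (interp_pos s)).ne'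

theorem discProfile_sq (s : ℝ) : discProfile s ^ 2 = (interp s)⁻¹ := by
  rw [discProfile, inv_pow, Real.sq_sqrt (interp_pos s).le]

theorem discProfile_pos (s : ℝ) : 0 < discProfile s :=
  inv_pos.2 (Real.sqrt_pos.2 (interp_pos s))

theorem interp_of_ge {s : ℝ} (hs : 1 / 4 ≤ s) : interp s = s := by
  have : smoothTransition (8 * s - 1) = 1 := smoothTransition.one_of_one_le (by linarith)
  rw [interp, this]; ring

theorem discProfile_eq_of_ge {s : ℝ} (hs : 1 / 4 ≤ s) : discProfile s = (√s)⁻¹ := by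
  rw [discProfile, interp_of_ge hs]

theorem mul_discProfile_sq_monotone {s t : ℝ} (hs : 0 ≤ s) (hst : s ≤ t) :
    s * discProfile s ^ 2 ≤ t * discProfile t ^ 2 := by
  rw [discProfile_sq, discProfile_sq, ← div_eq_mul_inv, ← div_eq_mul_inv,
    div_le_div_iff₀ (interp_pos s) (interp_pos t)]
  have h0 := smoothTransition.nonneg (8 * s - 1)
  have h1 := smoothTransition.le_one (8 * t - 1)
  have h2 : smoothTransition (8 * s - 1) ≤ smoothTransition (8 * t - 1) :=
    smoothTransition.monotone (by linarith)
  rcases le_or_gt s 1 with h | h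
  · unfold interp
    set a := smoothTransition (8 * s - 1)
    set b := smoothTransition (8 * t - 1)
    nlinarith [mul_nonneg (mul_nonneg (hs.trans hst) (sub_nonneg.2 h2)) (sub_nonneg.2 h),
      mul_nonneg (sub_nonneg.2 hst) (sub_nonneg.2 h1)]
  · rw [interp_of_ge (by linarith), interp_of_ge (by linarith), mul_comm]

/-- The density of `d(k² (x dy - y dx))` on the disc. -/
def discDensity (s : ℝ) : ℝ :=
  2 * (discProfile s ^ 2 + 2 * s * discProfile s * deriv discProfile s)

theorem hasDerivAt_discProfile (s : ℝ) : HasDerivAt discProfile (deriv discProfile s) s :=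
  (contDiff_discProfile.differentiable (by simp) s).hasDerivAt

theorem hasDerivAt_mul_discProfile_sq (s : ℝ) :
    HasDerivAt (fun s => s * discProfile s ^ 2) (discDensity s / 2) s := by
  have h := (hasDerivAt_id s).mul ((hasDerivAt_discProfile s).pow 2)
  refine h.congr_deriv ?_
  simp [discDensity]; ring

theorem discDensity_nonneg {s : ℝ} (hs : 0 ≤ s) : 0 ≤ discDensity s := by
  rcases hs.eq_or_lt with rfl | hs
  · simp [discDensity]; positivity
  · have h : 0 ≤ derivWithin (fun s => s * discProfile s ^ 2) (Ici 0) s :=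
      MonotoneOn.derivWithin_nonneg fun a ha b _ hab => mul_discProfile_sq_monotone ha hab
    rw [derivWithin_of_mem_nhds (Ici_mem_nhds hs), (hasDerivAt_mul_discProfile_sq s).deriv] at h
    linarith

theorem discDensity_zero_pos : 0 < discDensity 0 := by
  simp [discDensity]; exact pow_pos (discProfile_pos 0) 2

theorem discDensity_eq_zero {s : ℝ} (hs : 1 / 4 < s) : discDensity s = 0 := by
  have h1 : (fun s => s * discProfile s ^ 2) =ᶠ[𝓝 s] fun _ => 1 := by
    filter_upwards [Ioi_mem_nhds hs] with t ht
    have ht' : (1 : ℝ) / 4 < t := ht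
    rw [discProfile_sq, interp_of_ge ht'.le, mul_inv_cancel₀ (by linarith)]
  have h2 := (hasDerivAt_mul_discProfile_sq s).deriv
  rw [h1.deriv_eq, deriv_const] at h2
  linarith

theorem hasDerivAt_expNegInvGlue (x : ℝ) :
    HasDerivAt expNegInvGlue (x⁻¹ ^ 2 * expNegInvGlue x) x := by
  have := expNegInvGlue.hasDerivAt_polynomial_eval_inv_mul 1 x
  simpa using this

/-- The profile of the core of the solid torus. -/
def coreProfile (s : ℝ) : ℝ := expNegInvGlue (1 - s)

theorem contDiff_coreProfile : ContDiff ℝ ∞ coreProfile :=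
  expNegInvGlue.contDiff.comp (contDiff_const.sub contDiff_id)

theorem coreProfile_of_ge {s : ℝ} (hs : 1 ≤ s) : coreProfile s = 0 :=
  expNegInvGlue.zero_of_nonpos (by linarith)

theorem coreProfile_pos {s : ℝ} (hs : s < 1) : 0 < coreProfile s :=
  expNegInvGlue.pos_of_pos (by linarith)

theorem hasDerivAt_coreProfile (s : ℝ) :
    HasDerivAt coreProfile (-((1 - s)⁻¹ ^ 2 * coreProfile s)) s := by
  have h := (hasDerivAt_expNegInvGlue (1 - s)).comp s ((hasDerivAt_id s).const_sub 1)
  exact h.congr_deriv (by simp [coreProfile])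

theorem deriv_coreProfile_neg {s : ℝ} (hs : s < 1) : deriv coreProfile s < 0 := by
  rw [(hasDerivAt_coreProfile s).deriv]
  have := coreProfile_pos hs
  have : 0 < 1 - s := by linarith
  simp only [neg_neg_iff_pos]
  positivity

theorem deriv_smoothTransition_pos {x : ℝ} (h0 : 0 < x) (h1 : x < 1) :
    0 < deriv smoothTransition x := by
  have hE := hasDerivAt_expNegInvGlue x
  have hE' := (hasDerivAt_expNegInvGlue (1 - x)).comp x ((hasDerivAt_id x).const_sub 1)
  have h := hE.div (hE.add hE') (smoothTransition.pos_denom x).ne'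
  have h2 : HasDerivAt smoothTransition _ x := h
  rw [h2.deriv]
  have a := expNegInvGlue.pos_of_pos h0
  have b : 0 < expNegInvGlue (1 - x) := expNegInvGlue.pos_of_pos (by linarith)
  apply div_pos _ (by have := smoothTransition.pos_denom x; exact pow_pos this 2)
  simp
  have c : 0 < x⁻¹ := by positivity
  have d : 0 < (1 - x)⁻¹ := inv_pos.2 (by linarith)
  have e : 0 < (x ^ 2)⁻¹ := by positivity
  have f : 0 < ((1 - x) ^ 2)⁻¹ := by
    have : 0 < 1 - x := by linarith
    positivity
  have g := mul_pos (mul_pos a b) e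
  have k := mul_pos (mul_pos a b) f
  nlinarith

theorem deriv_smoothTransition_nonneg (x : ℝ) : 0 ≤ deriv smoothTransition x :=
  smoothTransition.monotone.deriv_nonneg

/-- The profile of the collar: constant for `s ≤ 1/2` and strictly decreasing to `0` at `s = 3`. -/
def collarProfile (s : ℝ) : ℝ := smoothTransition ((3 - s) * (2 / 5))

theorem contDiff_collarProfile : ContDiff ℝ ∞ collarProfile :=
  smoothTransition.contDiff.comp ((contDiff_const.sub contDiff_id).mul contDiff_const)

theorem collarProfile_of_ge {s : ℝ} (hs : 3 ≤ s) : collarProfile s = 0 :=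
  smoothTransition.zero_of_nonpos (by linarith)

theorem collarProfile_nonneg (s : ℝ) : 0 ≤ collarProfile s := smoothTransition.nonneg _

theorem collarProfile_pos {s : ℝ} (hs : s < 3) : 0 < collarProfile s :=
  smoothTransition.pos_of_pos (by linarith)

theorem deriv_collarProfile (s : ℝ) :
    deriv collarProfile s = -(deriv smoothTransition ((3 - s) * (2 / 5)) * (2 / 5)) := by
  have h1 : HasDerivAt smoothTransition _ ((3 - s) * (2 / 5)) :=
    ((smoothTransition.contDiff (n := 1)).differentiable (by simp) _).hasDerivAt
  have h := h1.comp s (((hasDerivAt_id s).const_sub 3).mul_const (2 / 5))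
  have h2 : HasDerivAt collarProfile _ s := h
  rw [h2.deriv]; ring

theorem deriv_collarProfile_nonpos (s : ℝ) : deriv collarProfile s ≤ 0 := by
  rw [deriv_collarProfile]
  have := deriv_smoothTransition_nonneg ((3 - s) * (2 / 5))
  linarith

theorem deriv_collarProfile_neg {s : ℝ} (h1 : 1 / 2 < s) (h2 : s < 3) :
    deriv collarProfile s < 0 := by
  rw [deriv_collarProfile]
  have := deriv_smoothTransition_pos (x := (3 - s) * (2 / 5)) (by linarith) (by linarith)
  linarith

theorem deriv_collarProfile_eq_zero {s : ℝ} (h1 : s < 1 / 2) : deriv collarProfile s = 0 := by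
  have h : collarProfile =ᶠ[𝓝 s] fun _ => 1 := by
    filter_upwards [Iio_mem_nhds h1] with t ht
    have ht' : t < 1 / 2 := ht
    exact smoothTransition.one_of_one_le (by linarith)
  rw [h.deriv_eq, deriv_const]

end Profiles

/-! ### The solid tori and the mapping torus as parametrized pieces of the 3-manifold -/

section Pieces

/-- A linear map into a 3-space is surjective if a 3-form does not vanish on some three values. -/
theorem surjective_of_form_ne_zero {V : Type*} [AddCommGroup V] [Module ℝ V]
    (L : V →ₗ[ℝ] E3) (Ω : E3 [⋀^Fin 3]→L[ℝ] ℝ) {u v w : V} (h : Ω ![L u, L v, L w] ≠ 0) :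
    Surjective L := by
  have hli : LinearIndependent ℝ ![L u, L v, L w] := by
    by_contra hn
    exact h (Ω.toAlternatingMap.map_linearDependent _ hn)
  have hs := hli.span_eq_top_of_card_eq_finrank (by simp)
  rw [← LinearMap.range_eq_top, eq_top_iff, ← hs, Submodule.span_le]
  rintro _ ⟨i, rfl⟩
  fin_cases i
  · exact ⟨u, rfl⟩
  · exact ⟨v, rfl⟩
  · exact ⟨w, rfl⟩

theorem two_pi_mul_arg_div (z : ℂ) : 2 * Real.pi * (z.arg / (2 * Real.pi)) = z.arg :=
  mul_div_cancel₀ _ (by have := Real.pi_pos; positivity)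

theorem norm_mul_exp_arg_div (z : ℂ) : (‖z‖ : ℂ) *
    Complex.exp (2 * Real.pi * ((z.arg / (2 * Real.pi) : ℝ) : ℂ) * Complex.I) = z := by
  rw [← Complex.ofReal_ofNat, ← Complex.ofReal_mul, ← Complex.ofReal_mul, two_pi_mul_arg_div,
    Complex.norm_mul_exp_arg_mul_I]

theorem finrank_prod_complex : Module.finrank ℝ (ℝ × ℂ) = 3 := by simp

theorem finrank_prod_plane : Module.finrank ℝ (ℝ × EuclideanSpace ℝ (Fin 2)) = 3 := by simp

variable {P : Type*} [TopologicalSpace P] [ChartedSpace (EuclideanHalfSpace 2) P]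
  {A : AbstractOpenBook P} {M : Type*} [TopologicalSpace M] [ChartedSpace E3 M]
  (G : Gluing A M)

namespace Gluing

theorem contMDiffAt_σ (i : Fin G.b) {q : ℝ × ℂ} (hq : q.2 ∈ Metric.ball (0 : ℂ) 2) :
    ContMDiffAt 𝓘(ℝ, ℝ × ℂ) (𝓡 3) ∞ (uncurry (G.σ i)) q :=
  (G.σ_smooth i).contMDiffAt ((isOpen_univ.prod Metric.isOpen_ball).mem_nhds ⟨mem_univ _, hq⟩)

theorem eventually_mem_ball {q : ℝ × ℂ} (hq : q.2 ∈ Metric.ball (0 : ℂ) 2) :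
    ∀ᶠ q' in 𝓝 q, q'.2 ∈ Metric.ball (0 : ℂ) 2 :=
  continuous_snd.continuousAt.eventually (Metric.isOpen_ball.mem_nhds hq)

theorem eventually_contMDiffAt_σ (i : Fin G.b) {q : ℝ × ℂ} (hq : q.2 ∈ Metric.ball (0 : ℂ) 2) :
    ∀ᶠ q' in 𝓝 q, ContMDiffAt 𝓘(ℝ, ℝ × ℂ) (𝓡 3) ∞ (uncurry (G.σ i)) q' := by
  filter_upwards [eventually_mem_ball hq] with q' h
  exact G.contMDiffAt_σ i h

theorem mdifferentiableAt_σ (i : Fin G.b) {q : ℝ × ℂ} (hq : q.2 ∈ Metric.ball (0 : ℂ) 2) :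
    MDifferentiableAt 𝓘(ℝ, ℝ × ℂ) (𝓡 3) (uncurry (G.σ i)) q :=
  (G.contMDiffAt_σ i hq).mdifferentiableAt (by simp)

/-- The derivative of the parametrization `σ i`. -/
abbrev dσ (i : Fin G.b) (θ : ℝ) (z : ℂ) : ℝ × ℂ →L[ℝ] TangentSpace (𝓡 3) (G.σ i θ z) :=
  mfderiv 𝓘(ℝ, ℝ × ℂ) (𝓡 3) (uncurry (G.σ i)) (θ, z)

theorem mfderiv_σ_left (i : Fin G.b) (θ : ℝ) {z : ℂ} (hz : z ∈ Metric.ball (0 : ℂ) 2) (a : ℝ) :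
    mfderiv 𝓘(ℝ, ℝ) (𝓡 3) (fun θ' => G.σ i θ' z) θ a = G.dσ i θ z (a, 0) := by
  have h0 : HasFDerivAt (fun θ' : ℝ => (θ', z)) (ContinuousLinearMap.inl ℝ ℝ ℂ) θ :=
    hasFDerivAt_prodMk_left θ z
  have h1 := (G.mdifferentiableAt_σ i (q := (θ, z)) hz).hasMFDerivAt
  have h2 := HasMFDerivAt.comp θ (f := fun θ' : ℝ => (θ', z)) h1 h0.hasMFDerivAt
  exact congrArg (fun L : ℝ →L[ℝ] E3 => L a) h2.mfderiv

theorem mfderiv_σ_right (i : Fin G.b) (θ : ℝ) {z : ℂ} (hz : z ∈ Metric.ball (0 : ℂ) 2) (ζ : ℂ) :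
    mfderiv 𝓘(ℝ, ℂ) (𝓡 3) (G.σ i θ) z ζ = G.dσ i θ z (0, ζ) := by
  have h0 : HasFDerivAt (fun z' : ℂ => (θ, z')) (ContinuousLinearMap.inr ℝ ℝ ℂ) z :=
    hasFDerivAt_prodMk_right θ z
  have h1 := (G.mdifferentiableAt_σ i (q := (θ, z)) hz).hasMFDerivAt
  have h2 := HasMFDerivAt.comp z (f := fun z' : ℂ => (θ, z')) h1 h0.hasMFDerivAt
  exact congrArg (fun L : ℂ →L[ℝ] E3 => L ζ) h2.mfderiv

theorem vol_dσ_pos (i : Fin G.b) (θ : ℝ) {z : ℂ} (hz : z ∈ Metric.ball (0 : ℂ) 2) :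
    0 < G.vol (G.σ i θ z) ![G.dσ i θ z (1, 0), G.dσ i θ z (0, 1), G.dσ i θ z (0, Complex.I)] := by
  rw [← G.mfderiv_σ_left i θ hz, ← G.mfderiv_σ_right i θ hz, ← G.mfderiv_σ_right i θ hz]
  exact G.σ_oriented i θ z hz

theorem surjective_dσ (i : Fin G.b) (θ : ℝ) {z : ℂ} (hz : z ∈ Metric.ball (0 : ℂ) 2) :
    Surjective (G.dσ i θ z) :=
  surjective_of_form_ne_zero (G.dσ i θ z).toLinearMap (G.vol (G.σ i θ z)) (G.vol_dσ_pos i θ hz).ne'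

/-- The concentric solid torus of radius `r`, without its boundary. -/
def openSolid (i : Fin G.b) (r : ℝ) : Set M :=
  uncurry (G.σ i) '' (univ ×ˢ Metric.ball 0 r)

/-- The concentric solid torus of radius `r`. -/
def closedSolid (i : Fin G.b) (r : ℝ) : Set M :=
  uncurry (G.σ i) '' (univ ×ˢ Metric.closedBall 0 r)

theorem ball_subset {r : ℝ} (hr : r ≤ 2) : Metric.ball (0 : ℂ) r ⊆ Metric.ball (0 : ℂ) 2 :=
  Metric.ball_subset_ball hr

theorem closedBall_subset {r : ℝ} (hr : r < 2) :
    Metric.closedBall (0 : ℂ) r ⊆ Metric.ball (0 : ℂ) 2 :=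
  Metric.closedBall_subset_ball hr

theorem σ_add_int (i : Fin G.b) (θ : ℝ) {z : ℂ} (hz : z ∈ Metric.ball (0 : ℂ) 2) (n : ℤ) :
    G.σ i (θ + n) z = G.σ i θ z :=
  ((G.σ_eq_iff i i z hz z hz θ (θ + n)).2 ⟨rfl, rfl, n, rfl⟩).symm

theorem isCompact_closedSolid (i : Fin G.b) {r : ℝ} (hr : r < 2) :
    IsCompact (G.closedSolid i r) := by
  have h : G.closedSolid i r = uncurry (G.σ i) '' (Icc 0 1 ×ˢ Metric.closedBall 0 r) := by
    refine Subset.antisymm ?_ (image_mono (prod_mono_left (subset_univ _)))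
    rintro _ ⟨⟨θ, z⟩, ⟨-, hz⟩, rfl⟩
    refine ⟨(Int.fract θ, z), ⟨⟨Int.fract_nonneg θ, (Int.fract_lt_one θ).le⟩, hz⟩, ?_⟩
    have := G.σ_add_int i (Int.fract θ) (closedBall_subset hr hz) ⌊θ⌋
    rw [Int.fract_add_floor] at this
    exact this.symm
  rw [h]
  refine (isCompact_Icc.prod (isCompact_closedBall 0 r)).image_of_continuousOn ?_
  exact (G.σ_smooth i).continuousOn.mono (prod_mono (subset_univ _) (closedBall_subset hr))

theorem isClosed_closedSolid [T2Space M] (i : Fin G.b) {r : ℝ} (hr : r < 2) :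
    IsClosed (G.closedSolid i r) :=
  (G.isCompact_closedSolid i hr).isClosed

theorem isOpen_openSolid [IsManifold (𝓡 3) ∞ M] [T2Space M] (i : Fin G.b) {r : ℝ} (hr : r ≤ 2) :
    IsOpen (G.openSolid i r) := by
  rw [isOpen_iff_mem_nhds]
  rintro _ ⟨⟨θ, z⟩, hz, rfl⟩
  have hz2 := ball_subset hr hz.2
  exact map_nhds_param finrank_prod_complex (G.eventually_contMDiffAt_σ i (q := (θ, z)) hz2)
    (G.surjective_dσ i θ hz2) ((isOpen_univ.prod Metric.isOpen_ball).mem_nhds hz)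

theorem mem_openSolid {i : Fin G.b} {r : ℝ} {x : M} :
    x ∈ G.openSolid i r ↔ ∃ θ, ∃ z ∈ Metric.ball (0 : ℂ) r, G.σ i θ z = x := by
  constructor
  · rintro ⟨⟨θ, z⟩, ⟨-, hz⟩, rfl⟩; exact ⟨θ, z, hz, rfl⟩
  · rintro ⟨θ, z, hz, rfl⟩; exact ⟨(θ, z), ⟨mem_univ _, hz⟩, rfl⟩

theorem mem_closedSolid {i : Fin G.b} {r : ℝ} {x : M} :
    x ∈ G.closedSolid i r ↔ ∃ θ, ∃ z ∈ Metric.closedBall (0 : ℂ) r, G.σ i θ z = x := by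
  constructor
  · rintro ⟨⟨θ, z⟩, ⟨-, hz⟩, rfl⟩; exact ⟨θ, z, hz, rfl⟩
  · rintro ⟨θ, z, hz, rfl⟩; exact ⟨(θ, z), ⟨mem_univ _, hz⟩, rfl⟩

theorem σ_mem_openSolid_iff {i j : Fin G.b} {r θ : ℝ} {z : ℂ} (hz : z ∈ Metric.ball (0 : ℂ) 2)
    (hr : r ≤ 2) : G.σ i θ z ∈ G.openSolid j r ↔ i = j ∧ z ∈ Metric.ball (0 : ℂ) r := by
  rw [mem_openSolid]
  constructor
  · rintro ⟨θ', z', hz', h⟩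
    obtain ⟨rfl, rfl, -⟩ := (G.σ_eq_iff j i z' (ball_subset hr hz') z hz θ' θ).1 h
    exact ⟨rfl, hz'⟩
  · rintro ⟨rfl, h⟩
    exact ⟨θ, z, h, rfl⟩

/-- Polar coordinates on the collar: outside the open solid torus of radius `1`, the point
`σ i (θ, z)` lies in the mapping torus. -/
theorem exists_κ_of_one_le {z : ℂ} (h1 : 1 ≤ ‖z‖) (hz : z ∈ Metric.ball (0 : ℂ) 2) (i : Fin G.b)
    (θ : ℝ) : ∃ φ : ℝ, G.σ i θ z = G.Φ φ (G.κ i ‖z‖ θ) ∧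
      z.re = ‖z‖ * Real.cos (2 * Real.pi * φ) ∧ z.im = ‖z‖ * Real.sin (2 * Real.pi * φ) := by
  refine ⟨z.arg / (2 * Real.pi), ?_, ?_, ?_⟩
  · rw [← G.glue i ‖z‖ ⟨h1, by simpa using hz⟩ θ, norm_mul_exp_arg_div]
  · rw [two_pi_mul_arg_div, Complex.norm_mul_cos_arg]
  · rw [two_pi_mul_arg_div, Complex.norm_mul_sin_arg]

theorem mem_openSolid_or_exists_Φ (x : M) : (∃ i, x ∈ G.openSolid i 1) ∨ ∃ t p, G.Φ t p = x := by
  rcases G.cover x with h | ⟨i, θ, z, hz, rfl⟩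
  · exact Or.inr h
  · exact Or.inl ⟨i, G.mem_openSolid.2 ⟨θ, z, hz, rfl⟩⟩

/-! The mapping torus near interior points of the page. -/

variable [IsManifold (𝓡∂ 2) ∞ P]

theorem contMDiff_Φ_right (t : ℝ) : ContMDiff (𝓡∂ 2) (𝓡 3) ∞ (G.Φ t) :=
  G.Φ_smooth.comp (contMDiff_const.prodMk contMDiff_id)

theorem contMDiff_Φ_left (p : P) : ContMDiff 𝓘(ℝ, ℝ) (𝓡 3) ∞ (fun t => G.Φ t p) :=
  G.Φ_smooth.comp (contMDiff_id.prodMk contMDiff_const)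

theorem continuous_Φ : Continuous (uncurry G.Φ) := G.Φ_smooth.continuous

/-- The mapping torus in the chart of the page at `p`. -/
def ΦChart (p : P) (q : ℝ × EuclideanSpace ℝ (Fin 2)) : M :=
  G.Φ q.1 ((extChartAt (𝓡∂ 2) p).symm q.2)

theorem ΦChart_self (t : ℝ) (p : P) : G.ΦChart p (t, extChartAt (𝓡∂ 2) p p) = G.Φ t p := by
  rw [ΦChart, extChartAt_to_inv]

theorem target_mem_nhds {p : P} (hp : p ∉ (𝓡∂ 2).boundary P) :
    (extChartAt (𝓡∂ 2) p).target ∈ 𝓝 (extChartAt (𝓡∂ 2) p p) := by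
  have h1 : (𝓡∂ 2).IsInteriorPoint p := by
    rw [← ModelWithCorners.compl_interior, mem_compl_iff, not_not] at hp
    exact hp
  have h2 : range (𝓡∂ 2) ∈ 𝓝 (extChartAt (𝓡∂ 2) p p) := mem_interior_iff_mem_nhds.1 h1
  have h3 := extChartAt_target_mem_nhdsWithin (I := 𝓡∂ 2) p
  rwa [nhdsWithin_eq_nhds.2 h2] at h3

theorem contMDiffAt_ΦChart (p : P) {q : ℝ × EuclideanSpace ℝ (Fin 2)}
    (hq : (extChartAt (𝓡∂ 2) p).target ∈ 𝓝 q.2) :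
    ContMDiffAt 𝓘(ℝ, ℝ × EuclideanSpace ℝ (Fin 2)) (𝓡 3) ∞ (G.ΦChart p) q := by
  have h1 : ContMDiffAt 𝓘(ℝ, EuclideanSpace ℝ (Fin 2)) (𝓡∂ 2) ∞ (extChartAt (𝓡∂ 2) p).symm q.2 :=
    (contMDiffOn_extChartAt_symm p).contMDiffAt hq
  have h2 : ContMDiffAt 𝓘(ℝ, ℝ × EuclideanSpace ℝ (Fin 2)) (𝓘(ℝ, ℝ).prod (𝓡∂ 2)) ∞
      (fun q : ℝ × EuclideanSpace ℝ (Fin 2) => (q.1, (extChartAt (𝓡∂ 2) p).symm q.2)) q :=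
    contDiff_fst.contMDiff.contMDiffAt.prodMk (h1.comp q contDiff_snd.contMDiff.contMDiffAt)
  exact (G.Φ_smooth _).comp q h2

theorem eventually_contMDiffAt_ΦChart {p : P} (hp : p ∉ (𝓡∂ 2).boundary P) (t : ℝ) :
    ∀ᶠ q in 𝓝 (t, extChartAt (𝓡∂ 2) p p),
      ContMDiffAt 𝓘(ℝ, ℝ × EuclideanSpace ℝ (Fin 2)) (𝓡 3) ∞ (G.ΦChart p) q := by
  have h : ∀ᶠ q : ℝ × EuclideanSpace ℝ (Fin 2) in 𝓝 (t, extChartAt (𝓡∂ 2) p p),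
      (extChartAt (𝓡∂ 2) p).target ∈ 𝓝 q.2 :=
    (continuous_snd.tendsto (t, extChartAt (𝓡∂ 2) p p)).eventually
      (eventually_mem_nhds_iff.2 (target_mem_nhds hp))
  filter_upwards [h] with q hq
  exact G.contMDiffAt_ΦChart p hq

theorem exists_area_pos (A : AbstractOpenBook P) (p : P) :
    ∃ v w : TangentSpace (𝓡∂ 2) p, 0 < A.area p ![v, w] := by
  by_contra! h
  refine A.area_ne_zero p (ContinuousAlternatingMap.ext fun v => ?_)
  have h1 := h (v 0) (v 1)
  have h2 := h (v 1) (v 0)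
  have h3 : A.area p ![v 1, v 0] = -A.area p ![v 0, v 1] := by
    have := (A.area p).toAlternatingMap.map_swap ![v 0, v 1] (i := 0) (j := 1) (by simp)
    refine Eq.trans ?_ this
    refine congrArg (A.area p) ?_
    ext i; fin_cases i <;> rfl
  have h4 : v = ![v 0, v 1] := by ext i; fin_cases i <;> rfl
  rw [h4]
  change _ = (0 : ℝ)
  linarith

/-- The derivative of `ΦChart` in terms of the partial derivatives of `Φ`. -/
theorem mfderiv_ΦChart {p : P} (hp : p ∉ (𝓡∂ 2).boundary P) (t : ℝ) :
    (∀ a : ℝ, (mfderiv 𝓘(ℝ, ℝ × EuclideanSpace ℝ (Fin 2)) (𝓡 3) (G.ΦChart p)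
        (t, extChartAt (𝓡∂ 2) p p) (a, 0) : E3) =
      mfderiv 𝓘(ℝ, ℝ) (𝓡 3) (fun s => G.Φ s p) t a) ∧
    ∀ v : TangentSpace (𝓡∂ 2) p, ((mfderiv 𝓘(ℝ, ℝ × EuclideanSpace ℝ (Fin 2)) (𝓡 3) (G.ΦChart p)
        (t, extChartAt (𝓡∂ 2) p p) (0, mfderiv (𝓡∂ 2) 𝓘(ℝ, EuclideanSpace ℝ (Fin 2))
          (extChartAt (𝓡∂ 2) p) p v)) : E3) =
      mfderiv (𝓡∂ 2) (𝓡 3) (G.Φ t) p v := by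
  have h1 := ((G.eventually_contMDiffAt_ΦChart hp t).self_of_nhds.mdifferentiableAt
    (by simp)).hasMFDerivAt
  constructor
  · intro a
    have h0 : HasFDerivAt (fun s : ℝ => (s, extChartAt (𝓡∂ 2) p p))
      (ContinuousLinearMap.inl ℝ ℝ (EuclideanSpace ℝ (Fin 2))) t := hasFDerivAt_prodMk_left t _
    have h2 := HasMFDerivAt.comp t (f := fun s : ℝ => (s, extChartAt (𝓡∂ 2) p p)) h1 h0.hasMFDerivAt
    have h3 : G.ΦChart p ∘ (fun s : ℝ => (s, extChartAt (𝓡∂ 2) p p)) = fun s => G.Φ s p := by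
      ext s; exact G.ΦChart_self s p
    rw [h3] at h2
    exact (congrArg (fun L : ℝ →L[ℝ] E3 => L a) h2.mfderiv).symm
  · intro v
    have h0 : HasFDerivAt (fun y : EuclideanSpace ℝ (Fin 2) => (t, y))
      (ContinuousLinearMap.inr ℝ ℝ (EuclideanSpace ℝ (Fin 2))) (extChartAt (𝓡∂ 2) p p) :=
      hasFDerivAt_prodMk_right t _
    have h2 := HasMFDerivAt.comp (extChartAt (𝓡∂ 2) p p)
      (f := fun y : EuclideanSpace ℝ (Fin 2) => (t, y)) h1 h0.hasMFDerivAt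
    have hp1 : IsManifold (𝓡∂ 2) 1 P := .of_le (n := ∞) (by simp)
    have h3 := (mdifferentiableAt_extChartAt (I := 𝓡∂ 2) (mem_chart_source _ p)).hasMFDerivAt
    have h4 := HasMFDerivAt.comp p h2 h3
    have h5 : (G.ΦChart p ∘ fun y : EuclideanSpace ℝ (Fin 2) => (t, y)) ∘ extChartAt (𝓡∂ 2) p
        =ᶠ[𝓝 p] G.Φ t := by
      filter_upwards [extChartAt_source_mem_nhds (I := 𝓡∂ 2) p] with q hq
      simp only [comp, ΦChart]
      rw [(extChartAt (𝓡∂ 2) p).left_inv hq]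
    have h6 := (h4.congr_of_eventuallyEq h5.symm).mfderiv
    exact (congrArg (fun L : EuclideanSpace ℝ (Fin 2) →L[ℝ] E3 => L v) h6).symm

theorem surjective_mfderiv_ΦChart {p : P} (hp : p ∉ (𝓡∂ 2).boundary P) (t : ℝ) :
    Surjective (mfderiv 𝓘(ℝ, ℝ × EuclideanSpace ℝ (Fin 2)) (𝓡 3) (G.ΦChart p)
      (t, extChartAt (𝓡∂ 2) p p)) := by
  obtain ⟨v, w, h⟩ := exists_area_pos A p
  have h1 := (G.Φ_oriented t p v w h).ne'
  obtain ⟨h2, h3⟩ := G.mfderiv_ΦChart hp t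
  let L : ℝ × EuclideanSpace ℝ (Fin 2) →L[ℝ] E3 :=
    mfderiv 𝓘(ℝ, ℝ × EuclideanSpace ℝ (Fin 2)) (𝓡 3) (G.ΦChart p) (t, extChartAt (𝓡∂ 2) p p)
  let u' : ℝ × EuclideanSpace ℝ (Fin 2) := ((1 : ℝ), 0)
  let T (v : TangentSpace (𝓡∂ 2) p) : ℝ × EuclideanSpace ℝ (Fin 2) :=
    (0, mfderiv (𝓡∂ 2) 𝓘(ℝ, EuclideanSpace ℝ (Fin 2)) (extChartAt (𝓡∂ 2) p) p v)
  refine surjective_of_form_ne_zero L.toLinearMap (G.vol (G.Φ t p))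
    (u := u') (v := T v) (w := T w) ?_
  have h4 : ![L.toLinearMap u', L.toLinearMap (T v), L.toLinearMap (T w)] =
      (![mfderiv 𝓘(ℝ, ℝ) (𝓡 3) (fun s => G.Φ s p) t (1 : ℝ),
      mfderiv (𝓡∂ 2) (𝓡 3) (G.Φ t) p v, mfderiv (𝓡∂ 2) (𝓡 3) (G.Φ t) p w] : Fin 3 → E3) := by
    ext1 i
    fin_cases i
    exacts [h2 1, h3 v, h3 w]
  exact fun h => h1 ((congrArg (G.vol (G.Φ t p)) h4).symm.trans h)

theorem not_mem_boundary {t : ℝ} {p : P} {x : M} (hx : G.Φ t p = x)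
    (h : ∀ i, x ∉ G.closedSolid i 1) : p ∉ (𝓡∂ 2).boundary P := by
  intro hp
  obtain ⟨i, θ, rfl⟩ := (G.κ_boundary p).1 hp
  refine h i (G.mem_closedSolid.2 ⟨θ, _, ?_, (G.glue i 1 ⟨le_rfl, by norm_num⟩ θ t).trans hx⟩)
  simp [Complex.norm_exp]

end Gluing

end Pieces

/-! ### The global functions of the construction -/

section Functions

variable {P : Type*} [TopologicalSpace P] [ChartedSpace (EuclideanHalfSpace 2) P]
  {A : AbstractOpenBook P} {M : Type*} [TopologicalSpace M] [ChartedSpace E3 M]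
  (G : Gluing A M)

namespace Gluing

open Classical in
/-- The complex function `w(|z|²) e^{2πiθ}` on the `i`-th solid torus `|z| < 2`, extended by `0`. -/
def solidFun (w : ℝ → ℝ) (i : Fin G.b) (x : M) : ℂ :=
  if h : x ∈ G.openSolid i 2 then
    let q := h.choose
    ⟨w (Complex.normSq q.2) * Real.cos (2 * Real.pi * q.1),
      w (Complex.normSq q.2) * Real.sin (2 * Real.pi * q.1)⟩
  else 0

theorem solidFun_σ (w : ℝ → ℝ) (i : Fin G.b) (θ : ℝ) {z : ℂ} (hz : z ∈ Metric.ball (0 : ℂ) 2) :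
    G.solidFun w i (G.σ i θ z) = ⟨w (Complex.normSq z) * Real.cos (2 * Real.pi * θ),
      w (Complex.normSq z) * Real.sin (2 * Real.pi * θ)⟩ := by
  have h : G.σ i θ z ∈ G.openSolid i 2 := G.mem_openSolid.2 ⟨θ, z, hz, rfl⟩
  have h1 := h.choose_spec
  rw [solidFun, dif_pos h]
  set q := h.choose
  obtain ⟨-, h2, n, h3⟩ := (G.σ_eq_iff i i q.2 h1.1.2 z hz q.1 θ).1 h1.2
  have h4 : 2 * Real.pi * (q.1 + n) = 2 * Real.pi * q.1 + n * (2 * Real.pi) := by ring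
  simp only [h2, h3, h4, Real.cos_add_int_mul_two_pi, Real.sin_add_int_mul_two_pi]

theorem solidFun_eq_zero (w : ℝ → ℝ) (i : Fin G.b) {x : M} (hx : x ∉ G.openSolid i 2) :
    G.solidFun w i x = 0 := by
  rw [solidFun, dif_neg hx]

/-- If `w` vanishes on `[r², 4)`, the support of the function is in the closed solid torus of
radius `r`. -/
theorem solidFun_eq_zero_of_notMem {w : ℝ → ℝ} {r : ℝ} (hr : 0 ≤ r)
    (hw : ∀ s, r ^ 2 ≤ s → w s = 0) (i : Fin G.b) {x : M} (hx : x ∉ G.closedSolid i r) :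
    G.solidFun w i x = 0 := by
  by_cases h : x ∈ G.openSolid i 2
  · obtain ⟨θ, z, hz, rfl⟩ := G.mem_openSolid.1 h
    have h1 : r < ‖z‖ := by
      by_contra! h2
      exact hx (G.mem_closedSolid.2 ⟨θ, z, by simpa using h2, rfl⟩)
    have h2 : w (Complex.normSq z) = 0 := by
      refine hw _ ?_
      rw [← Complex.sq_norm]
      exact pow_le_pow_left₀ hr h1.le 2
    rw [G.solidFun_σ w i θ hz, h2]
    simp
    rfl
  · exact G.solidFun_eq_zero w i h

theorem hasFDerivAt_normSq (q : ℝ × ℂ) :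
    HasFDerivAt (fun q : ℝ × ℂ => Complex.normSq q.2)
      ((2 * q.2.re) • (Complex.reCLM.comp (ContinuousLinearMap.snd ℝ ℝ ℂ)) +
        (2 * q.2.im) • (Complex.imCLM.comp (ContinuousLinearMap.snd ℝ ℝ ℂ))) q := by
  have h1 : HasFDerivAt (fun q : ℝ × ℂ => q.2.re)
    (Complex.reCLM.comp (ContinuousLinearMap.snd ℝ ℝ ℂ)) q :=
    (Complex.reCLM.comp (ContinuousLinearMap.snd ℝ ℝ ℂ)).hasFDerivAt
  have h2 : HasFDerivAt (fun q : ℝ × ℂ => q.2.im)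
    (Complex.imCLM.comp (ContinuousLinearMap.snd ℝ ℝ ℂ)) q :=
    (Complex.imCLM.comp (ContinuousLinearMap.snd ℝ ℝ ℂ)).hasFDerivAt
  refine ((h1.mul h1).add (h2.mul h2)).congr_fderiv ?_
  ext v <;> simp
  ring

theorem contDiff_normSq : ContDiff ℝ ∞ fun q : ℝ × ℂ => Complex.normSq q.2 := by
  have h1 : ContDiff ℝ ∞ fun q : ℝ × ℂ => q.2.re :=
    (Complex.reCLM.comp (ContinuousLinearMap.snd ℝ ℝ ℂ)).contDiff
  have h2 : ContDiff ℝ ∞ fun q : ℝ × ℂ => q.2.im :=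
    (Complex.imCLM.comp (ContinuousLinearMap.snd ℝ ℝ ℂ)).contDiff
  exact (h1.mul h1).add (h2.mul h2)

theorem contDiff_complex_mk {V : Type*} [NormedAddCommGroup V] [NormedSpace ℝ V] {X Y : V → ℝ}
    (hX : ContDiff ℝ ∞ X) (hY : ContDiff ℝ ∞ Y) : ContDiff ℝ ∞ fun v => (⟨X v, Y v⟩ : ℂ) :=
  Complex.equivRealProdCLM.symm.contDiff.comp (hX.prodMk hY)

theorem hasFDerivAt_comp_normSq {w : ℝ → ℝ} (hw : ContDiff ℝ ∞ w) (q : ℝ × ℂ) :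
    ∃ W' : ℝ × ℂ →L[ℝ] ℝ, HasFDerivAt (fun q : ℝ × ℂ => w (Complex.normSq q.2)) W' q ∧
      ∀ v, W' v = deriv w (Complex.normSq q.2) * (2 * (q.2.re * v.2.re + q.2.im * v.2.im)) := by
  have h1 : HasDerivAt w (deriv w (Complex.normSq q.2)) (Complex.normSq q.2) :=
    (hw.differentiable (by simp) _).hasDerivAt
  refine ⟨_, h1.comp_hasFDerivAt q (hasFDerivAt_normSq q), fun v => ?_⟩
  simp
  ring

theorem hasFDerivAt_solidFun {w : ℝ → ℝ} (hw : ContDiff ℝ ∞ w) (q : ℝ × ℂ) :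
    ∃ X' Y' : ℝ × ℂ →L[ℝ] ℝ,
      HasFDerivAt (fun q : ℝ × ℂ => w (Complex.normSq q.2) * Real.cos (2 * Real.pi * q.1)) X' q ∧
      HasFDerivAt (fun q : ℝ × ℂ => w (Complex.normSq q.2) * Real.sin (2 * Real.pi * q.1)) Y' q ∧
      (∀ v, X' v = deriv w (Complex.normSq q.2) * (2 * (q.2.re * v.2.re + q.2.im * v.2.im)) *
        Real.cos (2 * Real.pi * q.1) -
          w (Complex.normSq q.2) * Real.sin (2 * Real.pi * q.1) * (2 * Real.pi * v.1)) ∧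
      ∀ v, Y' v = deriv w (Complex.normSq q.2) * (2 * (q.2.re * v.2.re + q.2.im * v.2.im)) *
        Real.sin (2 * Real.pi * q.1) +
          w (Complex.normSq q.2) * Real.cos (2 * Real.pi * q.1) * (2 * Real.pi * v.1) := by
  obtain ⟨W', h1, h2⟩ := hasFDerivAt_comp_normSq hw q
  have h3 : HasFDerivAt (fun q : ℝ × ℂ => 2 * Real.pi * q.1)
      ((2 * Real.pi) • ContinuousLinearMap.fst ℝ ℝ ℂ) q :=
    (hasFDerivAt_fst (𝕜 := ℝ)).const_mul (2 * Real.pi)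
  refine ⟨_, _, h1.mul h3.cos, h1.mul h3.sin, fun v => ?_, fun v => ?_⟩ <;>
  · simp [h2]
    ring

theorem hasFDerivAt_mul_re_im {k : ℝ → ℝ} (hk : ContDiff ℝ ∞ k) (q : ℝ × ℂ) :
    ∃ X' Y' : ℝ × ℂ →L[ℝ] ℝ,
      HasFDerivAt (fun q : ℝ × ℂ => k (Complex.normSq q.2) * q.2.re) X' q ∧
      HasFDerivAt (fun q : ℝ × ℂ => k (Complex.normSq q.2) * q.2.im) Y' q ∧
      (∀ v, X' v = deriv k (Complex.normSq q.2) * (2 * (q.2.re * v.2.re + q.2.im * v.2.im)) *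
        q.2.re + k (Complex.normSq q.2) * v.2.re) ∧
      ∀ v, Y' v = deriv k (Complex.normSq q.2) * (2 * (q.2.re * v.2.re + q.2.im * v.2.im)) *
        q.2.im + k (Complex.normSq q.2) * v.2.im := by
  obtain ⟨W', h1, h2⟩ := hasFDerivAt_comp_normSq hk q
  have h3 : HasFDerivAt (fun q : ℝ × ℂ => q.2.re)
    (Complex.reCLM.comp (ContinuousLinearMap.snd ℝ ℝ ℂ)) q :=
    (Complex.reCLM.comp (ContinuousLinearMap.snd ℝ ℝ ℂ)).hasFDerivAt
  have h4 : HasFDerivAt (fun q : ℝ × ℂ => q.2.im)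
    (Complex.imCLM.comp (ContinuousLinearMap.snd ℝ ℝ ℂ)) q :=
    (Complex.imCLM.comp (ContinuousLinearMap.snd ℝ ℝ ℂ)).hasFDerivAt
  refine ⟨_, _, h1.mul h3, h1.mul h4, fun v => ?_, fun v => ?_⟩ <;>
  · simp [h2]
    ring

section Smooth

variable [IsManifold (𝓡 3) ∞ M] [T2Space M]

theorem contMDiff_solidFun {w : ℝ → ℝ} (hw : ContDiff ℝ ∞ w) {r : ℝ} (hr : 0 ≤ r) (hr2 : r < 2)
    (hw0 : ∀ s, r ^ 2 ≤ s → w s = 0) (i : Fin G.b) :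
    ContMDiff (𝓡 3) 𝓘(ℝ, ℂ) ∞ (G.solidFun w i) := by
  intro x
  by_cases hx : x ∈ G.openSolid i 2
  · obtain ⟨θ, z, hz, rfl⟩ := G.mem_openSolid.1 hx
    refine contMDiffAt_of_param finrank_prod_complex
      (G.eventually_contMDiffAt_σ i (q := (θ, z)) hz) (G.surjective_dσ i θ hz) ?_
    have h1 : ContDiff ℝ ∞ fun q : ℝ × ℂ => (⟨w (Complex.normSq q.2) * Real.cos (2 * Real.pi * q.1),
        w (Complex.normSq q.2) * Real.sin (2 * Real.pi * q.1)⟩ : ℂ) := by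
      have h2 := hw.comp contDiff_normSq
      have h3 : ContDiff ℝ ∞ fun q : ℝ × ℂ => 2 * Real.pi * q.1 := contDiff_const.mul contDiff_fst
      exact contDiff_complex_mk (h2.mul (Real.contDiff_cos.comp h3))
        (h2.mul (Real.contDiff_sin.comp h3))
    refine h1.contDiffAt.congr_of_eventuallyEq ?_
    filter_upwards [eventually_mem_ball (q := (θ, z)) hz] with q hq
    exact G.solidFun_σ w i q.1 hq
  · have h1 : x ∉ G.closedSolid i r := fun h => by
      obtain ⟨θ, z, hz, rfl⟩ := G.mem_closedSolid.1 h
      exact hx (G.mem_openSolid.2 ⟨θ, z, closedBall_subset hr2 hz, rfl⟩)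
    refine (contMDiffAt_const (c := (0 : ℂ))).congr_of_eventuallyEq ?_
    filter_upwards [(G.isClosed_closedSolid i hr2).isOpen_compl.mem_nhds h1] with y hy
    exact G.solidFun_eq_zero_of_notMem hr hw0 i hy

/-- In the coordinates of the solid torus, the angular form of `w(|z|²) e^{2πiθ}` is
`2π w² dθ`. -/
theorem angularForm_solidFun {w : ℝ → ℝ} (hw : ContDiff ℝ ∞ w) (i : Fin G.b)
    (hW : ContMDiff (𝓡 3) 𝓘(ℝ, ℂ) ∞ (G.solidFun w i)) (θ : ℝ) {z : ℂ}
    (hz : z ∈ Metric.ball (0 : ℂ) 2) (v : ℝ × ℂ) :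
    angularForm (G.solidFun w i) (G.σ i θ z) ![G.dσ i θ z v] =
      2 * Real.pi * w (Complex.normSq z) ^ 2 * v.1 := by
  obtain ⟨X', Y', hX, hY, hX', hY'⟩ := hasFDerivAt_solidFun hw (θ, z)
  refine (angularForm_param hW (F := uncurry (G.σ i)) (G.mdifferentiableAt_σ i (q := (θ, z)) hz)
    (by filter_upwards [eventually_mem_ball (q := (θ, z)) hz] with q hq
        exact G.solidFun_σ w i q.1 hq) hX hY v).trans ?_
  rw [hX', hY']
  linear_combination (2 * Real.pi * w (Complex.normSq z) ^ 2 * v.1) *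
    Real.sin_sq_add_cos_sq (2 * Real.pi * θ)

theorem angularTwoForm_solidFun {w : ℝ → ℝ} (hw : ContDiff ℝ ∞ w) (i : Fin G.b)
    (hW : ContMDiff (𝓡 3) 𝓘(ℝ, ℂ) ∞ (G.solidFun w i)) (θ : ℝ) {z : ℂ}
    (hz : z ∈ Metric.ball (0 : ℂ) 2) (v v' : ℝ × ℂ) :
    angularTwoForm (G.solidFun w i) (G.σ i θ z) ![G.dσ i θ z v, G.dσ i θ z v'] =
      8 * Real.pi * (w (Complex.normSq z) * deriv w (Complex.normSq z)) *
        ((z.re * v.2.re + z.im * v.2.im) * v'.1 - (z.re * v'.2.re + z.im * v'.2.im) * v.1) := by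
  obtain ⟨X', Y', hX, hY, hX', hY'⟩ := hasFDerivAt_solidFun hw (θ, z)
  refine (angularTwoForm_param hW (F := uncurry (G.σ i)) (G.mdifferentiableAt_σ i (q := (θ, z)) hz)
    (by filter_upwards [eventually_mem_ball (q := (θ, z)) hz] with q hq
        exact G.solidFun_σ w i q.1 hq) hX hY v v').trans ?_
  rw [hX', hY', hX', hY']
  linear_combination (8 * Real.pi * (w (Complex.normSq z) * deriv w (Complex.normSq z)) *
        ((z.re * v.2.re + z.im * v.2.im) * v'.1 - (z.re * v'.2.re + z.im * v'.2.im) * v.1)) *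
    Real.sin_sq_add_cos_sq (2 * Real.pi * θ)

theorem angularForm_eq_zero {Z : M → ℂ} {x : M} (h : Z x = 0) (v : TangentSpace (𝓡 3) x) :
    angularForm Z x ![v] = 0 := by
  rw [angularForm_apply, h]; simp

theorem angularTwoForm_eq_zero {Z : M → ℂ} {x : M} (h : Z =ᶠ[𝓝 x] 0)
    (v w : TangentSpace (𝓡 3) x) : angularTwoForm Z x ![v, w] = 0 := by
  have h1 : (fun x => (Z x).re) =ᶠ[𝓝 x] fun _ => (0 : ℝ) := by
    filter_upwards [h] with y hy; simp [hy]
  have h2 : differential (fun x => (Z x).re) x = 0 := by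
    rw [differential, h1.mfderiv_eq]
    exact mfderiv_const
  rw [angularTwoForm_apply, h2]
  change 2 * ((0 : ℝ) * _ - 0 * _) = 0
  ring

/-- Where the modulus of a function is constant, its angular form is closed. -/
theorem angularTwoForm_eq_zero_of_norm {Z : M → ℂ} (hZ : ContMDiff (𝓡 3) 𝓘(ℝ, ℂ) ∞ Z) {x : M}
    (h : ∀ᶠ y in 𝓝 x, Complex.normSq (Z y) = 1)
    (v w : TangentSpace (𝓡 3) x) : angularTwoForm Z x ![v, w] = 0 := by
  have h1 := ((contMDiff_re hZ).mdifferentiableAt (x := x) (by simp)).hasMFDerivAt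
  have h2 := ((contMDiff_im hZ).mdifferentiableAt (x := x) (by simp)).hasMFDerivAt
  have h3 := (h1.mul h1).add (h2.mul h2)
  have h4 : ((fun x => (Z x).re) * (fun x => (Z x).re) + (fun x => (Z x).im) * fun x => (Z x).im)
      =ᶠ[𝓝 x] fun _ => (1 : ℝ) := by
    filter_upwards [h] with y hy
    exact hy
  have h5 := h4.mfderiv_eq (I := 𝓡 3) (I' := 𝓘(ℝ, ℝ))
  rw [h3.mfderiv, mfderiv_const] at h5
  have h6 : ∀ v, (Z x).re * differential (fun x => (Z x).re) x v +
      (Z x).im * differential (fun x => (Z x).im) x v = 0 := fun v => by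
    have h7 := congrArg (fun L : E3 →L[ℝ] ℝ => L v) h5
    have h8 : (Z x).re * differential (fun x => (Z x).re) x v +
      (Z x).re * differential (fun x => (Z x).re) x v +
      ((Z x).im * differential (fun x => (Z x).im) x v +
      (Z x).im * differential (fun x => (Z x).im) x v) = 0 := h7
    linarith
  have h7 := h.self_of_nhds
  rw [Complex.normSq_apply] at h7
  rw [angularTwoForm_apply]
  have a := h6 v
  have b := h6 w
  generalize differential (fun x => (Z x).re) x v = r1 at *
  generalize differential (fun x => (Z x).re) x w = r2 at *
  generalize differential (fun x => (Z x).im) x v = s1 at *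
  generalize differential (fun x => (Z x).im) x w = s2 at *
  linear_combination (-2 * (r1 * s2 - r2 * s1)) * h7 + (2 * (Z x).re * s2 - 2 * (Z x).im * r2) * a +
    (2 * (Z x).im * r1 - 2 * (Z x).re * s1) * b

end Smooth

/-! The angular coordinate of the open book. -/

section Angle

variable [IsManifold (𝓡∂ 2) ∞ P] [IsManifold (𝓡 3) ∞ M] [T2Space M]

open Classical in
/-- The smooth function that is `e^{2πit}` at the points `Φ t p` of the mapping torus and
`k(|z|²) z` on the solid tori. -/
def angle (x : M) : ℂ :=
  if h : ∃ t p, G.Φ t p = x then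
    ⟨Real.cos (2 * Real.pi * h.choose), Real.sin (2 * Real.pi * h.choose)⟩
  else if h : ∃ z ∈ Metric.ball (0 : ℂ) 1, ∃ i θ, G.σ i θ z = x then
    ⟨discProfile (Complex.normSq h.choose) * h.choose.re,
      discProfile (Complex.normSq h.choose) * h.choose.im⟩
  else 0

theorem angle_Φ (t : ℝ) (p : P) :
    G.angle (G.Φ t p) = ⟨Real.cos (2 * Real.pi * t), Real.sin (2 * Real.pi * t)⟩ := by
  have h : ∃ s q, G.Φ s q = G.Φ t p := ⟨t, p, rfl⟩
  obtain ⟨q, hq⟩ := h.choose_spec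
  rw [angle, dif_pos h]
  set s := h.choose
  obtain ⟨n, h3, -⟩ := (G.Φ_eq_iff s q t p).1 hq
  have h4 : 2 * Real.pi * s = 2 * Real.pi * t + n * (2 * Real.pi) := by rw [h3]; ring
  rw [h4, Real.cos_add_int_mul_two_pi, Real.sin_add_int_mul_two_pi]

theorem angle_σ (i : Fin G.b) (θ : ℝ) {z : ℂ} (hz : z ∈ Metric.ball (0 : ℂ) 2) :
    G.angle (G.σ i θ z) = ⟨discProfile (Complex.normSq z) * z.re,
      discProfile (Complex.normSq z) * z.im⟩ := by
  rcases lt_or_ge ‖z‖ 1 with h1 | h1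
  · have hz1 : z ∈ Metric.ball (0 : ℂ) 1 := by simpa using h1
    have h2 : ¬ ∃ t p, G.Φ t p = G.σ i θ z := fun ⟨t, p, h⟩ => G.disjoint i θ z hz1 t p h.symm
    have h3 : ∃ z' ∈ Metric.ball (0 : ℂ) 1, ∃ j θ', G.σ j θ' z' = G.σ i θ z := ⟨z, hz1, i, θ, rfl⟩
    obtain ⟨h4, j, θ', h5⟩ := h3.choose_spec
    rw [angle, dif_neg h2, dif_pos h3]
    set z' := h3.choose
    obtain ⟨-, h6, -⟩ := (G.σ_eq_iff j i z' (ball_subset (by norm_num) h4) z hz θ' θ).1 h5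
    rw [h6]
  · obtain ⟨φ, h2, h3, h4⟩ := G.exists_κ_of_one_le h1 hz i θ
    have h5 : (1 : ℝ) / 4 ≤ Complex.normSq z := by
      rw [← Complex.sq_norm]; nlinarith
    have h6 : ‖z‖ ≠ 0 := by linarith
    rw [h2, angle_Φ, discProfile_eq_of_ge h5, ← Complex.sq_norm, Real.sqrt_sq (by linarith), h3, h4,
      inv_mul_cancel_left₀ h6, inv_mul_cancel_left₀ h6]

theorem contMDiff_angle : ContMDiff (𝓡 3) 𝓘(ℝ, ℂ) ∞ G.angle := by
  intro x
  by_cases hx : ∃ i, x ∈ G.openSolid i 2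
  · obtain ⟨i, hx⟩ := hx
    obtain ⟨θ, z, hz, rfl⟩ := G.mem_openSolid.1 hx
    refine contMDiffAt_of_param finrank_prod_complex
      (G.eventually_contMDiffAt_σ i (q := (θ, z)) hz) (G.surjective_dσ i θ hz) ?_
    have h1 : ContDiff ℝ ∞ fun q : ℝ × ℂ => (⟨discProfile (Complex.normSq q.2) * q.2.re,
        discProfile (Complex.normSq q.2) * q.2.im⟩ : ℂ) := by
      have h2 := contDiff_discProfile.comp contDiff_normSq
      exact contDiff_complex_mk
        (h2.mul (Complex.reCLM.comp (ContinuousLinearMap.snd ℝ ℝ ℂ)).contDiff)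
        (h2.mul (Complex.imCLM.comp (ContinuousLinearMap.snd ℝ ℝ ℂ)).contDiff)
    refine h1.contDiffAt.congr_of_eventuallyEq ?_
    filter_upwards [eventually_mem_ball (q := (θ, z)) hz] with q hq
    exact G.angle_σ i q.1 hq
  · push Not at hx
    have hx1 : ∀ i, x ∉ G.closedSolid i 1 := fun i h => by
      obtain ⟨θ, z, hz, rfl⟩ := G.mem_closedSolid.1 h
      exact hx i (G.mem_openSolid.2 ⟨θ, z, closedBall_subset (by norm_num) hz, rfl⟩)
    obtain ⟨t, p, rfl⟩ : ∃ t p, G.Φ t p = x := by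
      rcases G.mem_openSolid_or_exists_Φ x with ⟨i, h⟩ | h
      · obtain ⟨θ, z, hz, rfl⟩ := G.mem_openSolid.1 h
        exact absurd (G.mem_openSolid.2 ⟨θ, z, ball_subset (by norm_num) hz, rfl⟩) (hx i)
      · exact h
    have hp := G.not_mem_boundary rfl hx1
    rw [← G.ΦChart_self t p]
    refine contMDiffAt_of_param finrank_prod_plane (G.eventually_contMDiffAt_ΦChart hp t)
      (G.surjective_mfderiv_ΦChart hp t) ?_
    have h1 : G.angle ∘ G.ΦChart p = fun q : ℝ × EuclideanSpace ℝ (Fin 2) =>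
        (⟨Real.cos (2 * Real.pi * q.1), Real.sin (2 * Real.pi * q.1)⟩ : ℂ) := by
      ext1 q
      exact G.angle_Φ q.1 _
    rw [h1]
    have h3 : ContDiff ℝ ∞ fun q : ℝ × EuclideanSpace ℝ (Fin 2) => 2 * Real.pi * q.1 :=
      contDiff_const.mul contDiff_fst
    exact (contDiff_complex_mk (Real.contDiff_cos.comp h3)
      (Real.contDiff_sin.comp h3)).contDiffAt

/-- In the coordinates of the solid torus, the angular form of `k(|z|²) z` is
`k² (x dy - y dx)`. -/
theorem angularForm_angle (i : Fin G.b) (θ : ℝ) {z : ℂ}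
    (hz : z ∈ Metric.ball (0 : ℂ) 2) (v : ℝ × ℂ) :
    angularForm G.angle (G.σ i θ z) ![G.dσ i θ z v] =
      discProfile (Complex.normSq z) ^ 2 * (z.re * v.2.im - z.im * v.2.re) := by
  obtain ⟨X', Y', hX, hY, hX', hY'⟩ := hasFDerivAt_mul_re_im contDiff_discProfile (θ, z)
  refine (angularForm_param G.contMDiff_angle (F := uncurry (G.σ i))
    (G.mdifferentiableAt_σ i (q := (θ, z)) hz)
    (by filter_upwards [eventually_mem_ball (q := (θ, z)) hz] with q hq
        exact G.angle_σ i q.1 hq) hX hY v).trans ?_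
  rw [hX', hY']
  ring

theorem angularTwoForm_angle (i : Fin G.b) (θ : ℝ) {z : ℂ}
    (hz : z ∈ Metric.ball (0 : ℂ) 2) (v v' : ℝ × ℂ) :
    angularTwoForm G.angle (G.σ i θ z) ![G.dσ i θ z v, G.dσ i θ z v'] =
      discDensity (Complex.normSq z) * (v.2.re * v'.2.im - v.2.im * v'.2.re) := by
  obtain ⟨X', Y', hX, hY, hX', hY'⟩ := hasFDerivAt_mul_re_im contDiff_discProfile (θ, z)
  refine (angularTwoForm_param G.contMDiff_angle (F := uncurry (G.σ i))
    (G.mdifferentiableAt_σ i (q := (θ, z)) hz)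
    (by filter_upwards [eventually_mem_ball (q := (θ, z)) hz] with q hq
        exact G.angle_σ i q.1 hq) hX hY v v').trans ?_
  rw [hX', hY', hX', hY', discDensity, Complex.normSq_apply]
  ring

/-- The modulus of the angular function is `1` away from the solid tori of radius `1/2`. -/
theorem normSq_angle {x : M} (hx : ∀ i, x ∉ G.closedSolid i (1 / 2)) :
    Complex.normSq (G.angle x) = 1 := by
  rcases G.mem_openSolid_or_exists_Φ x with ⟨i, h⟩ | ⟨t, p, rfl⟩
  · obtain ⟨θ, z, hz, rfl⟩ := G.mem_openSolid.1 h
    have h1 : 1 / 2 < ‖z‖ := by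
      by_contra! h2
      exact hx i (G.mem_closedSolid.2 ⟨θ, z, by simpa using h2, rfl⟩)
    have h2 : 1 / 4 ≤ Complex.normSq z := by rw [← Complex.sq_norm]; nlinarith
    have h3 : Complex.normSq z ≠ 0 := by linarith
    rw [G.angle_σ i θ (ball_subset (by norm_num) hz), Complex.normSq_mk]
    have h4 : discProfile (Complex.normSq z) ^ 2 * Complex.normSq z = 1 := by
      rw [discProfile_sq, interp_of_ge h2, inv_mul_cancel₀ h3]
    rw [Complex.normSq_apply] at h4 ⊢
    linear_combination h4
  · rw [angle_Φ, Complex.normSq_mk]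
    linear_combination Real.sin_sq_add_cos_sq (2 * Real.pi * t)

theorem isOpen_compl_closedSolids {r : ℝ} (hr : r < 2) :
    IsOpen {x : M | ∀ i, x ∉ G.closedSolid i r} := by
  have : {x : M | ∀ i, x ∉ G.closedSolid i r} = ⋂ i, (G.closedSolid i r)ᶜ := by
    ext; simp
  rw [this]
  exact isOpen_iInter_of_finite fun i => (G.isClosed_closedSolid i hr).isOpen_compl

end Angle

end Gluing

end Functions

/-! ### The confoliation form and the deformation near the solid tori -/

section BaseForm

variable {P : Type*} [TopologicalSpace P] [ChartedSpace (EuclideanHalfSpace 2) P]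
  [IsManifold (𝓡∂ 2) ∞ P]
  {A : AbstractOpenBook P} {M : Type*} [TopologicalSpace M] [ChartedSpace E3 M]
  [IsManifold (𝓡 3) ∞ M] [T2Space M] (G : Gluing A M)

theorem form_two_ext {V : Type*} [AddCommGroup V] [Module ℝ V] [TopologicalSpace V]
    {β β' : V [⋀^Fin 2]→L[ℝ] ℝ} (h : ∀ v w, β ![v, w] = β' ![v, w]) : β = β' := by
  ext v
  have e : v = ![v 0, v 1] := by ext i; fin_cases i <;> rfl
  rw [e]
  exact h _ _

theorem sum_form_apply {ι : Type*} (s : Finset ι) {k : ℕ} (α : ι → DiffForm (𝓡 3) M k) (x : M)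
    (v : Fin k → TangentSpace (𝓡 3) x) : (∑ i ∈ s, α i) x v = ∑ i ∈ s, α i x v := by
  classical
  induction s using Finset.induction_on with
  | empty => simp
  | insert a s ha ih => rw [Finset.sum_insert ha, Finset.sum_insert ha, ← ih]; rfl

namespace Gluing

/-- The 1-form of the confoliation: the angular form of the open book, plus a form that makes it a
contact form on the solid tori `|z| < 1`. -/
def baseForm : DiffForm (𝓡 3) M 1 :=
  angularForm G.angle + ∑ i, angularForm (G.solidFun coreProfile i)

/-- The exterior derivative of `baseForm`. -/
def baseTwoForm : DiffForm (𝓡 3) M 2 :=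
  angularTwoForm G.angle + ∑ i, angularTwoForm (G.solidFun coreProfile i)

/-- The 1-form `2π w² dθ` on the solid tori `|z|² < 3`, where `w` is the collar profile. -/
def collarForm : DiffForm (𝓡 3) M 1 := ∑ i, angularForm (G.solidFun collarProfile i)

/-- The exterior derivative of `collarForm`. -/
def collarTwoForm : DiffForm (𝓡 3) M 2 := ∑ i, angularTwoForm (G.solidFun collarProfile i)

theorem contMDiff_coreFun (i : Fin G.b) :
    ContMDiff (𝓡 3) 𝓘(ℝ, ℂ) ∞ (G.solidFun coreProfile i) :=
  G.contMDiff_solidFun contDiff_coreProfile (r := 1) (by norm_num) (by norm_num)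
    (fun _ hs => coreProfile_of_ge (by linarith)) i

theorem contMDiff_collarFun (i : Fin G.b) :
    ContMDiff (𝓡 3) 𝓘(ℝ, ℂ) ∞ (G.solidFun collarProfile i) :=
  G.contMDiff_solidFun contDiff_collarProfile (r := 7 / 4) (by norm_num) (by norm_num)
    (fun _ hs => collarProfile_of_ge (by linarith)) i

theorem generated_baseForm : Generated G.baseForm G.baseTwoForm :=
  (generated_angularForm G.contMDiff_angle).add
    (Generated.sum _ fun i _ => generated_angularForm (G.contMDiff_coreFun i))

theorem generated_collarForm : Generated G.collarForm G.collarTwoForm :=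
  Generated.sum _ fun i _ => generated_angularForm (G.contMDiff_collarFun i)

theorem σ_notMem_openSolid {i j : Fin G.b} (hij : j ≠ i) (θ : ℝ) {z : ℂ}
    (hz : z ∈ Metric.ball (0 : ℂ) 2) : G.σ i θ z ∉ G.openSolid j 2 := fun h =>
  hij ((G.σ_mem_openSolid_iff hz le_rfl).1 h).1.symm

theorem eventually_solidFun_σ (w : ℝ → ℝ) {i j : Fin G.b} (hij : j ≠ i) (θ : ℝ) {z : ℂ}
    (hz : z ∈ Metric.ball (0 : ℂ) 2) : G.solidFun w j =ᶠ[𝓝 (G.σ i θ z)] 0 := by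
  filter_upwards [(G.isOpen_openSolid i le_rfl).mem_nhds (G.mem_openSolid.2 ⟨θ, z, hz, rfl⟩)]
    with y hy
  obtain ⟨θ', z', hz', rfl⟩ := G.mem_openSolid.1 hy
  exact G.solidFun_eq_zero w j (G.σ_notMem_openSolid hij θ' hz')

theorem sum_angularForm_σ {w : ℝ → ℝ} (hw : ContDiff ℝ ∞ w)
    (hW : ∀ i, ContMDiff (𝓡 3) 𝓘(ℝ, ℂ) ∞ (G.solidFun w i)) (i : Fin G.b) (θ : ℝ) {z : ℂ}
    (hz : z ∈ Metric.ball (0 : ℂ) 2) (v : ℝ × ℂ) :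
    (∑ j, angularForm (G.solidFun w j)) (G.σ i θ z) ![G.dσ i θ z v] =
      2 * Real.pi * w (Complex.normSq z) ^ 2 * v.1 := by
  rw [sum_form_apply, Finset.sum_eq_single i, G.angularForm_solidFun hw i (hW i) θ hz]
  · exact fun j _ hj => angularForm_eq_zero (G.eventually_solidFun_σ w hj θ hz).self_of_nhds _
  · simp

theorem sum_angularTwoForm_σ {w : ℝ → ℝ} (hw : ContDiff ℝ ∞ w)
    (hW : ∀ i, ContMDiff (𝓡 3) 𝓘(ℝ, ℂ) ∞ (G.solidFun w i)) (i : Fin G.b) (θ : ℝ) {z : ℂ}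
    (hz : z ∈ Metric.ball (0 : ℂ) 2) (v v' : ℝ × ℂ) :
    (∑ j, angularTwoForm (G.solidFun w j)) (G.σ i θ z) ![G.dσ i θ z v, G.dσ i θ z v'] =
      8 * Real.pi * (w (Complex.normSq z) * deriv w (Complex.normSq z)) *
        ((z.re * v.2.re + z.im * v.2.im) * v'.1 - (z.re * v'.2.re + z.im * v'.2.im) * v.1) := by
  rw [sum_form_apply, Finset.sum_eq_single i, G.angularTwoForm_solidFun hw i (hW i) θ hz]
  · exact fun j _ hj => angularTwoForm_eq_zero (G.eventually_solidFun_σ w hj θ hz) _ _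
  · simp

theorem baseForm_σ (i : Fin G.b) (θ : ℝ) {z : ℂ} (hz : z ∈ Metric.ball (0 : ℂ) 2) (v : ℝ × ℂ) :
    G.baseForm (G.σ i θ z) ![G.dσ i θ z v] =
      discProfile (Complex.normSq z) ^ 2 * (z.re * v.2.im - z.im * v.2.re) +
      2 * Real.pi * coreProfile (Complex.normSq z) ^ 2 * v.1 :=
  congrArg₂ (fun r s : ℝ => r + s) (G.angularForm_angle i θ hz v)
    (G.sum_angularForm_σ contDiff_coreProfile G.contMDiff_coreFun i θ hz v)

theorem baseTwoForm_σ (i : Fin G.b) (θ : ℝ) {z : ℂ} (hz : z ∈ Metric.ball (0 : ℂ) 2)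
    (v v' : ℝ × ℂ) : G.baseTwoForm (G.σ i θ z) ![G.dσ i θ z v, G.dσ i θ z v'] =
      discDensity (Complex.normSq z) * (v.2.re * v'.2.im - v.2.im * v'.2.re) +
      8 * Real.pi * (coreProfile (Complex.normSq z) * deriv coreProfile (Complex.normSq z)) *
        ((z.re * v.2.re + z.im * v.2.im) * v'.1 - (z.re * v'.2.re + z.im * v'.2.im) * v.1) :=
  congrArg₂ (fun r s : ℝ => r + s) (G.angularTwoForm_angle i θ hz v v')
    (G.sum_angularTwoForm_σ contDiff_coreProfile G.contMDiff_coreFun i θ hz v v')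

theorem collarForm_σ (i : Fin G.b) (θ : ℝ) {z : ℂ} (hz : z ∈ Metric.ball (0 : ℂ) 2) (v : ℝ × ℂ) :
    G.collarForm (G.σ i θ z) ![G.dσ i θ z v] =
      2 * Real.pi * collarProfile (Complex.normSq z) ^ 2 * v.1 :=
  G.sum_angularForm_σ contDiff_collarProfile G.contMDiff_collarFun i θ hz v

theorem collarTwoForm_σ (i : Fin G.b) (θ : ℝ) {z : ℂ} (hz : z ∈ Metric.ball (0 : ℂ) 2)
    (v v' : ℝ × ℂ) : G.collarTwoForm (G.σ i θ z) ![G.dσ i θ z v, G.dσ i θ z v'] =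
      8 * Real.pi * (collarProfile (Complex.normSq z) * deriv collarProfile (Complex.normSq z)) *
        ((z.re * v.2.re + z.im * v.2.im) * v'.1 - (z.re * v'.2.re + z.im * v'.2.im) * v.1) :=
  G.sum_angularTwoForm_σ contDiff_collarProfile G.contMDiff_collarFun i θ hz v v'

/-! Away from the solid tori `|z| < 1` the base form is the closed form `2π dt`. -/

theorem Φ_eq_σ_or (t : ℝ) (p : P) : (∃ i θ, ∃ z ∈ Metric.ball (0 : ℂ) 2, 1 ≤ Complex.normSq z ∧
    G.Φ t p = G.σ i θ z) ∨ ∀ i, G.Φ t p ∉ G.openSolid i 2 := by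
  by_cases h : ∃ i, G.Φ t p ∈ G.openSolid i 2
  · obtain ⟨i, h⟩ := h
    obtain ⟨θ, z, hz, hx⟩ := G.mem_openSolid.1 h
    refine Or.inl ⟨i, θ, z, hz, ?_, hx.symm⟩
    by_contra! h1
    refine G.disjoint i θ z ?_ t p hx
    rw [← Complex.sq_norm] at h1
    have h2 : ‖z‖ < 1 := by nlinarith [norm_nonneg z]
    simpa using h2
  · exact Or.inr (not_exists.1 h)

theorem coreFun_Φ (i : Fin G.b) (t : ℝ) (p : P) : G.solidFun coreProfile i (G.Φ t p) = 0 := by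
  rcases G.Φ_eq_σ_or t p with ⟨j, θ, z, hz, h1, h⟩ | h
  · rw [h]
    by_cases hij : i = j
    · subst hij
      rw [G.solidFun_σ _ i θ hz, coreProfile_of_ge h1]
      simp
      rfl
    · exact G.solidFun_eq_zero _ i (G.σ_notMem_openSolid hij θ hz)
  · exact G.solidFun_eq_zero _ i (h i)

theorem baseForm_Φ_apply (t : ℝ) (p : P) (v : TangentSpace (𝓡 3) (G.Φ t p)) :
    G.baseForm (G.Φ t p) ![v] =
      Real.cos (2 * Real.pi * t) * differential (fun x => (G.angle x).im) (G.Φ t p) v -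
      Real.sin (2 * Real.pi * t) * differential (fun x => (G.angle x).re) (G.Φ t p) v := by
  have h1 : (∑ i, angularForm (G.solidFun coreProfile i)) (G.Φ t p) ![v] = 0 := by
    rw [sum_form_apply]
    exact Finset.sum_eq_zero fun i _ => angularForm_eq_zero (G.coreFun_Φ i t p) v
  have h2 := angularForm_apply G.angle (G.Φ t p) v
  rw [G.angle_Φ] at h2
  exact (congrArg₂ (fun r s : ℝ => r + s) h2 h1).trans (add_zero _)

theorem differential_Φ_right {b : M → ℝ} (hb : ContMDiff (𝓡 3) 𝓘(ℝ, ℝ) ∞ b) (t : ℝ) {c : ℝ}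
    (hc : ∀ p, b (G.Φ t p) = c) (p : P) (v : TangentSpace (𝓡∂ 2) p) :
    differential b (G.Φ t p) (mfderiv (𝓡∂ 2) (𝓡 3) (G.Φ t) p v) = 0 := by
  have h1 := mfderiv_comp p (hb.mdifferentiableAt (by simp))
    ((G.contMDiff_Φ_right t).mdifferentiableAt (x := p) (by simp))
  have h2 : b ∘ G.Φ t = fun _ => c := funext hc
  rw [h2, mfderiv_const] at h1
  exact (congrArg (fun L : TangentSpace (𝓡∂ 2) p →L[ℝ] ℝ => L v) h1).symm

theorem baseForm_Φ_right (t : ℝ) (p : P) (v : TangentSpace (𝓡∂ 2) p) :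
    G.baseForm (G.Φ t p) ![mfderiv (𝓡∂ 2) (𝓡 3) (G.Φ t) p v] = 0 := by
  rw [baseForm_Φ_apply,
    G.differential_Φ_right (contMDiff_im G.contMDiff_angle) t (fun p => by rw [angle_Φ]),
    G.differential_Φ_right (contMDiff_re G.contMDiff_angle) t (fun p => by rw [angle_Φ])]
  simp

theorem baseForm_Φ_left (t : ℝ) (p : P) :
    G.baseForm (G.Φ t p) ![mfderiv 𝓘(ℝ, ℝ) (𝓡 3) (fun s => G.Φ s p) t (1 : ℝ)] =
      2 * Real.pi := by
  rw [baseForm_Φ_apply]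
  have hF : MDifferentiableAt 𝓘(ℝ, ℝ) (𝓡 3) (fun s => G.Φ s p) t :=
    (G.contMDiff_Φ_left p).mdifferentiableAt (by simp)
  have h1 := differential_comp (contMDiff_im G.contMDiff_angle) hF (1 : ℝ)
  have h2 := differential_comp (contMDiff_re G.contMDiff_angle) hF (1 : ℝ)
  have h3 : (fun x => (G.angle x).im) ∘ (fun s => G.Φ s p) = fun s => Real.sin (2 * Real.pi * s) :=
    funext fun s => by simp [angle_Φ]
  have h4 : (fun x => (G.angle x).re) ∘ (fun s => G.Φ s p) = fun s => Real.cos (2 * Real.pi * s) :=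
    funext fun s => by simp [angle_Φ]
  have h5 : HasDerivAt (fun s : ℝ => 2 * Real.pi * s) (2 * Real.pi) t := by
    simpa using (hasDerivAt_id t).const_mul (2 * Real.pi)
  rw [h3, fderiv_apply_one_eq_deriv, h5.sin.deriv] at h1
  rw [h4, fderiv_apply_one_eq_deriv, h5.cos.deriv] at h2
  refine (congrArg₂ (fun r s : ℝ => Real.cos (2 * Real.pi * t) * r - Real.sin (2 * Real.pi * t) * s)
    h1 h2).trans ?_
  linear_combination (2 * Real.pi) * Real.sin_sq_add_cos_sq (2 * Real.pi * t)

theorem form_two_eq_zero_of_dσ (β : DiffForm (𝓡 3) M 2) (i : Fin G.b) (θ : ℝ) {z : ℂ}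
    (hz : z ∈ Metric.ball (0 : ℂ) 2)
    (h : ∀ v w, β (G.σ i θ z) ![G.dσ i θ z v, G.dσ i θ z w] = 0) : β (G.σ i θ z) = 0 := by
  refine form_two_ext fun v w => ?_
  obtain ⟨v, rfl⟩ := G.surjective_dσ i θ hz v
  obtain ⟨w, rfl⟩ := G.surjective_dσ i θ hz w
  exact h v w

theorem sum_angularTwoForm_eq_zero {w : ℝ → ℝ} {r : ℝ} (hr : 0 ≤ r) (hr2 : r < 2)
    (hw0 : ∀ s, r ^ 2 ≤ s → w s = 0) {x : M} (hx : ∀ i, x ∉ G.closedSolid i r) :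
    (∑ i, angularTwoForm (G.solidFun w i)) x = 0 := by
  refine form_two_ext fun v u => ?_
  rw [sum_form_apply]
  refine Finset.sum_eq_zero fun i _ => angularTwoForm_eq_zero ?_ v u
  filter_upwards [(G.isClosed_closedSolid i hr2).isOpen_compl.mem_nhds (hx i)] with y hy
  exact G.solidFun_eq_zero_of_notMem hr hw0 i hy

theorem notMem_closedSolid_of_notMem_openSolid {x : M} {i : Fin G.b} (hx : x ∉ G.openSolid i 2)
    {r : ℝ} (hr : r < 2) : x ∉ G.closedSolid i r := fun h => by
  obtain ⟨θ, z, hz, rfl⟩ := G.mem_closedSolid.1 h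
  exact hx (G.mem_openSolid.2 ⟨θ, z, closedBall_subset hr hz, rfl⟩)

theorem baseTwoForm_Φ (t : ℝ) (p : P) : G.baseTwoForm (G.Φ t p) = 0 := by
  rcases G.Φ_eq_σ_or t p with ⟨j, θ, z, hz, h1, h⟩ | h
  · rw [h]
    refine G.form_two_eq_zero_of_dσ _ j θ hz fun v w => ?_
    rw [G.baseTwoForm_σ j θ hz, coreProfile_of_ge h1, discDensity_eq_zero (by linarith)]
    simp
  · have hh : ∀ y ∈ {x : M | ∀ i, x ∉ G.closedSolid i (1 / 2)}, Complex.normSq (G.angle y) = 1 :=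
      fun y hy => G.normSq_angle hy
    have h1 : ∀ v w, angularTwoForm G.angle (G.Φ t p) ![v, w] = 0 :=
      angularTwoForm_eq_zero_of_norm G.contMDiff_angle
        (eventually_of_mem ((G.isOpen_compl_closedSolids (r := 1 / 2) (by norm_num)).mem_nhds
          fun i => G.notMem_closedSolid_of_notMem_openSolid (h i) (by norm_num)) hh)
    have h2 : (∑ i, angularTwoForm (G.solidFun coreProfile i)) (G.Φ t p) = 0 :=
      G.sum_angularTwoForm_eq_zero (r := 1) (by norm_num) (by norm_num)
        (fun _ hs => coreProfile_of_ge (by linarith))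
        fun i => G.notMem_closedSolid_of_notMem_openSolid (h i) (by norm_num)
    have h3 : angularTwoForm G.angle (G.Φ t p) = 0 := form_two_ext h1
    change angularTwoForm G.angle (G.Φ t p) +
      (∑ i, angularTwoForm (G.solidFun coreProfile i)) (G.Φ t p) = 0
    rw [h2, h3, add_zero]

theorem collarTwoForm_eq_zero {x : M} (hx : ∀ i, x ∉ G.openSolid i 2) : G.collarTwoForm x = 0 :=
  G.sum_angularTwoForm_eq_zero (r := 7 / 4) (by norm_num) (by norm_num)
    (fun _ hs => collarProfile_of_ge (by linarith))
    fun i => G.notMem_closedSolid_of_notMem_openSolid (hx i) (by norm_num)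

/-! Densities of 3-forms `baseForm ∧ η` with respect to the volume form. -/

/-- The quotient of `baseForm ∧ η` by the volume form. -/
def density (η : DiffForm (𝓡 3) M 2) (x : M) : ℝ := topRatio (topForm G.baseForm η) G.vol x

theorem wedge_eq_density (η : DiffForm (𝓡 3) M 2) (x : M) (u v w : TangentSpace (𝓡 3) x) :
    wedge G.baseForm η x u v w = G.density η x * G.vol x ![u, v, w] := by
  rw [← topForm_apply]
  exact topRatio_mul _ (G.vol_ne_zero x) _

theorem density_add (η η' : DiffForm (𝓡 3) M 2) (x : M) :
    G.density (η + η') x = G.density η x + G.density η' x := by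
  unfold density topRatio
  rw [topForm_add_right]
  exact add_div _ _ _

theorem density_smul (c : ℝ) (η : DiffForm (𝓡 3) M 2) (x : M) :
    G.density (c • η) x = c * G.density η x := by
  unfold density topRatio
  rw [topForm_smul_right]
  exact mul_div_assoc _ _ _

theorem density_congr {η η' : DiffForm (𝓡 3) M 2} {x : M} (h : η x = η' x) :
    G.density η x = G.density η' x := by
  unfold density topRatio topForm
  rw [h]

theorem density_zero (x : M) : G.density 0 x = 0 := by
  have := G.density_smul 0 0 x
  rwa [zero_smul, zero_mul] at this

theorem continuous_density {η : DiffForm (𝓡 3) M 2} (hη : η.Smooth) :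
    Continuous (G.density η) :=
  topRatio_continuous G.generated_baseForm.smooth hη G.vol_smooth G.vol_ne_zero

/-- The density of the collar form is nonnegative, and positive on the collar. -/
theorem density_collar_σ (i : Fin G.b) (θ : ℝ) {z : ℂ} (hz : z ∈ Metric.ball (0 : ℂ) 2) :
    ∃ r : ℝ, 0 < r ∧ G.density G.collarTwoForm (G.σ i θ z) * r =
      -(8 * Real.pi * (collarProfile (Complex.normSq z) * deriv collarProfile (Complex.normSq z)) *
        discProfile (Complex.normSq z) ^ 2 * Complex.normSq z) := by
  refine ⟨_, G.vol_dσ_pos i θ hz, ?_⟩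
  rw [← wedge_eq_density]
  unfold wedge
  rw [G.baseForm_σ i θ hz, G.baseForm_σ i θ hz, G.baseForm_σ i θ hz, G.collarTwoForm_σ i θ hz,
    G.collarTwoForm_σ i θ hz, G.collarTwoForm_σ i θ hz, Complex.normSq_apply]
  simp
  ring

theorem density_collar_nonneg (x : M) : 0 ≤ G.density G.collarTwoForm x := by
  by_cases h : ∃ i, x ∈ G.openSolid i 2
  · obtain ⟨i, h⟩ := h
    obtain ⟨θ, z, hz, rfl⟩ := G.mem_openSolid.1 h
    obtain ⟨r, hr, h1⟩ := G.density_collar_σ i θ hz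
    refine nonneg_of_mul_nonneg_left (h1 ▸ ?_) hr
    have h2 := deriv_collarProfile_nonpos (Complex.normSq z)
    have h3 := collarProfile_nonneg (Complex.normSq z)
    have h4 := Complex.normSq_nonneg z
    have h5 := Real.pi_pos
    rw [← mul_neg_one]
    have : 0 ≤ 8 * Real.pi * (collarProfile (Complex.normSq z) *
      -deriv collarProfile (Complex.normSq z)) * discProfile (Complex.normSq z) ^ 2 *
        Complex.normSq z := by
      have : 0 ≤ -deriv collarProfile (Complex.normSq z) := by linarith
      positivity
    linarith
  · rw [G.density_congr (η' := 0) (G.collarTwoForm_eq_zero (not_exists.1 h)), density_zero]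

theorem density_collar_pos (i : Fin G.b) (θ : ℝ) {z : ℂ} (hz : z ∈ Metric.ball (0 : ℂ) 2)
    (h1 : 1 / 2 < Complex.normSq z) (h2 : Complex.normSq z < 3) :
    0 < G.density G.collarTwoForm (G.σ i θ z) := by
  obtain ⟨r, hr, h⟩ := G.density_collar_σ i θ hz
  refine pos_of_mul_pos_left (h ▸ ?_) hr.le
  have h3 := deriv_collarProfile_neg h1 h2
  have h4 := collarProfile_pos h2
  have h5 := Real.pi_pos
  have h6 := discProfile_pos (Complex.normSq z)
  have : 0 < 8 * Real.pi * (collarProfile (Complex.normSq z) *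
      -deriv collarProfile (Complex.normSq z)) * discProfile (Complex.normSq z) ^ 2 *
        Complex.normSq z := by
    have : 0 < -deriv collarProfile (Complex.normSq z) := by linarith
    positivity
  linarith

end Gluing

end BaseForm

/-! ### Propagation of positivity along the pages -/

section Profiles

open Real

/-- A smooth bump on the line, positive exactly on `(-η, η)`. -/
def bumpProfile (η s : ℝ) : ℝ := smoothTransition (1 - (s / η) ^ 2)

theorem contDiff_bumpProfile (η : ℝ) : ContDiff ℝ ∞ (bumpProfile η) :=
  smoothTransition.contDiff.comp (contDiff_const.sub ((contDiff_id.div_const η).pow 2))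

theorem bumpProfile_nonneg (η s : ℝ) : 0 ≤ bumpProfile η s := smoothTransition.nonneg _

theorem bumpProfile_zero_pos (η : ℝ) : 0 < bumpProfile η 0 :=
  smoothTransition.pos_of_pos (by norm_num)

theorem bumpProfile_eq_zero {η s : ℝ} (hη : 0 < η) (h : η ≤ |s|) : bumpProfile η s = 0 := by
  refine smoothTransition.zero_of_nonpos ?_
  have h1 : 1 ≤ |s / η| := by
    rw [abs_div, abs_of_pos hη]
    exact (one_le_div hη).2 h
  have h2 : 1 ≤ (s / η) ^ 2 := by rw [← sq_abs]; nlinarith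
  linarith

/-- A smooth function on the line supported in `[-1/2, 1 + η]` that decreases only on
`[1 - η, 1 + η]`. -/
def transferProfile (η a : ℝ) : ℝ :=
  smoothTransition (a + 1 / 2) * smoothTransition ((1 + η - a) / (2 * η))

theorem contDiff_transferProfile (η : ℝ) : ContDiff ℝ ∞ (transferProfile η) :=
  (smoothTransition.contDiff.comp (contDiff_id.add contDiff_const)).mul
    (smoothTransition.contDiff.comp ((contDiff_const.sub contDiff_id).div_const _))

theorem transferProfile_eq_zero_left {η a : ℝ} (h : a ≤ -1 / 2) : transferProfile η a = 0 := by
  rw [transferProfile, smoothTransition.zero_of_nonpos (by linarith), zero_mul]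

theorem transferProfile_eq_zero_right {η a : ℝ} (hη : 0 < η) (h : 1 + η ≤ a) :
    transferProfile η a = 0 := by
  rw [transferProfile, smoothTransition.zero_of_nonpos (x := (1 + η - a) / (2 * η)), mul_zero]
  exact div_nonpos_of_nonpos_of_nonneg (by linarith) (by linarith)

theorem deriv_transferProfile {η a : ℝ} (hη : 0 < η) (h : a < 1 - η) :
    deriv (transferProfile η) a = deriv smoothTransition (a + 1 / 2) := by
  have h1 : transferProfile η =ᶠ[𝓝 a] fun a => smoothTransition (a + 1 / 2) := by
    filter_upwards [Iio_mem_nhds h] with s hs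
    have hs' : s < 1 - η := hs
    rw [transferProfile, smoothTransition.one_of_one_le (x := (1 + η - s) / (2 * η)), mul_one]
    rw [one_le_div (by linarith)]
    linarith
  rw [h1.deriv_eq, deriv_comp_add_const]

theorem deriv_transferProfile_nonneg {η a : ℝ} (hη : 0 < η) (h : η < |a - 1|) :
    0 ≤ deriv (transferProfile η) a := by
  rcases lt_abs.1 h with h | h
  · have h1 : transferProfile η =ᶠ[𝓝 a] fun _ => 0 := by
      filter_upwards [Ioi_mem_nhds (show 1 + η < a by linarith)] with s hs
      exact transferProfile_eq_zero_right hη (le_of_lt hs)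
    rw [h1.deriv_eq, deriv_const]
  · rw [deriv_transferProfile hη (by linarith)]
    exact deriv_smoothTransition_nonneg _

theorem deriv_transferProfile_zero_pos {η : ℝ} (hη : 0 < η) (h : η < 1) :
    0 < deriv (transferProfile η) 0 := by
  rw [deriv_transferProfile hη (by linarith)]
  exact deriv_smoothTransition_pos (by norm_num) (by norm_num)

end Profiles

section Differential

variable {M : Type*} [TopologicalSpace M] [ChartedSpace E3 M] [IsManifold (𝓡 3) ∞ M]

theorem differential_mul {f g : M → ℝ} (hf : ContMDiff (𝓡 3) 𝓘(ℝ, ℝ) ∞ f)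
    (hg : ContMDiff (𝓡 3) 𝓘(ℝ, ℝ) ∞ g) (x : M) (v : TangentSpace (𝓡 3) x) :
    differential (fun x => f x * g x) x v = f x * differential g x v + g x * differential f x v := by
  have h1 := ((hf.mdifferentiableAt (x := x) (by simp)).hasMFDerivAt).mul
    ((hg.mdifferentiableAt (x := x) (by simp)).hasMFDerivAt)
  exact congrArg (fun L : E3 →L[ℝ] ℝ => L v) h1.mfderiv

theorem differential_real_comp {φ : ℝ → ℝ} (hφ : ContDiff ℝ ∞ φ) {f : M → ℝ}
    (hf : ContMDiff (𝓡 3) 𝓘(ℝ, ℝ) ∞ f) (x : M) (v : TangentSpace (𝓡 3) x) :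
    differential (fun x => φ (f x)) x v = deriv φ (f x) * differential f x v := by
  have h0 : HasFDerivAt φ _ (f x) := (hφ.differentiable (by simp) _).hasFDerivAt
  have h1 := h0.hasMFDerivAt.comp x (hf.mdifferentiableAt (x := x) (by simp)).hasMFDerivAt
  refine (congrArg (fun L : E3 →L[ℝ] ℝ => L v) h1.mfderiv).trans ?_
  refine (fderiv_eq_smul_deriv (differential f x v)).trans ?_
  rw [smul_eq_mul, mul_comm]

theorem differential_congr {f g : M → ℝ} {x : M} (h : f =ᶠ[𝓝 x] g) :
    differential f x = differential g x := h.mfderiv_eq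

theorem twoForm_pair (g b : M → ℝ) {x : M} (v w : TangentSpace (𝓡 3) x) :
    twoForm g b x ![v, w] =
      differential g x v * differential b x w - differential g x w * differential b x v :=
  twoForm_apply g b x ![v, w]

theorem twoForm_eq_zero {g b : M → ℝ} {x : M} (h : g =ᶠ[𝓝 x] fun _ => 0) : twoForm g b x = 0 := by
  refine form_two_ext fun v w => ?_
  rw [twoForm_apply]
  have h2 : differential g x = 0 := by
    rw [differential_congr h]
    exact mfderiv_const
  rw [h2]
  change (0 : ℝ) * _ - 0 * _ = 0
  ring

/-- The real and imaginary parts of `m Y + n` have differentials that are related to those of `Y`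
by the multiplication with `m`. -/
theorem differential_affine {Y : M → ℂ} (hY : ContMDiff (𝓡 3) 𝓘(ℝ, ℂ) ∞ Y) (m n : ℂ) (x : M)
    (v : TangentSpace (𝓡 3) x) :
    differential (fun x => (m * Y x + n).re) x v =
      m.re * differential (fun x => (Y x).re) x v - m.im * differential (fun x => (Y x).im) x v ∧
    differential (fun x => (m * Y x + n).im) x v =
      m.re * differential (fun x => (Y x).im) x v + m.im * differential (fun x => (Y x).re) x v := by
  have h1 := ((contMDiff_re hY).mdifferentiableAt (x := x) (by simp)).hasMFDerivAt
  have h2 := ((contMDiff_im hY).mdifferentiableAt (x := x) (by simp)).hasMFDerivAt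
  constructor
  · have h3 := ((h1.const_smul m.re).sub (h2.const_smul m.im)).add (hasMFDerivAt_const n.re x)
    have h4 : (fun x => (m * Y x + n).re) = ((m.re • fun x => (Y x).re) - m.im • fun x => (Y x).im) +
        fun _ => n.re := by
      ext x; simp
    rw [differential, h4, h3.mfderiv]
    exact add_zero _
  · have h3 := ((h2.const_smul m.re).add (h1.const_smul m.im)).add (hasMFDerivAt_const n.im x)
    have h4 : (fun x => (m * Y x + n).im) = ((m.re • fun x => (Y x).im) + m.im • fun x => (Y x).re) +
        fun _ => n.im := by
      ext x; simp
    rw [differential, h4, h3.mfderiv]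
    exact add_zero _

end Differential

/-- A function that is nonnegative off a closed set on which `D` is positive becomes nonnegative
after adding a large multiple of `D`. -/
theorem exists_mul_add_nonneg {X : Type*} [TopologicalSpace X] [CompactSpace X] {f D : X → ℝ}
    (hf : Continuous f) (hD : Continuous D) (hD0 : ∀ x, 0 ≤ D x) {K : Set X} (hK : IsClosed K)
    (hfK : ∀ x ∉ K, 0 ≤ f x) (hDK : ∀ x ∈ K, 0 < D x) :
    ∃ c : ℝ, 0 ≤ c ∧ ∀ x, 0 ≤ c * D x + f x := by
  have h1 : ContinuousOn (fun x => -f x / D x) K :=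
    hf.neg.continuousOn.div hD.continuousOn fun x hx => (hDK x hx).ne'
  obtain ⟨c, hc⟩ := (hK.isCompact.image_of_continuousOn h1).bddAbove
  refine ⟨max c 0, le_max_right _ _, fun x => ?_⟩
  by_cases hx : x ∈ K
  · have h2 : -f x / D x ≤ max c 0 := (hc ⟨x, hx, rfl⟩).trans (le_max_left _ _)
    rw [div_le_iff₀ (hDK x hx)] at h2
    linarith
  · exact add_nonneg (mul_nonneg (le_max_right _ _) (hD0 x)) (hfK x hx)

section Propagation

variable {P : Type*} [TopologicalSpace P] [ChartedSpace (EuclideanHalfSpace 2) P]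
  [IsManifold (𝓡∂ 2) ∞ P]
  {A : AbstractOpenBook P} {M : Type*} [TopologicalSpace M] [ChartedSpace E3 M]
  [IsManifold (𝓡 3) ∞ M] [T2Space M] (G : Gluing A M)

namespace Gluing

/-- The 1-forms `C collarForm + γ`, with `γ = 0` on the solid tori `|z| < 1`, whose exterior
derivative `C collarTwoForm + δ` has a nonnegative density. -/
structure Admissible (C : ℝ) (γ : DiffForm (𝓡 3) M 1) (δ : DiffForm (𝓡 3) M 2) : Prop where
  nonneg : 0 ≤ C
  generated : Generated γ δ
  eq_zero : ∀ i, ∀ x ∈ G.openSolid i 1, γ x = 0 ∧ δ x = 0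
  density_nonneg : ∀ x, 0 ≤ G.density (C • G.collarTwoForm + δ) x

/-- The points at which some admissible form has a positive density. -/
def positiveSet : Set M :=
  {x | ∃ C γ δ, G.Admissible C γ δ ∧ 0 < G.density (C • G.collarTwoForm + δ) x}

variable {G}

theorem Admissible.continuous {C : ℝ} {γ : DiffForm (𝓡 3) M 1} {δ : DiffForm (𝓡 3) M 2}
    (h : G.Admissible C γ δ) : Continuous (G.density (C • G.collarTwoForm + δ)) :=
  G.continuous_density ((G.generated_collarForm.smul C).add h.generated).smooth_snd

theorem density_add_add (C C' : ℝ) (δ δ' : DiffForm (𝓡 3) M 2) (x : M) :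
    G.density ((C + C') • G.collarTwoForm + (δ + δ')) x =
      G.density (C • G.collarTwoForm + δ) x + G.density (C' • G.collarTwoForm + δ') x := by
  simp only [density_add, density_smul]
  ring

theorem Admissible.add {C C' : ℝ} {γ γ' : DiffForm (𝓡 3) M 1} {δ δ' : DiffForm (𝓡 3) M 2}
    (h : G.Admissible C γ δ) (h' : G.Admissible C' γ' δ') :
    G.Admissible (C + C') (γ + γ') (δ + δ') where
  nonneg := add_nonneg h.nonneg h'.nonneg
  generated := h.generated.add h'.generated
  eq_zero i x hx := by
    obtain ⟨h1, h2⟩ := h.eq_zero i x hx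
    obtain ⟨h3, h4⟩ := h'.eq_zero i x hx
    exact ⟨by rw [Pi.add_apply, h1, h3, add_zero], by rw [Pi.add_apply, h2, h4, add_zero]⟩
  density_nonneg x := by
    rw [density_add_add]
    exact add_nonneg (h.density_nonneg x) (h'.density_nonneg x)

variable (G)

theorem admissible_collar {C : ℝ} (hC : 0 ≤ C) : G.Admissible C 0 0 where
  nonneg := hC
  generated := .zero
  eq_zero _ _ _ := ⟨rfl, rfl⟩
  density_nonneg x := by
    rw [add_zero, density_smul]
    exact mul_nonneg hC (G.density_collar_nonneg x)

theorem isOpen_positiveSet : IsOpen G.positiveSet := by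
  rw [isOpen_iff_mem_nhds]
  rintro x ⟨C, γ, δ, h, hx⟩
  filter_upwards [(isOpen_Ioi.preimage h.continuous).mem_nhds hx] with y hy
  exact ⟨C, γ, δ, h, hy⟩

/-- Positivity at each point of a compact set is achieved by one form on the whole set, since sums
of admissible forms are admissible. -/
theorem exists_admissible_of_isCompact {K : Set M} (hK : IsCompact K) (h : K ⊆ G.positiveSet) :
    ∃ C γ δ, G.Admissible C γ δ ∧ ∀ x ∈ K, 0 < G.density (C • G.collarTwoForm + δ) x := by
  refine hK.induction_on (p := fun K => ∃ C γ δ, G.Admissible C γ δ ∧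
    ∀ x ∈ K, 0 < G.density (C • G.collarTwoForm + δ) x) ?_ ?_ ?_ ?_
  · exact ⟨0, 0, 0, G.admissible_collar le_rfl, by simp⟩
  · rintro s t hst ⟨C, γ, δ, h1, h2⟩
    exact ⟨C, γ, δ, h1, fun x hx => h2 x (hst hx)⟩
  · rintro s t ⟨C, γ, δ, h1, h2⟩ ⟨C', γ', δ', h1', h2'⟩
    refine ⟨_, _, _, h1.add h1', ?_⟩
    rintro x (hx | hx)
    · rw [density_add_add]
      exact add_pos_of_pos_of_nonneg (h2 x hx) (h1'.density_nonneg x)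
    · rw [density_add_add]
      exact add_pos_of_nonneg_of_pos (h1.density_nonneg x) (h2' x hx)
  · intro x hx
    obtain ⟨C, γ, δ, h1, h2⟩ := h hx
    exact ⟨_, mem_nhdsWithin_of_mem_nhds ((isOpen_Ioi.preimage h1.continuous).mem_nhds h2),
      C, γ, δ, h1, fun y hy => hy⟩

theorem σ_mem_positiveSet (i : Fin G.b) (θ : ℝ) {z : ℂ} (hz : z ∈ Metric.ball (0 : ℂ) 2)
    (h1 : 1 / 2 < Complex.normSq z) (h2 : Complex.normSq z < 3) :
    G.σ i θ z ∈ G.positiveSet := by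
  refine ⟨1, 0, 0, G.admissible_collar zero_le_one, ?_⟩
  rw [add_zero, one_smul]
  exact G.density_collar_pos i θ hz h1 h2

/-- The density of `dg ∧ d(Im (mY + n))`, where the base form is `2π dτ` and `g` depends on `τ` and
on the real part `a` and the imaginary part of `mY + n`, is a multiple of the partial derivative
`∂g/∂a`. -/
theorem density_twoForm {τ g : M → ℝ} {Y : M → ℂ} (hY : ContMDiff (𝓡 3) 𝓘(ℝ, ℂ) ∞ Y) (m n : ℂ)
    {x : M} (hα : ∀ v, G.baseForm x ![v] = 2 * Real.pi * differential τ x v) {p q s : ℝ}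
    (hg : ∀ v, differential g x v = p * differential τ x v +
      q * differential (fun x => (m * Y x + n).re) x v +
      s * differential (fun x => (m * Y x + n).im) x v) :
    G.density (twoForm g fun x => (m * Y x + n).im) x = q * Complex.normSq m *
      G.density (twoForm (fun x => (Y x).re) fun x => (Y x).im) x := by
  obtain ⟨u, v, w, h⟩ : ∃ u v w : TangentSpace (𝓡 3) x, 0 < G.vol x ![u, v, w] :=
    exists_positive_basis (G.vol_ne_zero x)
  have h1 := G.wedge_eq_density (twoForm g fun x => (m * Y x + n).im) x u v w
  have h2 := G.wedge_eq_density (twoForm (fun x => (Y x).re) fun x => (Y x).im) x u v w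
  have h3 : wedge G.baseForm (twoForm g fun x => (m * Y x + n).im) x u v w =
      q * Complex.normSq m *
        wedge G.baseForm (twoForm (fun x => (Y x).re) fun x => (Y x).im) x u v w := by
    unfold wedge
    rw [hα u, hα v, hα w, twoForm_pair _ _ v w, twoForm_pair _ _ u w, twoForm_pair _ _ u v,
      twoForm_pair _ _ v w, twoForm_pair _ _ u w, twoForm_pair _ _ u v, hg u, hg v, hg w,
      (differential_affine hY m n x u).1, (differential_affine hY m n x u).2,
      (differential_affine hY m n x v).1, (differential_affine hY m n x v).2,
      (differential_affine hY m n x w).1, (differential_affine hY m n x w).2, Complex.normSq_apply]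
    ring
  rw [h1, h2, ← mul_assoc] at h3
  exact mul_right_cancel₀ h.ne' h3

/-- The step of the propagation: in a flow box of the mapping torus, a form that is positive at a
point of the page through `x` near `x` can be transferred to `x`. -/
theorem mem_positiveSet_of_near [CompactSpace M] {τ : M → ℝ} {Y : M → ℂ} {F : ℝ × ℂ → M} {x : M}
    (hτ : ContMDiff (𝓡 3) 𝓘(ℝ, ℝ) ∞ τ) (hY : ContMDiff (𝓡 3) 𝓘(ℝ, ℂ) ∞ Y)
    (hF : ∀ᶠ v in 𝓝 (τ x, Y x), ContinuousAt F v) (hFx : ∀ᶠ y in 𝓝 x, F (τ y, Y y) = y)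
    (hα : ∀ᶠ y in 𝓝 x, ∀ v, G.baseForm y ![v] = 2 * Real.pi * differential τ y v)
    (hd : G.density (twoForm (fun x => (Y x).re) fun x => (Y x).im) x ≠ 0)
    (hx : ∀ᶠ y in 𝓝 x, ∀ i, y ∉ G.openSolid i 1) :
    ∀ᶠ x' in 𝓝 x, τ x' = τ x → x' ∈ G.positiveSet → x ∈ G.positiveSet := by
  let D₀ := G.density (twoForm (fun x => (Y x).re) fun x => (Y x).im)
  have hD₀ : Continuous D₀ :=
    G.continuous_density (Generated.basic (contMDiff_re hY) (contMDiff_im hY)).smooth_snd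
  -- The factor `κ` corrects the orientation of the coordinate `Y`.
  let κ := D₀ x
  have hκ : ∀ᶠ y in 𝓝 x, 0 < κ * D₀ y :=
    (continuous_const.mul hD₀).continuousAt.eventually_const_lt (mul_self_pos.2 hd)
  -- In the support of the cut-off function `χ` all local properties hold.
  obtain ⟨χ, -, hχ⟩ := (SmoothBumpFunction.nhds_basis_tsupport (I := 𝓡 3) x).mem_iff.1
    (hFx.and (hα.and (hκ.and hx)))
  obtain ⟨N, hN, hNo, hxN⟩ := mem_nhds_iff.1 χ.eventuallyEq_one
  have hFu : F (τ x, Y x) = x := hFx.self_of_nhds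
  have hFN : ∀ᶠ v in 𝓝 (τ x, Y x), F v ∈ N :=
    hF.self_of_nhds.eventually (by rw [hFu]; exact hNo.mem_nhds hxN)
  obtain ⟨r, hr, hball⟩ := Metric.eventually_nhds_iff.1 (hF.and hFN)
  have hYx : ∀ᶠ x' in 𝓝 x, ‖Y x' - Y x‖ < r / 2 := by
    have h1 : Continuous fun x' => ‖Y x' - Y x‖ := (hY.continuous.sub continuous_const).norm
    exact h1.continuousAt.eventually_lt_const (by simpa using hr)
  filter_upwards [hYx, hFx] with x' hx'1 hx'2 hτx' hS
  -- If `Y x' = Y x`, the points `x` and `x'` coincide.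
  rcases eq_or_ne (Y x') (Y x) with hd0 | hd0
  · rw [hτx', hd0, hFu] at hx'2
    rwa [hx'2]
  obtain ⟨C, γ, δ, hadm, hpos⟩ := hS
  set d := Y x' - Y x with hd_def
  have hdne : d ≠ 0 := sub_ne_zero.2 hd0
  have hdpos : 0 < ‖d‖ := norm_pos_iff.2 hdne
  let D := G.density (C • G.collarTwoForm + δ)
  have hDc : Continuous D := hadm.continuous
  have hdist : dist (τ x, Y x') (τ x, Y x) < r := by
    rw [Prod.dist_eq, dist_self, dist_eq_norm]
    exact max_lt hr (by linarith)
  have hDF : ∀ᶠ v in 𝓝 (τ x, Y x'), 0 < D (F v) := by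
    have h1 := (hball hdist).1
    rw [hτx'] at hx'2
    have h2 : ∀ᶠ y in 𝓝 (F (τ x, Y x')), 0 < D y := by
      rw [hx'2]
      exact hDc.continuousAt.eventually_const_lt hpos
    exact h1.eventually h2
  obtain ⟨ρ, hρ, hballρ⟩ := Metric.eventually_nhds_iff.1 hDF
  obtain ⟨η, hη0, hη1, hη2, hη3, hη4⟩ : ∃ η : ℝ, 0 < η ∧ η ≤ 1 / 2 ∧ η < r ∧ η < ρ ∧
      2 * η * ‖d‖ < ρ := by
    refine ⟨min (1 / 2) (min (r / 2) (min (ρ / 2) (ρ / (4 * ‖d‖)))), by positivity,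
      min_le_left _ _, ?_, ?_, ?_⟩
    · exact ((min_le_right _ _).trans (min_le_left _ _)).trans_lt (by linarith)
    · exact ((min_le_right _ _).trans ((min_le_right _ _).trans (min_le_left _ _))).trans_lt
        (by linarith)
    · have h1 : min (1 / 2) (min (r / 2) (min (ρ / 2) (ρ / (4 * ‖d‖)))) ≤ ρ / (4 * ‖d‖) :=
        (min_le_right _ _).trans ((min_le_right _ _).trans (min_le_right _ _))
      have h2 : ρ / (4 * ‖d‖) * ‖d‖ = ρ / 4 := by field_simp
      nlinarith
  -- The complex coordinate with value `0` at `x` and `1` at `x'`.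
  let m : ℂ := d⁻¹
  let n : ℂ := -(d⁻¹ * Y x)
  let a : M → ℝ := fun y => (m * Y y + n).re
  let b : M → ℝ := fun y => (m * Y y + n).im
  have hζ : ContMDiff (𝓡 3) 𝓘(ℝ, ℂ) ∞ fun y => m * Y y + n :=
    ((contDiff_const.mul contDiff_id).add contDiff_const :
      ContDiff ℝ ∞ fun y : ℂ => m * y + n).contMDiff.comp hY
  have ha : ContMDiff (𝓡 3) 𝓘(ℝ, ℝ) ∞ a := contMDiff_re hζ
  have hb : ContMDiff (𝓡 3) 𝓘(ℝ, ℝ) ∞ b := contMDiff_im hζ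
  have hYζ : ∀ y, Y y - Y x = (m * Y y + n) * d := fun y => by
    simp only [m, n]; field_simp; ring
  have hYζ' : ∀ y, Y y - Y x' = (m * Y y + n - 1) * d := fun y => by
    rw [sub_mul, ← hYζ, one_mul, hd_def]; ring
  let T : M → ℝ := fun y => bumpProfile η (τ y - τ x)
  let w : M → ℝ := fun y => bumpProfile η (b y)
  let U : M → ℝ := fun y => transferProfile η (a y)
  have hT : ContMDiff (𝓡 3) 𝓘(ℝ, ℝ) ∞ T :=
    (contDiff_bumpProfile η).contMDiff.comp (hτ.sub contMDiff_const)
  have hw : ContMDiff (𝓡 3) 𝓘(ℝ, ℝ) ∞ w := (contDiff_bumpProfile η).contMDiff.comp hb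
  have hU : ContMDiff (𝓡 3) 𝓘(ℝ, ℝ) ∞ U := (contDiff_transferProfile η).contMDiff.comp ha
  have hUw : ContMDiff (𝓡 3) 𝓘(ℝ, ℝ) ∞ fun y => U y * w y := hU.mul hw
  let g : M → ℝ := fun y => χ y * (T y * (U y * w y))
  have hg : ContMDiff (𝓡 3) 𝓘(ℝ, ℝ) ∞ g := χ.contMDiff.mul (hT.mul hUw)
  let f := G.density (κ • twoForm g b)
  have hgen : Generated (κ • oneForm g b) (κ • twoForm g b) := (Generated.basic hg hb).smul κ
  have hf : Continuous f := G.continuous_density hgen.smooth_snd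
  -- Outside of the support of `χ` the function `g` vanishes.
  have hout : ∀ y, y ∉ tsupport χ → g =ᶠ[𝓝 y] fun _ => 0 := fun y hy => by
    filter_upwards [(isClosed_tsupport χ).isOpen_compl.mem_nhds hy] with y' hy'
    simp [g, image_eq_zero_of_notMem_tsupport hy']
  -- In `N` the function `g` is the product of its three profiles.
  have hin : ∀ y ∈ N, y ∈ tsupport χ → f y = (T y * deriv (transferProfile η) (a y) * w y) *
      Complex.normSq m * (κ * D₀ y) := fun y hyN hy => by
    have h1 : g =ᶠ[𝓝 y] fun y => T y * (U y * w y) := by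
      filter_upwards [hNo.mem_nhds hyN] with y' hy'
      have : χ y' = 1 := hN hy'
      simp [g, this]
    have h2 : ∀ v : TangentSpace (𝓡 3) y, differential g y v =
        (deriv (bumpProfile η) (τ y - τ x) * (U y * w y)) * differential τ y v +
        (T y * deriv (transferProfile η) (a y) * w y) * differential a y v +
        (T y * U y * deriv (bumpProfile η) (b y)) * differential b y v := fun v => by
      have e1 := differential_real_comp (contDiff_bumpProfile η) (hτ.sub (contMDiff_const (c := τ x)))
        y v
      have e2 := differential_real_comp (contDiff_bumpProfile η) hb y v
      have e3 := differential_real_comp (contDiff_transferProfile η) ha y v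
      have e4 : differential (fun y => τ y - τ x) y v = differential τ y v := by
        have := ((hτ.mdifferentiableAt (x := y) (by simp)).hasMFDerivAt.sub
          (hasMFDerivAt_const (τ x) y)).mfderiv
        exact (congrArg (fun L : E3 →L[ℝ] ℝ => L v) this).trans (sub_zero _)
      rw [differential_congr h1]
      rw [e4] at e1
      have e0 := differential_mul hT hUw y v
      have e5 := differential_mul hU hw y v
      have e1' : differential T y v = _ := e1
      have e2' : differential w y v = _ := e2
      have e3' : differential U y v = _ := e3
      rw [e2', e3'] at e5
      rw [e5, e1'] at e0
      refine e0.trans ?_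
      ring
    have h3 := G.density_twoForm hY m n (hχ hy).2.1 h2
    change G.density (κ • twoForm g b) y = _
    rw [density_smul, h3]
    ring
  have hf0 : ∀ y, g =ᶠ[𝓝 y] (fun _ => 0) → f y = 0 := fun y hy => by
    change G.density (κ • twoForm g b) y = 0
    rw [density_smul, G.density_congr (η' := 0) (twoForm_eq_zero hy), density_zero, mul_zero]
  -- The box around `x'` outside of which `∂g/∂a ≥ 0`. By the choice of `η` the given form is
  -- positive on it.
  let K : Set M := tsupport χ ∩ {y | |τ y - τ x| ≤ η ∧ |a y - 1| ≤ η ∧ |b y| ≤ η}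
  have hcτ : Continuous fun y => |τ y - τ x| := (hτ.continuous.sub continuous_const).abs
  have hK : IsClosed K := by
    refine (isClosed_tsupport χ).inter ?_
    exact (isClosed_le hcτ continuous_const).inter
      ((isClosed_le (ha.continuous.sub continuous_const).abs continuous_const).inter
        (isClosed_le hb.continuous.abs continuous_const))
  have hDK : ∀ y ∈ K, 0 < D y := by
    rintro y ⟨hy, h1, h2, h3⟩
    have h4 : F (τ y, Y y) = y := (hχ hy).1
    rw [← h4]
    refine hballρ ?_
    rw [Prod.dist_eq, Real.dist_eq, dist_eq_norm, hYζ', norm_mul]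
    refine max_lt (h1.trans_lt hη3) ?_
    have h5 := Complex.norm_le_abs_re_add_abs_im (m * Y y + n - 1)
    have h6 : (m * Y y + n - 1).re = a y - 1 := by simp [a]
    have h7 : (m * Y y + n - 1).im = b y := by simp [b]
    rw [h6, h7] at h5
    nlinarith
  have hfK : ∀ y ∉ K, 0 ≤ f y := by
    intro y hyK
    by_cases hy : y ∈ tsupport χ
    swap
    · exact (hf0 y (hout y hy)).ge
    have h4 : F (τ y, Y y) = y := (hχ hy).1
    by_cases hyr : dist (τ y, Y y) (τ x, Y x) < r
    · have hyN : y ∈ N := h4 ▸ (hball hyr).2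
      rw [hin y hyN hy]
      have hT0 : 0 ≤ T y := bumpProfile_nonneg _ _
      have hw0 : 0 ≤ w y := bumpProfile_nonneg _ _
      refine mul_nonneg (mul_nonneg ?_ (Complex.normSq_nonneg m)) (hχ hy).2.2.1.le
      by_cases h1 : |τ y - τ x| ≤ η
      · by_cases h3 : |b y| ≤ η
        · have h2 : η < |a y - 1| := not_le.1 fun h2 => hyK ⟨hy, h1, h2, h3⟩
          exact mul_nonneg (mul_nonneg hT0 (deriv_transferProfile_nonneg hη0 h2)) hw0
        · have : w y = 0 := bumpProfile_eq_zero hη0 (not_le.1 h3).le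
          rw [this, mul_zero]
      · have : T y = 0 := bumpProfile_eq_zero hη0 (not_le.1 h1).le
        rw [this, zero_mul, zero_mul]
    -- Off the neighbourhood `N`, where `χ` need not be constant, a profile vanishes.
    · refine (hf0 y ?_).ge
      rw [not_lt, Prod.dist_eq, le_max_iff, Real.dist_eq, dist_eq_norm, hYζ, norm_mul] at hyr
      rcases hyr with h1 | h1
      · filter_upwards [(isOpen_lt continuous_const hcτ).mem_nhds (hη2.trans_le h1)] with y' hy'
        have : T y' = 0 := bumpProfile_eq_zero hη0 (le_of_lt hy')
        simp [g, this]
      · have h5 : ‖m * Y y + n‖ ≤ |a y| + |b y| := Complex.norm_le_abs_re_add_abs_im _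
        have h6 : 2 < |a y| + |b y| := by nlinarith
        by_cases h7 : η < |b y|
        · filter_upwards [(isOpen_lt continuous_const hb.continuous.abs).mem_nhds h7] with y' hy'
          have : w y' = 0 := bumpProfile_eq_zero hη0 (le_of_lt hy')
          simp [g, this]
        · have h8 : 3 / 2 < |a y| := by linarith
          filter_upwards [(isOpen_lt continuous_const ha.continuous.abs).mem_nhds h8] with y' hy'
          have : U y' = 0 := by
            rcases lt_abs.1 (show 3 / 2 < |a y'| from hy') with h | h
            · exact transferProfile_eq_zero_right hη0 (by linarith)
            · exact transferProfile_eq_zero_left (by linarith)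
          simp [g, this]
  obtain ⟨c, hc, hcf⟩ := exists_mul_add_nonneg hf hDc hadm.density_nonneg hK hfK hDK
  have hsum : ∀ y, G.density ((c * C) • G.collarTwoForm + (c • δ + κ • twoForm g b)) y =
      c * D y + f y := fun y => by
    simp only [D, f, density_add, density_smul]
    ring
  refine ⟨c * C, c • γ + κ • oneForm g b, c • δ + κ • twoForm g b, ⟨mul_nonneg hc hadm.nonneg,
    (hadm.generated.smul c).add hgen, fun i y hy => ?_, fun y => ?_⟩, ?_⟩
  · obtain ⟨h1, h2⟩ := hadm.eq_zero i y hy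
    have h3 : y ∉ tsupport χ := fun h => (hχ h).2.2.2 i hy
    have h4 : oneForm g b y = 0 := by
      have h5 : g y = 0 := (hout y h3).self_of_nhds
      rw [oneForm, h5, zero_smul]
      rfl
    have h5 : twoForm g b y = 0 := twoForm_eq_zero (hout y h3)
    constructor
    · rw [Pi.add_apply, Pi.smul_apply, Pi.smul_apply, h1, h4, smul_zero, smul_zero, add_zero]
    · rw [Pi.add_apply, Pi.smul_apply, Pi.smul_apply, h2, h5, smul_zero, smul_zero, add_zero]
  · rw [hsum]
    exact hcf y
  · rw [hsum]
    have hζx : m * Y x + n = 0 := by simp [m, n]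
    have hax : a x = 0 := by simp only [a, hζx, Complex.zero_re]
    have hbx : b x = 0 := by simp only [b, hζx, Complex.zero_im]
    refine add_pos_of_nonneg_of_pos (mul_nonneg hc (hadm.density_nonneg x)) ?_
    have hxs : x ∈ tsupport χ := subset_tsupport _ (by simp)
    rw [hin x hxN hxs, hax]
    have h1 : 0 < T x := by simp only [T, sub_self]; exact bumpProfile_zero_pos η
    have h2 : 0 < w x := by simp only [w, hbx]; exact bumpProfile_zero_pos η
    have h3 := deriv_transferProfile_zero_pos hη0 (by linarith)
    have h4 : 0 < Complex.normSq m := Complex.normSq_pos.2 (inv_ne_zero hdne)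
    exact mul_pos (mul_pos (mul_pos (mul_pos h1 h3) h2) h4) (mul_self_pos.2 hd)

end Gluing

end Propagation

/-! ### Flow boxes and positivity on the mapping torus -/

section FlowBox

variable {P : Type*} [TopologicalSpace P] [ChartedSpace (EuclideanHalfSpace 2) P]
  [IsManifold (𝓡∂ 2) ∞ P]
  {A : AbstractOpenBook P} {M : Type*} [TopologicalSpace M] [ChartedSpace E3 M]
  [IsManifold (𝓡 3) ∞ M] [T2Space M] (G : Gluing A M)

namespace Gluing

/-- If the points near `x` lie in the fibres `Φ ({τ} × P)`, the base form is `2π dτ` near `x`. -/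
theorem eventually_baseForm_eq {τ : M → ℝ} (hτ : ContMDiff (𝓡 3) 𝓘(ℝ, ℝ) ∞ τ) {x : M}
    (h : ∀ᶠ y in 𝓝 x, ∃ p, G.Φ (τ y) p = y) :
    ∀ᶠ y in 𝓝 x, ∀ v, G.baseForm y ![v] = 2 * Real.pi * differential τ y v := by
  filter_upwards [eventually_eventually_nhds.2 h] with y hy v
  obtain ⟨p, hp⟩ := hy.self_of_nhds
  have h1 := G.baseForm_Φ_apply (τ y) p
  rw [hp] at h1
  have h0 : ContDiff ℝ ∞ fun s : ℝ => 2 * Real.pi * s := contDiff_const.mul contDiff_id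
  have hd : HasDerivAt (fun s : ℝ => 2 * Real.pi * s) (2 * Real.pi) (τ y) := by
    simpa using (hasDerivAt_id (τ y)).const_mul (2 * Real.pi)
  have h2 := differential_real_comp (Real.contDiff_sin.comp h0) hτ y v
  have h3 := differential_real_comp (Real.contDiff_cos.comp h0) hτ y v
  have h4 : (fun x => (G.angle x).im) =ᶠ[𝓝 y] fun x => Real.sin (2 * Real.pi * τ x) := by
    filter_upwards [hy] with y' ⟨p', hp'⟩
    rw [← congrArg G.angle hp', angle_Φ]
  have h5 : (fun x => (G.angle x).re) =ᶠ[𝓝 y] fun x => Real.cos (2 * Real.pi * τ x) := by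
    filter_upwards [hy] with y' ⟨p', hp'⟩
    rw [← congrArg G.angle hp', angle_Φ]
  have h6 : differential (fun x => (G.angle x).im) y v =
      Real.cos (2 * Real.pi * τ y) * (2 * Real.pi) * differential τ y v := by
    rw [differential_congr h4]
    refine h2.trans ?_
    rw [show deriv (Real.sin ∘ fun s : ℝ => 2 * Real.pi * s) (τ y) = _ from hd.sin.deriv]
  have h7 : differential (fun x => (G.angle x).re) y v =
      -Real.sin (2 * Real.pi * τ y) * (2 * Real.pi) * differential τ y v := by
    rw [differential_congr h5]
    refine h3.trans ?_
    rw [show deriv (Real.cos ∘ fun s : ℝ => 2 * Real.pi * s) (τ y) = _ from hd.cos.deriv]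
  rw [h1 v, h6, h7]
  linear_combination (2 * Real.pi * differential τ y v) *
    Real.sin_sq_add_cos_sq (2 * Real.pi * τ y)

/-- Coordinates of the mapping torus near `Φ t p`, extended to global functions: the angle `τ`,
and a complex coordinate `Y` on the page. -/
theorem exists_flowBox (t : ℝ) {p : P} (hp : p ∉ (𝓡∂ 2).boundary P) :
    ∃ (τ : M → ℝ) (Y : M → ℂ) (F : ℝ × ℂ → M), ContMDiff (𝓡 3) 𝓘(ℝ, ℝ) ∞ τ ∧
      ContMDiff (𝓡 3) 𝓘(ℝ, ℂ) ∞ Y ∧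
      (∀ᶠ v in 𝓝 (τ (G.Φ t p), Y (G.Φ t p)), ContinuousAt F v) ∧
      (∀ᶠ y in 𝓝 (G.Φ t p), F (τ y, Y y) = y) ∧
      (∀ᶠ y in 𝓝 (G.Φ t p), ∃ q, G.Φ (τ y) q = y) ∧
      (∀ᶠ q in 𝓝 p, τ (G.Φ t q) = τ (G.Φ t p)) ∧
      G.density (twoForm (fun x => (Y x).re) fun x => (Y x).im) (G.Φ t p) ≠ 0 := by
  have hsm := G.eventually_contMDiffAt_ΦChart hp t
  obtain ⟨g, hg, hFg, hgF⟩ := exists_smooth_inverse finrank_prod_plane hsm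
    (G.surjective_mfderiv_ΦChart hp t)
  set u : ℝ × EuclideanSpace ℝ (Fin 2) := (t, extChartAt (𝓡∂ 2) p p) with hu
  have hFu : G.ΦChart p u = G.Φ t p := G.ΦChart_self t p
  have hgu : g (G.ΦChart p u) = u := hgF.self_of_nhds
  rw [hFu] at hFg
  let L : ℂ ≃L[ℝ] EuclideanSpace ℝ (Fin 2) :=
    Complex.orthonormalBasisOneI.repr.toContinuousLinearEquiv
  let τ : M → ℝ := fun y => (g y).1
  let Y : M → ℂ := fun y => L.symm (g y).2
  let F : ℝ × ℂ → M := fun v => G.ΦChart p (v.1, L v.2)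
  have hτ : ContMDiff (𝓡 3) 𝓘(ℝ, ℝ) ∞ τ := contDiff_fst.contMDiff.comp hg
  have hY : ContMDiff (𝓡 3) 𝓘(ℝ, ℂ) ∞ Y :=
    (L.symm.contDiff.comp contDiff_snd).contMDiff.comp hg
  have hτY : (τ (G.Φ t p), L (Y (G.Φ t p))) = u := by
    simp only [τ, Y, L.apply_symm_apply, ← hFu, hgu]
  have hτq : ∀ᶠ q in 𝓝 p, τ (G.Φ t q) = t := by
    have h1 : Tendsto (fun q => (t, extChartAt (𝓡∂ 2) p q)) (𝓝 p) (𝓝 u) :=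
      tendsto_const_nhds.prodMk_nhds (continuousAt_extChartAt p)
    filter_upwards [h1.eventually hgF, extChartAt_source_mem_nhds (I := 𝓡∂ 2) p] with q h2 h3
    have h4 : G.ΦChart p (t, extChartAt (𝓡∂ 2) p q) = G.Φ t q := by
      rw [ΦChart, (extChartAt (𝓡∂ 2) p).left_inv h3]
    rw [h4] at h2
    simp only [τ, h2]
  have hτx : τ (G.Φ t p) = t := hτq.self_of_nhds
  have hFx : ∀ᶠ y in 𝓝 (G.Φ t p), F (τ y, Y y) = y := by
    filter_upwards [hFg] with y hy
    simpa only [F, τ, Y, L.apply_symm_apply] using hy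
  have hΦ : ∀ᶠ y in 𝓝 (G.Φ t p), ∃ q, G.Φ (τ y) q = y := by
    filter_upwards [hFg] with y hy
    exact ⟨_, hy⟩
  refine ⟨τ, Y, F, hτ, hY, ?_, hFx, hΦ, by simpa only [hτx] using hτq, fun h0 => ?_⟩
  · have hc : Continuous fun v : ℝ × ℂ => (v.1, L v.2) :=
      continuous_fst.prodMk (L.continuous.comp continuous_snd)
    have h1 := (hc.tendsto (τ (G.Φ t p), Y (G.Φ t p)))
    simp only [hτY] at h1
    filter_upwards [h1.eventually hsm] with v hv
    exact ContinuousAt.comp (f := fun v : ℝ × ℂ => (v.1, L v.2)) hv.continuousAt hc.continuousAt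
  -- On the image of the standard basis of the parameter space, `dτ ∧ dRe Y ∧ dIm Y` is `1`.
  · have hα := (G.eventually_baseForm_eq hτ hΦ).self_of_nhds
    have hd := hsm.self_of_nhds.mdifferentiableAt (by simp)
    let DF : ℝ × EuclideanSpace ℝ (Fin 2) → TangentSpace (𝓡 3) (G.ΦChart p u) := fun e =>
      mfderiv 𝓘(ℝ, ℝ × EuclideanSpace ℝ (Fin 2)) (𝓡 3) (G.ΦChart p) u e
    rw [← hFu] at hα h0
    have e1 : ∀ e, differential τ (G.ΦChart p u) (DF e) = e.1 := fun e => by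
      refine (differential_comp hτ hd e).trans ?_
      have : τ ∘ G.ΦChart p =ᶠ[𝓝 u] fun v => v.1 := by
        filter_upwards [hgF] with v hv
        simp [τ, hv]
      rw [this.fderiv_eq]
      exact congrArg (fun L : ℝ × EuclideanSpace ℝ (Fin 2) →L[ℝ] ℝ => L e)
        (hasFDerivAt_fst (𝕜 := ℝ)).fderiv
    have e2 : ∀ e, differential (fun x => (Y x).re) (G.ΦChart p u) (DF e) = (L.symm e.2).re :=
        fun e => by
      refine (differential_comp (contMDiff_re hY) hd e).trans ?_
      let l : ℝ × EuclideanSpace ℝ (Fin 2) →L[ℝ] ℝ := Complex.reCLM.comp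
        ((L.symm : EuclideanSpace ℝ (Fin 2) →L[ℝ] ℂ).comp (ContinuousLinearMap.snd ℝ _ _))
      have : (fun x => (Y x).re) ∘ G.ΦChart p =ᶠ[𝓝 u] l := by
        filter_upwards [hgF] with v hv
        simp [Y, hv, l]
      rw [this.fderiv_eq, l.fderiv]
      rfl
    have e3 : ∀ e, differential (fun x => (Y x).im) (G.ΦChart p u) (DF e) = (L.symm e.2).im :=
        fun e => by
      refine (differential_comp (contMDiff_im hY) hd e).trans ?_
      let l : ℝ × EuclideanSpace ℝ (Fin 2) →L[ℝ] ℝ := Complex.imCLM.comp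
        ((L.symm : EuclideanSpace ℝ (Fin 2) →L[ℝ] ℂ).comp (ContinuousLinearMap.snd ℝ _ _))
      have : (fun x => (Y x).im) ∘ G.ΦChart p =ᶠ[𝓝 u] l := by
        filter_upwards [hgF] with v hv
        simp [Y, hv, l]
      rw [this.fderiv_eq, l.fderiv]
      rfl
    have h1 := G.wedge_eq_density (twoForm (fun x => (Y x).re) fun x => (Y x).im)
      (G.ΦChart p u) (DF (1, 0)) (DF (0, L 1)) (DF (0, L Complex.I))
    rw [h0, zero_mul] at h1
    unfold wedge at h1
    rw [hα, hα, hα, twoForm_pair, twoForm_pair, twoForm_pair] at h1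
    simp only [e1, e2, e3] at h1
    simp [Real.pi_ne_zero] at h1

theorem closedSolid_mono (i : Fin G.b) {r r' : ℝ} (h : r ≤ r') :
    G.closedSolid i r ⊆ G.closedSolid i r' :=
  image_mono (prod_mono_right (Metric.closedBall_subset_closedBall h))

theorem Φ_mem_positiveSet_of_closedSolid {t : ℝ} {p : P} {i : Fin G.b}
    (h : G.Φ t p ∈ G.closedSolid i (3 / 2)) : G.Φ t p ∈ G.positiveSet := by
  obtain ⟨θ, z, hz, hx⟩ := G.mem_closedSolid.1 h
  have hz1 : ‖z‖ ≤ 3 / 2 := by simpa using hz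
  have hz2 : 1 ≤ ‖z‖ := by
    by_contra! h1
    exact G.disjoint i θ z (by simpa using h1) t p hx
  rw [← hx]
  refine G.σ_mem_positiveSet i θ (closedBall_subset (by norm_num) hz) ?_ ?_ <;>
    rw [← Complex.sq_norm] <;> nlinarith

/-- On each page the set of points with positive density is open and closed, and contains the
boundary; so it is the whole page. -/
theorem Φ_mem_positiveSet [CompactSpace M] (t : ℝ) (p : P) : G.Φ t p ∈ G.positiveSet := by
  have hcont : Continuous (G.Φ t) := (G.contMDiff_Φ_right t).continuous
  have hopen : IsOpen (G.Φ t ⁻¹' G.positiveSet) := G.isOpen_positiveSet.preimage hcont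
  have hclosed : IsClosed (G.Φ t ⁻¹' G.positiveSet) := by
    rw [← closure_subset_iff_isClosed]
    intro q hq
    by_cases h : ∃ i, G.Φ t q ∈ G.closedSolid i (3 / 2)
    · obtain ⟨i, h⟩ := h
      exact G.Φ_mem_positiveSet_of_closedSolid h
    push Not at h
    have hqb : q ∉ (𝓡∂ 2).boundary P :=
      G.not_mem_boundary rfl fun i hi => h i (G.closedSolid_mono i (by norm_num) hi)
    obtain ⟨τ, Y, F, hτ, hY, hF, hFx, hΦ, hτq, hd⟩ := G.exists_flowBox t hqb
    have hx : ∀ᶠ y in 𝓝 (G.Φ t q), ∀ i, y ∉ G.openSolid i 1 := by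
      filter_upwards [(G.isOpen_compl_closedSolids (r := 3 / 2) (by norm_num)).mem_nhds h]
        with y hy i hi
      obtain ⟨θ, z, hz, rfl⟩ := G.mem_openSolid.1 hi
      exact hy i (G.mem_closedSolid.2 ⟨θ, z, Metric.ball_subset_closedBall
        (Metric.ball_subset_ball (by norm_num) hz), rfl⟩)
    have h1 := G.mem_positiveSet_of_near hτ hY hF hFx (G.eventually_baseForm_eq hτ hΦ) hd hx
    obtain ⟨q', h2, h3, h4⟩ := ((mem_closure_iff_frequently.1 hq).and_eventually
      ((hcont.continuousAt.eventually h1).and hτq)).exists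
    exact h3 h4 h2
  obtain ⟨r, hr, hrp⟩ := A.meets_boundary p
  obtain ⟨i, θ, rfl⟩ := (G.κ_boundary r).1 hr
  have hmem : G.κ i 1 θ ∈ G.Φ t ⁻¹' G.positiveSet := by
    refine G.Φ_mem_positiveSet_of_closedSolid (i := i) ?_
    refine G.mem_closedSolid.2 ⟨θ, _, ?_, G.glue i 1 ⟨le_rfl, by norm_num⟩ θ t⟩
    simp [Complex.norm_exp]
    norm_num
  have hp : p ∈ connectedComponent (G.κ i 1 θ) := by
    rw [← connectedComponent_eq hrp]
    exact mem_connectedComponent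
  exact IsClopen.connectedComponent_subset ⟨hclosed, hopen⟩ hmem hp

theorem isCompact_range_Φ [CompactSpace P] : IsCompact {x | ∃ t p, G.Φ t p = x} := by
  have h : {x | ∃ t p, G.Φ t p = x} = uncurry G.Φ '' (Icc 0 1 ×ˢ univ) := by
    refine Subset.antisymm ?_ ?_
    · rintro _ ⟨t, p, rfl⟩
      refine ⟨(Int.fract t, ((A.ψ.toEquiv : Equiv.Perm P) ^ ⌊t⌋) p),
        ⟨⟨Int.fract_nonneg t, (Int.fract_lt_one t).le⟩, mem_univ _⟩, ?_⟩
      refine ((G.Φ_eq_iff t p _ _).2 ⟨⌊t⌋, (Int.fract_add_floor t).symm, rfl⟩).symm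
    · rintro _ ⟨⟨t, p⟩, -, rfl⟩
      exact ⟨t, p, rfl⟩
  rw [h]
  exact (isCompact_Icc.prod isCompact_univ).image G.continuous_Φ

/-- The deformation of the base form on the whole mapping torus. -/
theorem exists_admissible [CompactSpace P] [CompactSpace M] : ∃ C γ δ, G.Admissible C γ δ ∧
    ∀ t p, 0 < G.density (C • G.collarTwoForm + δ) (G.Φ t p) := by
  obtain ⟨C, γ, δ, h1, h2⟩ := G.exists_admissible_of_isCompact G.isCompact_range_Φ (by
    rintro _ ⟨t, p, rfl⟩
    exact G.Φ_mem_positiveSet t p)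
  exact ⟨C, γ, δ, h1, fun t p => h2 _ ⟨t, p, rfl⟩⟩

end Gluing

end FlowBox

/-! ### The taming form and its positivity -/

section Taming

variable {P : Type*} [TopologicalSpace P] [ChartedSpace (EuclideanHalfSpace 2) P]
  [IsManifold (𝓡∂ 2) ∞ P]
  {A : AbstractOpenBook P} {M : Type*} [TopologicalSpace M] [ChartedSpace E3 M]
  [IsManifold (𝓡 3) ∞ M] [T2Space M] (G : Gluing A M)

namespace Gluing

variable {G} {C : ℝ} {γ : DiffForm (𝓡 3) M 1} {δ : DiffForm (𝓡 3) M 2}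

theorem normSq_lt_one {z : ℂ} (hz : z ∈ Metric.ball (0 : ℂ) 1) : Complex.normSq z < 1 := by
  have h1 : ‖z‖ < 1 := by simpa using hz
  rw [← Complex.sq_norm]
  nlinarith [norm_nonneg z]

theorem Admissible.twoForm_σ (h : G.Admissible C γ δ) (i : Fin G.b) (θ : ℝ) {z : ℂ}
    (hz : z ∈ Metric.ball (0 : ℂ) 1) (v w : ℝ × ℂ) :
    (C • G.collarTwoForm + δ) (G.σ i θ z) ![G.dσ i θ z v, G.dσ i θ z w] =
      C * (8 * Real.pi * (collarProfile (Complex.normSq z) *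
        deriv collarProfile (Complex.normSq z)) *
        ((z.re * v.2.re + z.im * v.2.im) * w.1 - (z.re * w.2.re + z.im * w.2.im) * v.1)) := by
  have h1 := (h.eq_zero i _ (G.mem_openSolid.2 ⟨θ, z, hz, rfl⟩)).2
  rw [← G.collarTwoForm_σ i θ (ball_subset (by norm_num) hz)]
  change C * _ + δ (G.σ i θ z) _ = _
  rw [h1]
  exact add_zero _

/-- At each point the exterior derivatives of the base form and of the deformation are
proportional, with nonnegative factors. -/
theorem Admissible.exists_proportional (h : G.Admissible C γ δ) (x : M) : ∃ r ∈ Icc (0 : ℝ) 1,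
    G.baseTwoForm x = r • (G.baseTwoForm + (C • G.collarTwoForm + δ)) x ∧
    (C • G.collarTwoForm + δ) x = (1 - r) • (G.baseTwoForm + (C • G.collarTwoForm + δ)) x := by
  rcases G.cover x with ⟨t, p, rfl⟩ | ⟨i, θ, z, hz, rfl⟩
  · refine ⟨0, by simp, ?_, ?_⟩
    · rw [baseTwoForm_Φ, zero_smul]
    · rw [sub_zero, one_smul, Pi.add_apply G.baseTwoForm, baseTwoForm_Φ, zero_add]
  have hz2 := ball_subset (by norm_num : (1 : ℝ) ≤ 2) hz
  have hs1 := normSq_lt_one hz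
  rcases lt_or_ge (Complex.normSq z) (1 / 2) with hs | hs
  · have h1 : (C • G.collarTwoForm + δ) (G.σ i θ z) = 0 :=
      G.form_two_eq_zero_of_dσ _ i θ hz2 fun v w => by
        rw [h.twoForm_σ i θ hz, deriv_collarProfile_eq_zero hs]
        ring
    refine ⟨1, by simp, ?_, ?_⟩
    · rw [one_smul, Pi.add_apply G.baseTwoForm, h1, add_zero]
    · rw [sub_self, zero_smul, h1]
  · set a := coreProfile (Complex.normSq z) * deriv coreProfile (Complex.normSq z) with ha
    set b := C * (collarProfile (Complex.normSq z) * deriv collarProfile (Complex.normSq z)) with hb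
    have ha0 : a < 0 := mul_neg_of_pos_of_neg (coreProfile_pos hs1) (deriv_coreProfile_neg hs1)
    have hb0 : b ≤ 0 := mul_nonpos_of_nonneg_of_nonpos h.nonneg
      (mul_nonpos_of_nonneg_of_nonpos (collarProfile_nonneg _) (deriv_collarProfile_nonpos _))
    have hab : a + b < 0 := by linarith
    let R : ℝ × ℂ → ℝ × ℂ → ℝ := fun v w =>
      8 * Real.pi * ((z.re * v.2.re + z.im * v.2.im) * w.1 -
        (z.re * w.2.re + z.im * w.2.im) * v.1)
    have h1 : ∀ v w, G.baseTwoForm (G.σ i θ z) ![G.dσ i θ z v, G.dσ i θ z w] = a * R v w :=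
      fun v w => by
        rw [G.baseTwoForm_σ i θ hz2, discDensity_eq_zero (by linarith)]
        simp only [R]
        ring
    have h2 : ∀ v w, (C • G.collarTwoForm + δ) (G.σ i θ z) ![G.dσ i θ z v, G.dσ i θ z w] =
        b * R v w := fun v w => by
      rw [h.twoForm_σ i θ hz]
      simp only [R, hb]
      ring
    have h3 : ∀ v w, (G.baseTwoForm + (C • G.collarTwoForm + δ)) (G.σ i θ z)
        ![G.dσ i θ z v, G.dσ i θ z w] = (a + b) * R v w := fun v w => by
      rw [add_mul, ← h1, ← h2]
      rfl
    have h4 : ∀ (η : DiffForm (𝓡 3) M 2) (r s : ℝ), s = r * (a + b) →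
        (∀ v w, η (G.σ i θ z) ![G.dσ i θ z v, G.dσ i θ z w] = s * R v w) →
        η (G.σ i θ z) = r • (G.baseTwoForm + (C • G.collarTwoForm + δ)) (G.σ i θ z) := by
      intro η r s hs hη
      refine form_two_ext fun v w => ?_
      obtain ⟨v, rfl⟩ := G.surjective_dσ i θ hz2 v
      obtain ⟨w, rfl⟩ := G.surjective_dσ i θ hz2 w
      rw [hη, hs, mul_assoc, ← h3]
      rfl
    refine ⟨a / (a + b), ⟨div_nonneg_of_nonpos ha0.le hab.le, ?_⟩, h4 _ _ _ ?_ h1, h4 _ _ _ ?_ h2⟩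
    · rw [div_le_one_of_neg hab]
      linarith
    · rw [div_mul_cancel₀ _ hab.ne]
    · rw [sub_mul, div_mul_cancel₀ _ hab.ne]
      ring

/-- The sum of the exterior derivatives of the base form and of the deformation is positive on the
kernel of the base form. -/
theorem Admissible.density_pos (h : G.Admissible C γ δ)
    (hΦ : ∀ t p, 0 < G.density (C • G.collarTwoForm + δ) (G.Φ t p)) (x : M) :
    0 < G.density (G.baseTwoForm + (C • G.collarTwoForm + δ)) x := by
  rcases G.cover x with ⟨t, p, rfl⟩ | ⟨i, θ, z, hz, rfl⟩
  · rw [density_add, G.density_congr (η' := 0) (G.baseTwoForm_Φ t p), density_zero, zero_add]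
    exact hΦ t p
  have hz2 := ball_subset (by norm_num : (1 : ℝ) ≤ 2) hz
  have hs1 := normSq_lt_one hz
  set s := Complex.normSq z with hs
  have h0 : 0 ≤ s := Complex.normSq_nonneg z
  have hvol := G.vol_dσ_pos i θ hz2
  have h1 := G.wedge_eq_density (G.baseTwoForm + (C • G.collarTwoForm + δ)) (G.σ i θ z)
    (G.dσ i θ z (1, 0)) (G.dσ i θ z (0, 1)) (G.dσ i θ z (0, Complex.I))
  refine pos_of_mul_pos_left (h1 ▸ ?_) hvol.le
  have h2 : ∀ v w, (G.baseTwoForm + (C • G.collarTwoForm + δ)) (G.σ i θ z)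
      ![G.dσ i θ z v, G.dσ i θ z w] = _ := fun v w =>
    congrArg₂ (fun a b : ℝ => a + b) (G.baseTwoForm_σ i θ hz2 v w) (h.twoForm_σ i θ hz v w)
  unfold wedge
  rw [G.baseForm_σ i θ hz2, G.baseForm_σ i θ hz2, G.baseForm_σ i θ hz2, h2, h2, h2, ← hs]
  have hn : s = z.re * z.re + z.im * z.im := Complex.normSq_apply z
  have ha0 : 0 < coreProfile s := coreProfile_pos hs1
  have ha1 : 0 < -deriv coreProfile s := by have := deriv_coreProfile_neg hs1; linarith
  have hb0 := collarProfile_nonneg s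
  have hb1 : 0 ≤ -deriv collarProfile s := by have := deriv_collarProfile_nonpos s; linarith
  have hk := discProfile_pos s
  have hJ := discDensity_nonneg h0
  have hπ := Real.pi_pos
  have hC := h.nonneg
  have key : 0 < 2 * Real.pi * coreProfile s ^ 2 * discDensity s +
      8 * Real.pi * discProfile s ^ 2 * s * (coreProfile s * -deriv coreProfile s +
        C * (collarProfile s * -deriv collarProfile s)) := by
    rcases h0.eq_or_lt with h0 | h0
    · rw [← h0]
      have := discDensity_zero_pos
      have := coreProfile_pos zero_lt_one
      have : 0 < 2 * Real.pi * coreProfile 0 ^ 2 * discDensity 0 := by positivity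
      linarith
    · positivity
  refine key.trans_eq ?_
  simp
  rw [hn]
  ring

/-! Positivity on the pages in the mapping torus. -/

/-- The taming form is positive on the fibres of the mapping torus, as the base form vanishes on
them and is positive on `∂_t`. -/
theorem Admissible.pos_Φ (h : G.Admissible C γ δ)
    (hΦ : ∀ t p, 0 < G.density (C • G.collarTwoForm + δ) (G.Φ t p)) (t : ℝ) (p : P)
    (v w : TangentSpace (𝓡∂ 2) p) (hvw : 0 < A.area p ![v, w]) :
    0 < (G.baseTwoForm + (C • G.collarTwoForm + δ)) (G.Φ t p)
      ![mfderiv (𝓡∂ 2) (𝓡 3) (G.Φ t) p v, mfderiv (𝓡∂ 2) (𝓡 3) (G.Φ t) p w] := by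
  have h1 := G.wedge_eq_density (G.baseTwoForm + (C • G.collarTwoForm + δ)) (G.Φ t p)
    (mfderiv 𝓘(ℝ, ℝ) (𝓡 3) (fun s => G.Φ s p) t (1 : ℝ))
    (mfderiv (𝓡∂ 2) (𝓡 3) (G.Φ t) p v) (mfderiv (𝓡∂ 2) (𝓡 3) (G.Φ t) p w)
  unfold wedge at h1
  rw [G.baseForm_Φ_left, G.baseForm_Φ_right, G.baseForm_Φ_right, zero_mul, zero_mul, sub_zero,
    add_zero] at h1
  have h2 := mul_pos (h.density_pos hΦ (G.Φ t p)) (G.Φ_oriented t p v w hvw)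
  rw [← h1] at h2
  exact pos_of_mul_pos_right h2 (by have := Real.pi_pos; positivity)

variable (G) in
/-- On the mapping torus the kernel of the base form is the vertical distribution, since the base
form is `2π dt` there. -/
theorem extendsVertical : G.ExtendsVertical (kernelField G.baseForm) := by
  intro t p
  apply le_antisymm
  · intro u hu
    rw [mem_kernelField] at hu
    obtain ⟨v, w, hvw⟩ := exists_area_pos A p
    let e : TangentSpace (𝓡 3) (G.Φ t p) := mfderiv 𝓘(ℝ, ℝ) (𝓡 3) (fun s => G.Φ s p) t (1 : ℝ)
    let B : TangentSpace (𝓡∂ 2) p →ₗ[ℝ] TangentSpace (𝓡 3) (G.Φ t p) :=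
      (mfderiv (𝓡∂ 2) (𝓡 3) (G.Φ t) p).toLinearMap
    let L : ℝ × TangentSpace (𝓡∂ 2) p →ₗ[ℝ] TangentSpace (𝓡 3) (G.Φ t p) :=
      (LinearMap.toSpanSingleton ℝ _ e).coprod B
    have hL0 : L (1, 0) = e := by simp [L]
    have hLv : ∀ v, L (0, v) = B v := fun v => by simp [L]
    have hvol : 0 < G.vol (G.Φ t p) ![L (1, 0), L (0, v), L (0, w)] := by
      rw [hL0, hLv, hLv]
      exact G.Φ_oriented t p v w hvw
    obtain ⟨⟨a, η⟩, rfl⟩ := surjective_of_form_ne_zero L (G.vol (G.Φ t p)) hvol.ne' u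
    have h1 : L (a, η) = a • e + B η := by simp [L]
    have h2 : G.baseForm (G.Φ t p) ![L (a, η)] = a * (2 * Real.pi) := by
      refine (congrArg (fun u : TangentSpace (𝓡 3) (G.Φ t p) =>
        G.baseForm (G.Φ t p) ![u]) h1).trans ?_
      refine ((G.baseForm (G.Φ t p)).vecCons_add ![] (a • e) (B η)).trans ?_
      have h3 : G.baseForm (G.Φ t p) ![a • e] = a * (2 * Real.pi) := by
        rw [form_one_smul]
        exact congrArg (fun r : ℝ => a * r) (G.baseForm_Φ_left t p)
      have h4 : G.baseForm (G.Φ t p) ![B η] = 0 := G.baseForm_Φ_right t p η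
      exact (congrArg₂ (fun r s : ℝ => r + s) h3 h4).trans (add_zero _)
    have h3 : a = 0 := by
      rcases mul_eq_zero.1 (h2.symm.trans hu) with h | h
      · exact h
      · exact absurd h (by have := Real.pi_pos; positivity)
    have h4 : a • e + B η = B η := by rw [h3, zero_smul, zero_add]
    exact ⟨η, (h1.trans h4).symm⟩
  · rintro _ ⟨v, rfl⟩
    rw [mem_kernelField]
    exact G.baseForm_Φ_right t p v

theorem Admissible.positivelyTransverse (h : G.Admissible C γ δ)
    (hΦ : ∀ t p, 0 < G.density (C • G.collarTwoForm + δ) (G.Φ t p))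
    {X : ∀ x : M, TangentSpace (𝓡 3) x} (hX : ∀ x, G.baseForm x ![X x] = 1) :
    G.PositivelyTransverse X := by
  intro t p v w hvw
  have h1 := G.wedge_eq_density (G.baseTwoForm + (C • G.collarTwoForm + δ)) (G.Φ t p)
    (X (G.Φ t p)) (mfderiv (𝓡∂ 2) (𝓡 3) (G.Φ t) p v) (mfderiv (𝓡∂ 2) (𝓡 3) (G.Φ t) p w)
  unfold wedge at h1
  rw [hX, G.baseForm_Φ_right, G.baseForm_Φ_right, zero_mul, zero_mul, sub_zero,
    add_zero, one_mul] at h1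
  have h2 := h.pos_Φ hΦ t p v w hvw
  rw [h1] at h2
  exact pos_of_mul_pos_right h2 (h.density_pos hΦ _).le

/-! Positivity on the pages in the solid tori. -/

/-- On the collar the parametrizations by the solid torus and by the mapping torus have the same
tangent vectors to the pages. -/
theorem exists_dσ_eq (i : Fin G.b) (θ : ℝ) {z : ℂ} (hz : z ∈ Metric.ball (0 : ℂ) 2)
    (h1 : 1 ≤ ‖z‖) : ∃ φ : ℝ, G.Φ φ (G.κ i ‖z‖ θ) = G.σ i θ z ∧
      (mfderiv (𝓡∂ 2) (𝓡 3) (G.Φ φ) (G.κ i ‖z‖ θ)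
        (mfderiv 𝓘(ℝ, ℝ) (𝓡∂ 2) (fun θ' => G.κ i ‖z‖ θ') θ (1 : ℝ)) : E3) =
          G.dσ i θ z (1, 0) ∧
      (‖z‖ • mfderiv (𝓡∂ 2) (𝓡 3) (G.Φ φ) (G.κ i ‖z‖ θ)
        (mfderivWithin 𝓘(ℝ, ℝ) (𝓡∂ 2) (fun ρ => G.κ i ρ θ) (Ico 1 2) ‖z‖ (1 : ℝ)) : E3) =
          G.dσ i θ z (0, z) := by
  have h2 : ‖z‖ < 2 := by simpa using hz
  have hmem : ‖z‖ ∈ Ico (1 : ℝ) 2 := ⟨h1, h2⟩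
  let φ := z.arg / (2 * Real.pi)
  let e : ℂ := Complex.exp (2 * Real.pi * φ * Complex.I)
  have hze : (‖z‖ : ℂ) * e = z := norm_mul_exp_arg_div z
  have hglue : ∀ θ', G.σ i θ' z = G.Φ φ (G.κ i ‖z‖ θ') := fun θ' => by
    rw [← G.glue i ‖z‖ hmem θ' φ]
    congr 1
    exact hze.symm
  have hΦd : ∀ p, MDifferentiableAt (𝓡∂ 2) (𝓡 3) (G.Φ φ) p := fun p =>
    (G.contMDiff_Φ_right φ).mdifferentiableAt (by simp)
  refine ⟨φ, (hglue θ).symm, ?_, ?_⟩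
  · rw [← G.mfderiv_σ_left i θ hz]
    have hκ : MDifferentiableAt 𝓘(ℝ, ℝ) (𝓡∂ 2) (fun θ' => G.κ i ‖z‖ θ') θ := by
      have h5 : ContMDiffOn 𝓘(ℝ, ℝ) (𝓡∂ 2) ∞ (fun θ' : ℝ => G.κ i ‖z‖ θ') univ :=
        (G.κ_smooth i).comp (f := fun θ' : ℝ => (‖z‖, θ'))
          (contDiff_const.prodMk contDiff_id).contMDiff.contMDiffOn
          fun θ' _ => ⟨hmem, mem_univ _⟩
      exact (contMDiffOn_univ.1 h5).mdifferentiableAt (by simp)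
    have h6 := mfderiv_comp θ (hΦd _) hκ
    have h7 : (G.Φ φ ∘ fun θ' => G.κ i ‖z‖ θ') = fun θ' => G.σ i θ' z :=
      funext fun θ' => (hglue θ').symm
    rw [h7] at h6
    exact (congrArg (fun L : ℝ →L[ℝ] E3 => L (1 : ℝ)) h6).symm
  · have hκ : MDifferentiableWithinAt 𝓘(ℝ, ℝ) (𝓡∂ 2) (fun ρ => G.κ i ρ θ) (Ico 1 2) ‖z‖ := by
      have h5 : ContMDiffOn 𝓘(ℝ, ℝ) (𝓡∂ 2) ∞ (fun ρ : ℝ => G.κ i ρ θ) (Ico 1 2) :=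
        (G.κ_smooth i).comp (f := fun ρ : ℝ => (ρ, θ))
          (contDiff_id.prodMk contDiff_const).contMDiff.contMDiffOn
          fun ρ hρ => ⟨hρ, mem_univ _⟩
      exact (h5 _ hmem).mdifferentiableWithinAt (by simp)
    have hu : UniqueMDiffWithinAt 𝓘(ℝ, ℝ) (Ico (1 : ℝ) 2) ‖z‖ :=
      (uniqueDiffOn_Ico 1 2 _ hmem).uniqueMDiffWithinAt
    have h6 := ((hΦd _).hasMFDerivAt.comp_hasMFDerivWithinAt ‖z‖ hκ.hasMFDerivWithinAt)
    -- The radial curve in the solid torus.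
    have hc : HasFDerivAt (fun ρ : ℝ => (θ, (ρ : ℂ) * e))
        ((ContinuousLinearMap.inr ℝ ℝ ℂ).comp (Complex.ofRealCLM.smulRight e)) ‖z‖ := by
      have := (ContinuousLinearMap.hasFDerivAt (Complex.ofRealCLM.smulRight e) (x := ‖z‖))
      exact (hasFDerivAt_prodMk_right θ _).comp ‖z‖ this
    have h8 : HasMFDerivAt 𝓘(ℝ, ℝ × ℂ) (𝓡 3) (uncurry (G.σ i)) (θ, (‖z‖ : ℂ) * e)
        (G.dσ i θ z) := by
      have h9 := (G.mdifferentiableAt_σ i (q := (θ, z)) hz).hasMFDerivAt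
      rw [hze]
      exact h9
    have h10 := HasMFDerivAt.comp ‖z‖ (f := fun ρ : ℝ => (θ, (ρ : ℂ) * e)) h8 hc.hasMFDerivAt
    have h11 : ∀ ρ ∈ Ico (1 : ℝ) 2, (G.Φ φ ∘ fun ρ => G.κ i ρ θ) ρ =
        (uncurry (G.σ i) ∘ fun ρ : ℝ => (θ, (ρ : ℂ) * e)) ρ := fun ρ hρ =>
      (G.glue i ρ hρ θ φ).symm
    have h12 := (h10.hasMFDerivWithinAt (s := Ico 1 2)).congr_of_eventuallyEq
      (eventually_of_mem self_mem_nhdsWithin h11) (h11 _ hmem)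
    have h13 := hu.eq h6 h12
    have h14 := congrArg (fun L : ℝ →L[ℝ] E3 => ‖z‖ • L (1 : ℝ)) h13
    refine h14.trans ?_
    change ‖z‖ • G.dσ i θ z (0, ((1 : ℝ) : ℂ) * e) = _
    refine ((G.dσ i θ z).map_smul ‖z‖ _).symm.trans ?_
    congr 1
    refine Prod.ext (by simp) ?_
    simp [hze]

/-- On the part `1 ≤ |z|` of the collar, positivity is that of the page of the mapping torus; on the
solid torus it follows from the monotonicity of the radial profiles. -/
theorem Admissible.pos_σ (h : G.Admissible C γ δ)
    (hΦ : ∀ t p, 0 < G.density (C • G.collarTwoForm + δ) (G.Φ t p)) (i : Fin G.b) (θ : ℝ) {z : ℂ}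
    (hz : z ∈ Metric.ball (0 : ℂ) 2) (hz0 : z ≠ 0) :
    0 < (G.baseTwoForm + (C • G.collarTwoForm + δ)) (G.σ i θ z)
      ![G.dσ i θ z (1, 0), G.dσ i θ z (0, z)] := by
  rcases lt_or_ge ‖z‖ 1 with h1 | h1
  · have hz1 : z ∈ Metric.ball (0 : ℂ) 1 := by simpa using h1
    have hs1 := normSq_lt_one hz1
    refine lt_of_lt_of_eq ?_ (congrArg₂ (fun a b : ℝ => a + b)
      (G.baseTwoForm_σ i θ hz (1, 0) (0, z)) (h.twoForm_σ i θ hz1 (1, 0) (0, z))).symm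
    have hn : Complex.normSq z = z.re * z.re + z.im * z.im := Complex.normSq_apply z
    set s := Complex.normSq z with hs
    have h0 : 0 < s := Complex.normSq_pos.2 hz0
    have ha0 : 0 < coreProfile s := coreProfile_pos hs1
    have ha1 : 0 < -deriv coreProfile s := by have := deriv_coreProfile_neg hs1; linarith
    have hb0 := collarProfile_nonneg s
    have hb1 : 0 ≤ -deriv collarProfile s := by have := deriv_collarProfile_nonpos s; linarith
    have hπ := Real.pi_pos
    have hC := h.nonneg
    have key : 0 < 8 * Real.pi * s * (coreProfile s * -deriv coreProfile s +
        C * (collarProfile s * -deriv collarProfile s)) := by positivity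
    refine key.trans_eq ?_
    simp
    rw [hn]
    ring
  · obtain ⟨φ, h2, h3, h4⟩ := exists_dσ_eq (G := G) i θ hz h1
    have h5 : ‖z‖ < 2 := by simpa using hz
    have h6 := h.pos_Φ hΦ φ _ _ _ (G.κ_oriented i ‖z‖ ⟨h1, h5⟩ θ)
    let β : M → E3 [⋀^Fin 2]→L[ℝ] ℝ := G.baseTwoForm + (C • G.collarTwoForm + δ)
    have h7 : ∀ u v : E3, β (G.Φ φ (G.κ i ‖z‖ θ)) ![u, ‖z‖ • v] =
        ‖z‖ * β (G.Φ φ (G.κ i ‖z‖ θ)) ![u, v] := fun u v => by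
      rw [form_two_swap _ u, form_two_swap _ u, ContinuousAlternatingMap.vecCons_smul, smul_eq_mul,
        mul_neg]
    have h8 := mul_pos (show 0 < ‖z‖ by linarith) h6
    have h9 : ∀ {x x' : M} {u u' v v' : E3}, x = x' → u = u' → v = v' →
        β x ![u, v] = β x' ![u', v'] := by
      rintro _ _ _ _ _ _ rfl rfl rfl
      rfl
    exact h8.trans_eq ((h7 _ _).symm.trans (h9 h2 h3 h4))

theorem Admissible.positiveOnPages (h : G.Admissible C γ δ)
    (hΦ : ∀ t p, 0 < G.density (C • G.collarTwoForm + δ) (G.Φ t p)) {β : DiffForm (𝓡 3) M 2}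
    (hβ : ∀ x, ∃ r : ℝ, 0 < r ∧ β x = r • (G.baseTwoForm + (C • G.collarTwoForm + δ)) x) :
    G.PositiveOnPages β := by
  refine ⟨fun t p v w hvw => ?_, fun i θ z hz hz0 => ?_⟩
  · obtain ⟨r, hr, h1⟩ := hβ (G.Φ t p)
    rw [h1]
    exact mul_pos hr (h.pos_Φ hΦ t p v w hvw)
  · obtain ⟨r, hr, h1⟩ := hβ (G.σ i θ z)
    rw [G.mfderiv_σ_left i θ hz, G.mfderiv_σ_right i θ hz, h1]
    exact mul_pos hr (h.pos_σ hΦ i θ hz hz0)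

theorem Admissible.positiveOnBinding (h : G.Admissible C γ δ) {ε : ℝ} (hε : 0 ≤ ε) :
    G.PositiveOnBinding (G.baseForm + ε • (C • G.collarForm + γ)) := by
  intro i θ
  have hz1 : (0 : ℂ) ∈ Metric.ball (0 : ℂ) 1 := by simp
  have hz : (0 : ℂ) ∈ Metric.ball (0 : ℂ) 2 := by simp
  have h1 := (h.eq_zero i _ (G.mem_openSolid.2 ⟨θ, 0, hz1, rfl⟩)).1
  rw [G.mfderiv_σ_left i θ hz]
  have h2 := G.baseForm_σ i θ hz (1, 0)
  have h3 := G.collarForm_σ i θ hz (1, 0)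
  change 0 < G.baseForm (G.σ i θ 0) ![G.dσ i θ 0 (1, 0)] +
    ε * (C * G.collarForm (G.σ i θ 0) ![G.dσ i θ 0 (1, 0)] +
      γ (G.σ i θ 0) ![G.dσ i θ 0 (1, 0)])
  rw [h1, h2, h3]
  have h4 := coreProfile_pos zero_lt_one
  have h5 := h.nonneg
  have h6 := Real.pi_pos
  have h7 : (0 : TangentSpace (𝓡 3) (G.σ i θ 0) [⋀^Fin 1]→L[ℝ] ℝ) ![G.dσ i θ 0 (1, 0)] = 0 := rfl
  rw [h7]
  simp
  positivity

end Gluing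

end Taming

end OpenBook

end

open OpenBook in
theorem mainTheorem2 {P : Type*} [TopologicalSpace P] [ChartedSpace (EuclideanHalfSpace 2) P]
    [IsManifold (𝓡∂ 2) ∞ P] [T2Space P] [CompactSpace P] (A : AbstractOpenBook P)
    {M : Type*} [TopologicalSpace M] [ChartedSpace (EuclideanSpace ℝ (Fin 3)) M]
    [IsManifold (𝓡 3) ∞ M] [T2Space M] [CompactSpace M] (G : Gluing A M) :
    ∃ (H₀ : StableHamiltonianStructure M G.vol) (H : ℝ → StableHamiltonianStructure M G.vol)
      (ε₀ : ℝ), 0 < ε₀ ∧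
      G.ExtendsVertical H₀.ξ ∧ G.PositivelyTransverse H₀.X ∧ IsConfoliation G.vol H₀.ξ ∧
      (∀ ε ∈ Set.Ioo 0 ε₀, IsContactStructure G.vol (H ε).ξ ∧ G.Supports (H ε).ξ) ∧
      SHSTendsto H H₀ := by
  obtain ⟨C, γ, δ, h, hΦ⟩ := G.exists_admissible
  choose c hc hc1 hc2 using h.exists_proportional
  obtain ⟨H₀, H, ε₀, hε₀, hξ, hX, hconf, hH, hlim⟩ := exists_family_of_proportional G.vol_ne_zero
    G.generated_baseForm ((G.generated_collarForm.smul C).add h.generated) c hc hc1 hc2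
    fun x u v w hv => by
      rw [topForm_apply, Gluing.wedge_eq_density]
      exact mul_pos (h.density_pos hΦ x) hv
  refine ⟨H₀, H, ε₀, hε₀, hξ ▸ G.extendsVertical, h.positivelyTransverse hΦ hX, hconf,
    fun ε hε => ?_, hlim⟩
  obtain ⟨h1, h2, h3, h4⟩ := hH ε hε
  exact ⟨⟨_, h1, h2⟩, _, h1, h2, h3 ▸ h.positiveOnPages hΦ h4, h.positiveOnBinding hε.1.le⟩
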